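/- Let $N\ge 2$ and $a\in(-1,1)$. Write points of $\mathbb R^{N+1}$ as $z=(x,y)$ with $x\in\mathbb R^N$, $y\in\mathbb R$, let $S^N_+=\{z=(x,y): |z|=1,\ y>0\}$ be the open upper unit hemisphere with surface measure $dS$, and let $$H^{1;a}(S^N_+)=\Big\{u:S^N_+\to\mathbb R \ :\ \int_{S^N_+}y^a|\nabla_{S^N}u|^2\,dS+\int_{S^N_+}y^a u^2\,dS<+\infty\Big\},$$ where $\nabla_{S^N}u$ is the weak tangential gradient. For $y\in[0,1)$ let $S^{N-1}_y=\{z\in S^N: z=(x,y)\}$, a round $(N-1)$-sphere of radius $\sqrt{1-y^2}$, and let $z_y=(\sqrt{1-y^2},0,\dots,0,y)\in S^{N-1}_y$. For a set $A\subset S^{N-1}_y$ of positive $(N-1)$-dimensional measure let $A^*$ be the closed geodesic ball of $S^{N-1}_y$ centred at $z_y$ with the same $(N-1)$-dimensional measure as $A$; if $A$ has measure zero let $A^*=\emptyset$. For a nonnegative measurable $u$ on $S^N_+$, its foliated Schwarz symmetrization $u^*$ is the function which on each parallel is the symmetric decreasing rearrangement of $u$ about $z_y$, i.e. for $z=(x,y)\in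 S^N_+$ $$u^*(z)=\sup\big\{t\ge 0 \ :\ z\in(\{u>t\}\cap S^{N-1}_y)^*\big\}$$ (with $\sup\emptyset=0$), which is defined up to a set of measure zero. If $u\in H^{1;a}(S^N_+)$ is nonnegative, then $u^*\in H^{1;a}(S^N_+)$, $u^*$ is nonnegative, and $$\int_{S^N_+}y^a|\nabla_{S^N}u^*|^2\,dS\le\int_{S^N_+}y^a|\nabla_{S^N}u|^2\,dS.$$ -/

import Mathlib

open MeasureTheory Set
open scoped ENNReal

noncomputable section

namespace FoliatedSchwarz

/-- The ambient space `ℝ^(N+1)` of points `z = (x, y)`, with `x = (z 0, …, z (N-1)) ∈ ℝ^N`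
and `y = z (Fin.last N) ∈ ℝ`. -/
abbrev Amb (N : ℕ) : Type := EuclideanSpace ℝ (Fin (N + 1))

/-- The last coordinate `y` of `z = (x, y)`. -/
def height {N : ℕ} (z : Amb N) : ℝ := z (Fin.last N)

/-- The open upper hemisphere `S^N_+ = S^N ∩ {y > 0}`. -/
def hemisphere (N : ℕ) : Set (Amb N) := {z | ‖z‖ = 1 ∧ 0 < height z}

/-- The surface measure of the unit sphere `S^N`, as a measure on the ambient space. -/
def sphereMeasure (N : ℕ) : Measure (Amb N) :=
  ((volume : Measure (Amb N)).toSphere).map Subtype.val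

/-- The surface measure `dS` on the hemisphere `S^N_+`. -/
def surface (N : ℕ) : Measure (Amb N) := (sphereMeasure N).restrict (hemisphere N)

/-- The weighted measure `dμ = y^a dS` on the hemisphere. -/
def weighted (N : ℕ) (a : ℝ) : Measure (Amb N) :=
  (surface N).withDensity fun z => ENNReal.ofReal (height z ^ a)

/-- Smooth tangent vector fields with compact support in the open hemisphere, written as
restrictions of smooth fields of the ambient space with compact support in `{y > 0}`. -/
structure IsTestField {N : ℕ} (X : Amb N → Amb N) : Prop where
  smooth : ContDiff ℝ ((⊤ : ℕ∞) : WithTop ℕ∞) X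
  compact : HasCompactSupport X
  support : tsupport X ⊆ {z | 0 < height z}
  tangent : ∀ z, ‖z‖ = 1 → inner ℝ z (X z) = 0

/-- The divergence on the unit sphere: the trace of `DX(z)` over the tangent space `z^⊥`
of the sphere at `z`, that is, the full trace minus the normal contribution. -/
def sphereDiv {N : ℕ} (X : Amb N → Amb N) (z : Amb N) : ℝ :=
  (∑ i, (fderiv ℝ X z (EuclideanSpace.single i 1)) i) - inner ℝ z (fderiv ℝ X z z)

/-- `G` is the weak tangential gradient `∇_{S^N} u` of `u` on the open hemisphere: it is tangent
to the sphere and `∫ u div X dS = - ∫ ⟨G, X⟩ dS` for every test field `X`. Only the values of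
`u` and `G` on the hemisphere matter. -/
structure IsWeakGradient {N : ℕ} (u : Amb N → ℝ) (G : Amb N → Amb N) : Prop where
  locInt : LocallyIntegrableOn u (hemisphere N) (sphereMeasure N)
  locInt_grad : LocallyIntegrableOn G (hemisphere N) (sphereMeasure N)
  tangent : ∀ᵐ z ∂(surface N), inner ℝ z (G z) = 0
  byParts : ∀ X : Amb N → Amb N, IsTestField X →
    ∫ z, u z * sphereDiv X z ∂(surface N) = - ∫ z, inner ℝ (G z) (X z) ∂(surface N)

/-- The weighted Sobolev space `H^{1;a}(S^N_+)`: `u` and its weak tangential gradient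
are square integrable with respect to `y^a dS`. -/
def MemH1 {N : ℕ} (a : ℝ) (u : Amb N → ℝ) : Prop :=
  MemLp u 2 (weighted N a) ∧ ∃ G, IsWeakGradient u G ∧ MemLp G 2 (weighted N a)

/-- The parallel `S^{N-1}_y = S^N ∩ {height = y}`. -/
def slice (N : ℕ) (y : ℝ) : Set (Amb N) := {z | ‖z‖ = 1 ∧ height z = y}

/-- The point `(√(1 - y²) θ, y)` of the parallel `S^{N-1}_y`, for `θ` in the unit sphere
of `ℝ^N`. -/
def slicePoint {N : ℕ} (y : ℝ) (θ : Metric.sphere (0 : EuclideanSpace ℝ (Fin N)) 1) : Amb N :=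
  WithLp.toLp 2 (Fin.snoc (α := fun _ => ℝ) (fun i => √(1 - y ^ 2) * θ.1 i) y)

/-- The `(N-1)`-dimensional surface measure of the parallel `S^{N-1}_y`, a round sphere of
radius `√(1 - y²)`, as a measure on the ambient space. -/
def sliceMeasure (N : ℕ) (y : ℝ) : Measure (Amb N) :=
  ENNReal.ofReal (√(1 - y ^ 2) ^ (N - 1)) •
    ((volume : Measure (EuclideanSpace ℝ (Fin N))).toSphere).map (slicePoint y)

/-- The centre `z_y = (√(1 - y²), 0, …, 0, y)` of the balls in `S^{N-1}_y`; for `y = 0` it is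
the point of the closed hemisphere in `{x₁ > 0}` at maximal distance from `{x₁ = 0}`. -/
def slicePole (N : ℕ) (y : ℝ) : Amb N :=
  EuclideanSpace.single 0 (√(1 - y ^ 2)) + EuclideanSpace.single (Fin.last N) y

/-- The closed ball of `S^{N-1}_y` about `z_y` of chordal radius `r`. Since chordal distance is an
increasing function of geodesic distance, these are the closed geodesic balls. -/
def sliceBall (N : ℕ) (y r : ℝ) : Set (Amb N) :=
  slice N y ∩ Metric.closedBall (slicePole N y) r

/-- The least radius for which the ball has at least the measure of `A ∩ S^{N-1}_y`; that ball
then has exactly this measure. -/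
def symmRadius {N : ℕ} (y : ℝ) (A : Set (Amb N)) : ℝ :=
  sInf {r : ℝ | 0 ≤ r ∧ sliceMeasure N y A ≤ sliceMeasure N y (sliceBall N y r)}

/-- The symmetrization `(A ∩ S^{N-1}_y)^*`: the closed geodesic ball of `S^{N-1}_y` centred at `z_y`
with the same `(N-1)`-dimensional measure as `A ∩ S^{N-1}_y` (empty if that measure is zero). -/
def symmSet {N : ℕ} (y : ℝ) (A : Set (Amb N)) : Set (Amb N) :=
  {z | sliceMeasure N y A ≠ 0 ∧ z ∈ sliceBall N y (symmRadius y A)}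

/-- The foliated Schwarz symmetrization `u^*`: on each parallel it is the symmetric decreasing
rearrangement of `u`, that is, `u^*(z) = sup {t ≥ 0 | z ∈ ({u > t} ∩ S^{N-1}_y)^*}` with `y` the
height of `z`. The supremum of the empty set is `0`; the supremum can be infinite only at the
centres `z_y`, which form a null set. -/
def symmetrization {N : ℕ} (u : Amb N → ℝ) (z : Amb N) : ℝ :=
  sSup {t : ℝ | 0 ≤ t ∧ z ∈ symmSet (height z) {w | t < u w}}

/-- The weighted Dirichlet integral `∫_{S^N_+} y^a |G|² dS` of a gradient field `G`. -/
def weightedEnergy {N : ℕ} (a : ℝ) (G : Amb N → Amb N) : ℝ≥0∞ :=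
  ∫⁻ z, ENNReal.ofReal (height z ^ a * ‖G z‖ ^ 2) ∂(surface N)

end FoliatedSchwarz

end

/-!
Symmetrization decreases the weighted Dirichlet integral because it is a limit of polarizations.
For a reflection `σ` of `ℝ^N`, acting on `ℝ^(N+1)` without changing the height, the polarization of
`v` puts the larger of the values `v z`, `v (σ z)` at that of the points `z`, `σ z` which has the
larger first coordinate, that is, which is closer to the centre `z_y`. Where a Lipschitz function
and its polarization are differentiable, the norms of the gradients at `z` and `σ z` are only
permuted, so no energy is gained for weights invariant under `σ` (`ambEnergy_polarizeAmb_le`); no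
isoperimetric inequality or coarea formula is needed.

Polarizing also brings `v` closer, in `L¹`, to its rearrangement on the orbits of the rotations of
`ℝ^N`. Averaged over all reflections, the gain is at least a multiple of the square of the distance
(`sq_le_lintegral_gain`), because the images of a point under random reflections are spread over
the whole orbit (`isSpreading_sphRefl`). Hence finitely many polarizations come as close to the
rearrangement as desired (`exists_list_polarizeProd_close`).

The energy bound survives the limit in its dual form: if `‖Y‖² ≤ W q`, then
`-2 ∫ v div Y ≤ ∫ W ‖∇v‖² + ∫ q`, and the left side is continuous in `L¹`. This gives the bound for
rearrangements of Lipschitz functions (`star_energy_of_lipschitz`). Since the rearrangement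
contracts `L¹` distances (`lintegral_abs_rearr_sub_le`), it also holds for limits of Lipschitz
functions of controlled energy (`star_energy_of_approx`).

A function on the hemisphere enters through its `0`-homogeneous extension, which has a weak
gradient on the upper half-space (`IsWeakGradient.hasWeakGradientOn`) and can be mollified
(`exists_lipschitz_approx`). In cylindrical coordinates the symmetrization is the rearrangement on
the orbits (`ae_symmetrization_direction_cyl`). Test fields on the hemisphere are extended
homogeneously and cut off to a conical annulus, on which all integrals are one and the same multiple
of integrals over the hemisphere. So the distributional gradient of the symmetrization is bounded
in the dual norm (`dual_energy_bound`), and the Riesz representation theorem in `L²(y^(-a) dS)`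
turns it into a weak gradient whose energy is at most that of `u`
(`exists_isWeakGradient_of_dual_bound`). Equimeasurability on the parallels preserves the weighted
`L²` norm (`lintegral_sq_symmetrization`), and weak gradients are unique (`IsWeakGradient.ae_eq`),
so the inequality holds for every choice of them.
-/

noncomputable section

namespace FoliatedSchwarz

open Filter Topology

/-! ### Rearrangement on a finite measure space along a height function -/

section Rearrangement

variable {S : Type*} [MeasurableSpace S]

/-- The measure of the part of the space lying strictly higher than `θ`. On the sphere, with height
`⟨θ, p⟩`, it is the measure of the open cap about `p` with `θ` on its boundary. -/
def capMeasure (m : Measure S) (h : S → ℝ) (θ : S) : ℝ≥0∞ := m {θ' | h θ < h θ'}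

/-- The rearrangement of the nonnegative function `f` which increases with the height `h`. The
defining property is that `{rearr m h f > s}` is `{capMeasure m h < m {f > s}}`; where the set
below is unbounded, which happens at most where `capMeasure` vanishes, the supremum is `0`. -/
def rearr (m : Measure S) (h : S → ℝ) (f : S → ℝ) (θ : S) : ℝ :=
  sSup {t : ℝ | 0 ≤ t ∧ capMeasure m h θ < m {θ' | t < f θ'}}

variable {m : Measure S} {h : S → ℝ}

lemma capMeasure_anti {θ θ' : S} (hle : h θ ≤ h θ') : capMeasure m h θ' ≤ capMeasure m h θ :=
  measure_mono fun _ hx => lt_of_le_of_lt hle hx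

lemma measurable_heightTail (m : Measure S) (h : S → ℝ) :
    Measurable fun s : ℝ => m {θ' | s < h θ'} := by
  have : Antitone fun s : ℝ => m {θ' | s < h θ'} :=
    fun a b hab => measure_mono fun _ hx => lt_of_le_of_lt hab hx
  exact this.measurable

lemma measurable_capMeasure (hm : Measurable h) : Measurable (capMeasure m h) :=
  (measurable_heightTail m h).comp hm

lemma measure_Ioi_eq_iSup (f : S → ℝ) (s : ℝ) :
    m {θ | s < f θ} = ⨆ n : ℕ, m {θ | s + 1 / ((n : ℝ) + 1) < f θ} := by
  have hmono : Monotone fun n : ℕ => {θ | s + 1 / ((n : ℝ) + 1) < f θ} := by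
    intro a b hab θ hθ
    have h1 : (1 : ℝ) / ((b : ℝ) + 1) ≤ 1 / ((a : ℝ) + 1) := by
      apply one_div_le_one_div_of_le <;> [positivity; (gcongr)]
    have h2 : s + 1 / ((a : ℝ) + 1) < f θ := hθ
    show s + 1 / ((b : ℝ) + 1) < f θ
    linarith
  rw [← hmono.measure_iUnion]
  congr 1
  ext θ
  simp only [mem_ofPred_eq, mem_iUnion]
  constructor
  · intro hs
    obtain ⟨n, hn⟩ := exists_nat_one_div_lt (sub_pos.2 hs)
    exact ⟨n, by linarith⟩
  · rintro ⟨n, hn⟩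
    have : (0 : ℝ) < 1 / ((n : ℝ) + 1) := by positivity
    linarith

lemma exists_gt_of_lt_measure {f : S → ℝ} {s : ℝ} {c : ℝ≥0∞} (hc : c < m {θ | s < f θ}) :
    ∃ t, s < t ∧ c < m {θ | t < f θ} := by
  rw [measure_Ioi_eq_iSup, lt_iSup_iff] at hc
  obtain ⟨n, hn⟩ := hc
  exact ⟨_, by have : (0 : ℝ) < 1 / ((n : ℝ) + 1) := by positivity
               linarith, hn⟩

lemma rearr_nonneg (f : S → ℝ) (θ : S) : 0 ≤ rearr m h f θ :=
  Real.sSup_nonneg fun _ ht => ht.1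

lemma bddAbove_rearr_of_measure_le {f : S → ℝ} {θ : S} {t : ℝ}
    (ht : m {θ' | t < f θ'} ≤ capMeasure m h θ) :
    BddAbove {t : ℝ | 0 ≤ t ∧ capMeasure m h θ < m {θ' | t < f θ'}} :=
  ⟨t, fun _ hs => not_lt.1 fun hc => not_lt.2 ht (hs.2.trans_le
    (measure_mono fun _ hx => lt_trans hc hx))⟩

lemma lt_rearr_iff_of_bddAbove {f : S → ℝ} {θ : S} {s : ℝ} (hs : 0 ≤ s)
    (hb : BddAbove {t : ℝ | 0 ≤ t ∧ capMeasure m h θ < m {θ' | t < f θ'}}) :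
    s < rearr m h f θ ↔ capMeasure m h θ < m {θ' | s < f θ'} := by
  constructor
  · intro hlt
    have hne : {t : ℝ | 0 ≤ t ∧ capMeasure m h θ < m {θ' | t < f θ'}}.Nonempty := by
      by_contra hc
      rw [rearr, not_nonempty_iff_eq_empty.1 hc, Real.sSup_empty] at hlt
      exact not_lt.2 hs hlt
    obtain ⟨t, ht, hst⟩ := exists_lt_of_lt_csSup hne hlt
    exact ht.2.trans_le (measure_mono fun _ hx => lt_trans hst hx)
  · intro hlt
    obtain ⟨t, hst, ht⟩ := exists_gt_of_lt_measure hlt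
    exact lt_of_lt_of_le hst (le_csSup hb ⟨hs.trans hst.le, ht⟩)

lemma ofReal_abs_sub_eq_lintegral {a b : ℝ} (ha : 0 ≤ a) (hb : 0 ≤ b) :
    ENNReal.ofReal |a - b| = ∫⁻ t in Ici (0 : ℝ),
      ((Ico b a).indicator 1 t + (Ico a b).indicator 1 t) := by
  rw [lintegral_add_left (measurable_one.indicator measurableSet_Ico),
    lintegral_indicator_one measurableSet_Ico, lintegral_indicator_one measurableSet_Ico,
    Measure.restrict_apply measurableSet_Ico, Measure.restrict_apply measurableSet_Ico,
    inter_eq_left.2 (show Ico b a ⊆ Ici 0 from fun t ht => hb.trans ht.1),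
    inter_eq_left.2 (show Ico a b ⊆ Ici 0 from fun t ht => ha.trans ht.1),
    Real.volume_Ico, Real.volume_Ico]
  rcases le_total a b with hab | hab
  · rw [ENNReal.ofReal_of_nonpos (by linarith : a - b ≤ 0), zero_add, abs_sub_comm,
      abs_of_nonneg (by linarith)]
  · rw [ENNReal.ofReal_of_nonpos (by linarith : b - a ≤ 0), add_zero,
      abs_of_nonneg (by linarith)]

lemma measurable_indicator_Ico {T : Type*} [MeasurableSpace T] {f g : T → ℝ} (hf : Measurable f)
    (hg : Measurable g) :
    Measurable fun z : T × ℝ => (Ico (f z.1) (g z.1)).indicator (1 : ℝ → ℝ≥0∞) z.2 := by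
  have h1 : (fun z : T × ℝ => (Ico (f z.1) (g z.1)).indicator (1 : ℝ → ℝ≥0∞) z.2) =
      {z : T × ℝ | f z.1 ≤ z.2 ∧ z.2 < g z.1}.indicator 1 := by
    ext z
    simp only [indicator, mem_Ico, mem_ofPred_eq, Pi.one_apply]
  rw [h1]
  exact measurable_one.indicator ((measurableSet_le (hf.comp measurable_fst) measurable_snd).inter
    (measurableSet_lt measurable_snd (hg.comp measurable_fst)))

lemma lt_rearr_iff_of_le {f : S → ℝ} {M : ℝ} (hM : ∀ θ, f θ ≤ M) {θ : S} {s : ℝ} (hs : 0 ≤ s) :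
    s < rearr m h f θ ↔ capMeasure m h θ < m {θ' | s < f θ'} := by
  refine lt_rearr_iff_of_bddAbove hs (bddAbove_rearr_of_measure_le (t := M) ?_)
  have : {θ' | M < f θ'} = ∅ := by ext θ'; simpa using hM θ'
  simp [this]

lemma rearr_mono_height {f : S → ℝ} {M : ℝ} (hM : ∀ θ, f θ ≤ M) {θ θ' : S}
    (hle : h θ ≤ h θ') : rearr m h f θ ≤ rearr m h f θ' := by
  by_contra hc
  have h1 := (lt_rearr_iff_of_le hM (rearr_nonneg f θ')).1 (not_le.1 hc)
  exact lt_irrefl _ ((lt_rearr_iff_of_le hM (rearr_nonneg f θ')).2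
    ((capMeasure_anti hle).trans_lt h1))

lemma rearr_le {f : S → ℝ} {M : ℝ} (hM0 : 0 ≤ M) (hM : ∀ θ, f θ ≤ M) (θ : S) :
    rearr m h f θ ≤ M := by
  by_contra hc
  have h1 := (lt_rearr_iff_of_le hM hM0).1 (not_le.1 hc)
  have : {θ' | M < f θ'} = ∅ := by ext θ'; simpa using hM θ'
  simp [this] at h1

variable [IsFiniteMeasure m]

lemma exists_nat_measure_lt {f : S → ℝ} (hf : Measurable f) {c : ℝ≥0∞} (hc : c ≠ 0) :
    ∃ n : ℕ, m {θ | (n : ℝ) < f θ} < c := by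
  have hanti : Antitone fun n : ℕ => {θ | (n : ℝ) < f θ} := fun a b hab θ hθ =>
    lt_of_le_of_lt (by exact_mod_cast hab) (show (b : ℝ) < f θ from hθ)
  have h1 := tendsto_measure_iInter_atTop (μ := m) (s := fun n : ℕ => {θ | (n : ℝ) < f θ})
    (fun n => (measurableSet_lt measurable_const hf).nullMeasurableSet) hanti
    ⟨0, measure_ne_top _ _⟩
  have h2 : ⋂ n : ℕ, {θ | (n : ℝ) < f θ} = ∅ := by
    ext θ
    simp only [mem_iInter, mem_ofPred_eq, mem_empty_iff_false, iff_false, not_forall, not_lt]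
    exact exists_nat_ge _
  rw [h2, measure_empty] at h1
  exact ((tendsto_order.1 h1).2 c (pos_iff_ne_zero.2 hc)).exists

/-- `capMeasure` is uniformly distributed: the level sets of the height are null, so its
distribution function is continuous. -/
lemma measure_capMeasure_lt (hm : Measurable h) (hh : ∀ s, m {θ | h θ = s} = 0) {α : ℝ≥0∞}
    (hα : α ≤ m univ) : m {θ | capMeasure m h θ < α} = α := by
  rcases eq_or_ne α 0 with rfl | hα0
  · simp
  set g : ℝ → ℝ≥0∞ := fun s => m {θ' | s < h θ'} with hg
  have hgm : Antitone g := fun a b hab => measure_mono fun _ hx => lt_of_le_of_lt hab hx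
  set T : Set ℝ := {s | g s < α} with hT
  have hTne : T.Nonempty := by
    obtain ⟨n, hn⟩ := exists_nat_measure_lt (m := m) hm hα0
    exact ⟨n, hn⟩
  by_cases hTb : BddBelow T
  · set s₁ := sInf T
    have h1 : ∀ s, s₁ < s → g s < α := fun s hs => by
      obtain ⟨t, ht, hts⟩ := exists_lt_of_csInf_lt hTne hs
      exact lt_of_le_of_lt (hgm hts.le) ht
    have h2 : ∀ s, s < s₁ → α ≤ g s := fun s hs => not_lt.1 fun hc => not_le.2 hs (csInf_le hTb hc)
    have h3 : g s₁ ≤ α := by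
      rw [hg]
      beta_reduce
      rw [measure_Ioi_eq_iSup]
      exact iSup_le fun n => (h1 _ (by
        have : (0 : ℝ) < 1 / ((n : ℝ) + 1) := by positivity
        linarith)).le
    have h4 : α ≤ m {θ | s₁ ≤ h θ} := by
      have hanti : Antitone fun n : ℕ => {θ | s₁ - 1 / ((n : ℝ) + 1) < h θ} := by
        intro a b hab θ hθ
        have h1 : (1 : ℝ) / ((b : ℝ) + 1) ≤ 1 / ((a : ℝ) + 1) := by
          apply one_div_le_one_div_of_le <;> [positivity; (gcongr)]
        have h2 : s₁ - 1 / ((b : ℝ) + 1) < h θ := hθ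
        show s₁ - 1 / ((a : ℝ) + 1) < h θ
        linarith
      have h5 : {θ | s₁ ≤ h θ} = ⋂ n : ℕ, {θ | s₁ - 1 / ((n : ℝ) + 1) < h θ} := by
        ext θ
        simp only [mem_ofPred_eq, mem_iInter]
        constructor
        · intro hs n
          have : (0 : ℝ) < 1 / ((n : ℝ) + 1) := by positivity
          linarith
        · intro hs
          by_contra hc
          obtain ⟨n, hn⟩ := exists_nat_one_div_lt (sub_pos.2 (not_le.1 hc))
          linarith [hs n]
      rw [h5]
      refine ge_of_tendsto' (tendsto_measure_iInter_atTop
        (fun n => (measurableSet_lt measurable_const hm).nullMeasurableSet) hanti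
        ⟨0, measure_ne_top _ _⟩) fun n => h2 _ (by
        have : (0 : ℝ) < 1 / ((n : ℝ) + 1) := by positivity
        linarith)
    have h5 : m {θ | s₁ ≤ h θ} ≤ g s₁ := by
      calc m {θ | s₁ ≤ h θ} ≤ m ({θ | s₁ < h θ} ∪ {θ | h θ = s₁}) :=
            measure_mono fun θ hθ => (lt_or_eq_of_le (show s₁ ≤ h θ from hθ)).imp id Eq.symm
        _ ≤ g s₁ + m {θ | h θ = s₁} := measure_union_le _ _
        _ = g s₁ := by rw [hh, add_zero]
    apply le_antisymm
    · exact (measure_mono fun θ hθ => not_lt.1 fun hc => not_le.2 hθ (h2 _ hc)).trans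
        (h5.trans h3)
    · exact (h4.trans h5).trans (measure_mono fun θ hθ => h1 _ hθ)
  · have hall : ∀ s, g s < α := fun s => by
      obtain ⟨t, ht, hts⟩ := not_bddBelow_iff.1 hTb s
      exact lt_of_le_of_lt (hgm hts.le) ht
    have h1 : {θ | capMeasure m h θ < α} = univ := eq_univ_of_forall fun θ => hall _
    rw [h1]
    refine le_antisymm ?_ hα
    have h2 := tendsto_measure_iUnion_atTop (μ := m) (s := fun n : ℕ => {θ | -(n : ℝ) < h θ})
      (fun a b hab θ hθ => by
        have h3 : (a : ℝ) ≤ b := by exact_mod_cast hab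
        have h4 : -(a : ℝ) < h θ := hθ
        show -(b : ℝ) < h θ
        linarith)
    have h3 : ⋃ n : ℕ, {θ | -(n : ℝ) < h θ} = univ := by
      refine eq_univ_of_forall fun θ => ?_
      obtain ⟨n, hn⟩ := exists_nat_gt (-h θ)
      exact mem_iUnion.2 ⟨n, by show -(n : ℝ) < h θ; linarith⟩
    rw [h3] at h2
    exact le_of_tendsto' h2 fun n => (hall _).le

lemma measure_capMeasure_eq (hm : Measurable h) (hh : ∀ s, m {θ | h θ = s} = 0) (α : ℝ≥0∞) :
    m {θ | capMeasure m h θ = α} = 0 := by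
  have hle : ∀ θ, capMeasure m h θ ≤ m univ := fun θ => measure_mono (subset_univ _)
  rcases lt_or_ge (m univ) α with hα | hα
  · convert measure_empty (μ := m)
    ext θ
    simpa using (lt_of_le_of_lt (hle θ) hα).ne
  have key : m {θ | capMeasure m h θ ≤ α} ≤ α := by
    refine ENNReal.le_of_forall_pos_le_add fun ε hε _ => ?_
    rcases le_or_gt (α + ε) (m univ) with h1 | h1
    · refine le_trans (measure_mono ?_) (measure_capMeasure_lt hm hh h1).le
      intro θ hθ
      exact lt_of_le_of_lt hθ (ENNReal.lt_add_right
        (ne_top_of_le_ne_top (measure_ne_top m univ) hα) (by simpa using hε.ne'))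
    · exact (measure_mono (subset_univ _)).trans h1.le
  have h2 : {θ | capMeasure m h θ = α} =
      {θ | capMeasure m h θ ≤ α} \ {θ | capMeasure m h θ < α} := by
    ext θ
    simp only [mem_ofPred_eq, Set.mem_sdiff, not_lt]
    exact ⟨fun h => ⟨h.le, h.ge⟩, fun h => le_antisymm h.1 h.2⟩
  have h3 : {θ | capMeasure m h θ < α} ⊆ {θ | capMeasure m h θ ≤ α} := fun θ hθ =>
    le_of_lt (show capMeasure m h θ < α from hθ)
  rw [h2, measure_sdiff h3
    (measurableSet_lt (measurable_capMeasure hm) measurable_const).nullMeasurableSet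
    (measure_ne_top _ _), measure_capMeasure_lt hm hh hα]
  exact tsub_eq_zero_of_le key

lemma ae_capMeasure_ne_zero (hm : Measurable h) (hh : ∀ s, m {θ | h θ = s} = 0) :
    ∀ᵐ θ ∂m, capMeasure m h θ ≠ 0 := by
  rw [ae_iff]
  simpa using measure_capMeasure_eq hm hh 0

lemma lt_rearr_iff {f : S → ℝ} (hf : Measurable f) {θ : S} (hθ : capMeasure m h θ ≠ 0)
    {s : ℝ} (hs : 0 ≤ s) :
    s < rearr m h f θ ↔ capMeasure m h θ < m {θ' | s < f θ'} := by
  obtain ⟨n, hn⟩ := exists_nat_measure_lt (m := m) hf hθ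
  exact lt_rearr_iff_of_bddAbove hs (bddAbove_rearr_of_measure_le hn.le)

lemma measure_lt_rearr (hm : Measurable h) (hh : ∀ s, m {θ | h θ = s} = 0) {f : S → ℝ}
    (hf : Measurable f) {s : ℝ} (hs : 0 ≤ s) :
    m {θ | s < rearr m h f θ} = m {θ | s < f θ} := by
  rw [← measure_capMeasure_lt hm hh (measure_mono (subset_univ {θ | s < f θ}))]
  apply measure_congr
  filter_upwards [ae_capMeasure_ne_zero hm hh] with θ hθ
  exact propext (lt_rearr_iff hf hθ hs)

/-- At points whose cap does not have the measure of a superlevel set at a rational level, the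
superlevel sets in the definition of the rearrangement may be replaced by any sets between the open
and the closed ones. -/
lemma sSup_eq_rearr {f : S → ℝ} (hf : Measurable f) {θ : S} (hθ0 : capMeasure m h θ ≠ 0)
    (hθ : ∀ q : ℚ, capMeasure m h θ ≠ m {θ' | (q : ℝ) < f θ'}) {T : Set ℝ}
    (hT1 : {t : ℝ | 0 ≤ t ∧ capMeasure m h θ < m {θ' | t < f θ'}} ⊆ T)
    (hT2 : T ⊆ {t : ℝ | 0 ≤ t ∧ capMeasure m h θ ≤ m {θ' | t < f θ'}}) :
    sSup T = rearr m h f θ := by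
  obtain ⟨n, hn⟩ := exists_nat_measure_lt (m := m) hf hθ0
  have hb := bddAbove_rearr_of_measure_le hn.le
  have hbT : BddAbove T := ⟨n, fun t ht => not_lt.1 fun hc => not_lt.2 (hT2 ht).2
    (lt_of_le_of_lt (measure_mono fun _ hx => lt_trans hc hx) hn)⟩
  apply le_antisymm
  · rcases T.eq_empty_or_nonempty with rfl | hne
    · rw [Real.sSup_empty]; exact rearr_nonneg _ _
    refine csSup_le hne fun t ht => ?_
    by_contra hc
    obtain ⟨q, hq1, hq2⟩ := exists_rat_btwn (not_le.1 hc)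
    have hq0 : (0 : ℝ) ≤ q := (rearr_nonneg f θ).trans hq1.le
    have h3 : capMeasure m h θ < m {θ' | (q : ℝ) < f θ'} :=
      lt_of_le_of_ne ((hT2 ht).2.trans (measure_mono fun _ hx => lt_trans hq2 hx)) (hθ q)
    exact not_le.2 hq1 (le_csSup hb ⟨hq0, h3⟩)
  · rcases eq_empty_or_nonempty {t : ℝ | 0 ≤ t ∧ capMeasure m h θ < m {θ' | t < f θ'}}
      with he | hne
    · rw [rearr, he, Real.sSup_empty]
      exact Real.sSup_nonneg fun t ht => (hT2 ht).1
    · exact csSup_le_csSup hbT hne hT1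

/-- Layer-cake formula for the `L¹` distance of two nonnegative functions. -/
lemma lintegral_abs_sub_eq {f g : S → ℝ} (hf : AEMeasurable f m) (hg : AEMeasurable g m)
    (hf0 : ∀ᵐ θ ∂m, 0 ≤ f θ) (hg0 : ∀ᵐ θ ∂m, 0 ≤ g θ) :
    ∫⁻ θ, ENNReal.ofReal |f θ - g θ| ∂m = ∫⁻ t in Ici (0 : ℝ),
      (m {θ | t < f θ ∧ g θ ≤ t} + m {θ | t < g θ ∧ f θ ≤ t}) := by
  wlog hmeas : Measurable f ∧ Measurable g generalizing f g
  · have e1 := hf.ae_eq_mk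
    have e2 := hg.ae_eq_mk
    have := this (f := hf.mk f) (g := hg.mk g) hf.measurable_mk.aemeasurable
      hg.measurable_mk.aemeasurable (by filter_upwards [e1, hf0] with θ h1 h2; rwa [← h1])
      (by filter_upwards [e2, hg0] with θ h1 h2; rwa [← h1])
      ⟨hf.measurable_mk, hg.measurable_mk⟩
    rw [lintegral_congr_ae (g := fun θ => ENNReal.ofReal |hf.mk f θ - hg.mk g θ|)
      (by filter_upwards [e1, e2] with θ h1 h2; rw [h1, h2]), this]
    refine lintegral_congr fun t => ?_
    congr 1 <;>
    · apply measure_congr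
      filter_upwards [e1, e2] with θ h1 h2
      apply propext
      change (_ < _ ∧ _ ≤ _) ↔ (_ < _ ∧ _ ≤ _)
      rw [h1, h2]
  obtain ⟨hf', hg'⟩ := hmeas
  rw [lintegral_congr_ae (g := fun θ => ∫⁻ t in Ici (0 : ℝ),
      ((Ico (g θ) (f θ)).indicator 1 t + (Ico (f θ) (g θ)).indicator 1 t))
      (by filter_upwards [hf0, hg0] with θ h1 h2; exact ofReal_abs_sub_eq_lintegral h1 h2),
    lintegral_lintegral_swap]
  · refine lintegral_congr fun t => ?_
    have e1 : ∀ f g : S → ℝ, (fun θ => (Ico (g θ) (f θ)).indicator (1 : ℝ → ℝ≥0∞) t) =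
        {θ | t < f θ ∧ g θ ≤ t}.indicator 1 := fun f g => by
      ext θ
      simp only [indicator, mem_Ico, mem_ofPred_eq, Pi.one_apply, and_comm]
    have m1 : ∀ f g : S → ℝ, Measurable f → Measurable g →
        MeasurableSet {θ | t < f θ ∧ g θ ≤ t} := fun f g hf hg =>
      (measurableSet_lt measurable_const hf).inter (measurableSet_le hg measurable_const)
    rw [lintegral_add_left (by rw [e1]; exact measurable_one.indicator (m1 f g hf' hg')), e1, e1,
      lintegral_indicator_one (m1 f g hf' hg'), lintegral_indicator_one (m1 g f hg' hf')]
  · exact ((measurable_indicator_Ico hg' hf').add (measurable_indicator_Ico hf' hg')).aemeasurable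

/-- The rearrangement contracts the `L¹` distance: the superlevel sets of two rearrangements are
nested. -/
lemma lintegral_abs_rearr_sub_le (hm : Measurable h) (hh : ∀ s, m {θ | h θ = s} = 0) {f g : S → ℝ}
    (hf : Measurable f) (hg : Measurable g) (hf0 : ∀ θ, 0 ≤ f θ) (hg0 : ∀ θ, 0 ≤ g θ)
    (hf' : Measurable (rearr m h f)) (hg' : Measurable (rearr m h g)) :
    ∫⁻ θ, ENNReal.ofReal |rearr m h f θ - rearr m h g θ| ∂m ≤
      ∫⁻ θ, ENNReal.ofReal |f θ - g θ| ∂m := by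
  rw [lintegral_abs_sub_eq hf'.aemeasurable hg'.aemeasurable
    (.of_forall fun _ => rearr_nonneg _ _) (.of_forall fun _ => rearr_nonneg _ _),
    lintegral_abs_sub_eq hf.aemeasurable hg.aemeasurable (.of_forall hf0) (.of_forall hg0)]
  refine setLIntegral_mono' measurableSet_Ici fun t ht => ?_
  -- One of the two difference sets of the rearrangements is null, the other one has the measure
  -- `m {f > t} - m {g > t}`.
  have key : ∀ f g : S → ℝ, Measurable f → Measurable g → Measurable (rearr m h f) →
      Measurable (rearr m h g) → m {θ | t < g θ} ≤ m {θ | t < f θ} →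
      m {θ | t < rearr m h f θ ∧ rearr m h g θ ≤ t} +
        m {θ | t < rearr m h g θ ∧ rearr m h f θ ≤ t} ≤ m {θ | t < f θ ∧ g θ ≤ t} := by
    intro f g hf hg hf' hg' hle
    have e1 : ∀ f g : S → ℝ, {θ | t < f θ ∧ g θ ≤ t} = {θ | t < f θ} \ {θ | t < g θ} := by
      intro f g; ext θ; simp
    have h0 : m {θ | t < rearr m h g θ ∧ rearr m h f θ ≤ t} = 0 := by
      rw [← nonpos_iff_eq_zero, ← measure_empty (μ := m)]
      refine (measure_mono_ae ?_)
      filter_upwards [ae_capMeasure_ne_zero hm hh] with θ hθ hc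
      have hc' : t < rearr m h g θ ∧ rearr m h f θ ≤ t := hc
      exact absurd ((lt_rearr_iff hf hθ ht).2 (((lt_rearr_iff hg hθ ht).1 hc'.1).trans_le hle))
        (not_lt.2 hc'.2)
    have h1 : m ({θ | t < rearr m h g θ} \ {θ | t < rearr m h f θ}) = 0 := by rw [← e1, h0]
    rw [h0, add_zero, e1, e1]
    calc m ({θ | t < rearr m h f θ} \ {θ | t < rearr m h g θ})
        = m {θ | t < rearr m h f θ} - m {θ | t < rearr m h g θ} := by
          refine measure_sdiff' _ (measurableSet_lt measurable_const hg').nullMeasurableSet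
            (measure_ne_top _ _) |>.trans ?_
          congr 1
          refine le_antisymm ?_ (measure_mono subset_union_left)
          rw [← union_sdiff_self]
          exact (measure_union_le _ _).trans (by rw [h1, add_zero])
      _ = m {θ | t < f θ} - m {θ | t < g θ} := by
          rw [measure_lt_rearr hm hh hf ht, measure_lt_rearr hm hh hg ht]
      _ ≤ _ := le_measure_sdiff
  rcases le_total (m {θ | t < g θ}) (m {θ | t < f θ}) with hle | hle
  · exact (key f g hf hg hf' hg' hle).trans le_self_add
  · rw [add_comm]
    exact (key g f hg hf hg' hf' hle).trans le_add_self

lemma measurable_rearr_prod (hm : Measurable h) {B : Type*} [MeasurableSpace B]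
    {f : B × S → ℝ} (hf : Measurable f) :
    Measurable fun x : B × S => rearr m h (fun θ => f (x.1, θ)) x.2 := by
  refine measurable_of_Ioi fun s => ?_
  have hF : ∀ t : ℝ, Measurable fun x : B × S => m {θ | t < f (x.1, θ)} := fun t =>
    (measurable_measure_prodMk_left (measurableSet_lt measurable_const hf)).comp measurable_fst
  have hc : Measurable fun x : B × S => capMeasure m h x.2 :=
    (measurable_capMeasure hm).comp measurable_snd
  rcases lt_or_ge s 0 with hs | hs
  · convert MeasurableSet.univ
    exact eq_univ_of_forall fun x => hs.trans_le (rearr_nonneg _ _)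
  · have h1 : (fun x : B × S => rearr m h (fun θ => f (x.1, θ)) x.2) ⁻¹' Ioi s =
        (⋃ n : ℕ, {x | m {θ | (n : ℝ) < f (x.1, θ)} ≤ capMeasure m h x.2}) ∩
          {x | capMeasure m h x.2 < m {θ | s < f (x.1, θ)}} := by
      ext x
      simp only [mem_preimage, mem_Ioi, mem_inter_iff, mem_iUnion, mem_ofPred_eq]
      constructor
      · intro hlt
        have hb : ∃ n : ℕ, m {θ | (n : ℝ) < f (x.1, θ)} ≤ capMeasure m h x.2 := by
          by_contra hcon
          push Not at hcon
          have : ¬ BddAbove {t : ℝ | 0 ≤ t ∧ capMeasure m h x.2 < m {θ | t < f (x.1, θ)}} := by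
            rintro ⟨K, hK⟩
            obtain ⟨n, hn⟩ := exists_nat_gt K
            exact not_le.2 hn (hK ⟨n.cast_nonneg, hcon n⟩)
          rw [rearr, Real.sSup_of_not_bddAbove this] at hlt
          exact not_lt.2 hs hlt
        obtain ⟨n, hn⟩ := hb
        exact ⟨⟨n, hn⟩, (lt_rearr_iff_of_bddAbove hs (bddAbove_rearr_of_measure_le hn)).1 hlt⟩
      · rintro ⟨⟨n, hn⟩, hlt⟩
        exact (lt_rearr_iff_of_bddAbove hs (bddAbove_rearr_of_measure_le hn)).2 hlt
    rw [h1]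
    exact (MeasurableSet.iUnion fun n => measurableSet_le (hF _) hc).inter
      (measurableSet_lt hc (hF _))

/-- In almost every point of a product, the hypotheses of `sSup_eq_rearr` hold for the section. -/
lemma ae_prod_capMeasure_ne (hm : Measurable h) (hh : ∀ s, m {θ | h θ = s} = 0) {B : Type*}
    [MeasurableSpace B] {β : Measure B} [SFinite β] {f : B × S → ℝ} (hf : Measurable f) :
    ∀ᵐ x ∂(β.prod m), capMeasure m h x.2 ≠ 0 ∧
      ∀ q : ℚ, capMeasure m h x.2 ≠ m {θ | (q : ℝ) < f (x.1, θ)} := by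
  have hc : Measurable fun x : B × S => capMeasure m h x.2 :=
    (measurable_capMeasure hm).comp measurable_snd
  refine Filter.Eventually.and (Measure.quasiMeasurePreserving_snd.ae
    (ae_capMeasure_ne_zero hm hh)) (ae_all_iff.2 fun q => ?_)
  have hF : Measurable fun x : B × S => m {θ | (q : ℝ) < f (x.1, θ)} :=
    (measurable_measure_prodMk_left (measurableSet_lt measurable_const hf)).comp measurable_fst
  rw [ae_iff]
  simp only [ne_eq, not_not]
  rw [Measure.measure_prod_null (measurableSet_eq_fun hc hF)]
  exact Filter.Eventually.of_forall fun b =>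
    measure_capMeasure_eq hm hh (m {θ | (q : ℝ) < f (b, θ)})

end Rearrangement

end FoliatedSchwarz

end
noncomputable section

namespace FoliatedSchwarz

open Filter Topology

/-! ### Polarization and its convergence to the rearrangement -/

section Polarization

/-- The polarization (two-point rearrangement) of `v` with respect to the involution `σ`: of the
two values of `v` on an orbit `{z, σ z}` the larger one is moved to the point of larger height.
Orbits on which the height is constant are left alone. -/
def polarize {T : Type*} (σ : T → T) (h : T → ℝ) (v : T → ℝ) (z : T) : ℝ :=
  if h (σ z) < h z then max (v z) (v (σ z))
  else if h z < h (σ z) then min (v z) (v (σ z)) else v z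

lemma polarize_comp {T U : Type*} {σ : T → T} {τ : U → U} {h : T → ℝ} {k : U → ℝ} (Φ : U → T)
    (h1 : ∀ z, σ (Φ z) = Φ (τ z)) (h2 : ∀ z, h (Φ (τ z)) < h (Φ z) ↔ k (τ z) < k z)
    (h3 : ∀ z, h (Φ z) < h (Φ (τ z)) ↔ k z < k (τ z)) (v : T → ℝ) :
    polarize σ h v ∘ Φ = polarize τ k (v ∘ Φ) := by
  ext z
  simp only [polarize, Function.comp, h1, h2, h3]

lemma le_polarize {T : Type*} {σ : T → T} {h v : T → ℝ} {a : ℝ} (ha : ∀ z, a ≤ v z) (z : T) :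
    a ≤ polarize σ h v z := by
  unfold polarize
  split_ifs
  · exact le_max_of_le_left (ha z)
  · exact le_min (ha z) (ha _)
  · exact ha z

lemma polarize_le {T : Type*} {σ : T → T} {h v : T → ℝ} {a : ℝ} (ha : ∀ z, v z ≤ a) (z : T) :
    polarize σ h v z ≤ a := by
  unfold polarize
  split_ifs
  · exact max_le (ha z) (ha _)
  · exact min_le_of_left_le (ha z)
  · exact ha z

lemma measurable_polarize {T : Type*} [MeasurableSpace T] {σ : T → T} {h v : T → ℝ}
    (hσ : Measurable σ) (hh : Measurable h) (hv : Measurable v) :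
    Measurable (polarize σ h v) :=
  Measurable.ite (measurableSet_lt (hh.comp hσ) hh) (hv.max (hv.comp hσ))
    (Measurable.ite (measurableSet_lt hh (hh.comp hσ)) (hv.min (hv.comp hσ)) hv)

/-- The two-point inequality: ordering the pair `α, β` like the pair `Y ≤ X` decreases the
`ℓ¹` distance by at least the length of the overlap of `[α, β]` and `[Y, X]`. -/
lemma two_point_ineq {α β X Y : ℝ} (h : Y ≤ X) :
    |max α β - X| + |min α β - Y| + max (min β X - max α Y) 0 ≤ |α - X| + |β - Y| := by
  rcases le_total α β with h1 | h1
  · rw [max_eq_right h1, min_eq_left h1]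
    rcases le_total (min β X - max α Y) 0 with h2 | h2
    · rw [max_eq_right h2]
      rcases abs_cases (β - X) with h3 | h3 <;> rcases abs_cases (α - Y) with h4 | h4 <;>
      rcases abs_cases (α - X) with h5 | h5 <;> rcases abs_cases (β - Y) with h6 | h6 <;> linarith
    · rw [max_eq_left h2]
      have h7 := min_le_left β X
      have h8 := min_le_right β X
      have h9 := le_max_left α Y
      have h10 := le_max_right α Y
      rcases abs_cases (β - X) with h3 | h3 <;> rcases abs_cases (α - Y) with h4 | h4 <;>
      rcases abs_cases (α - X) with h5 | h5 <;> rcases abs_cases (β - Y) with h6 | h6 <;> linarith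
  · rw [max_eq_left h1, min_eq_right h1, max_eq_right (b := (0 : ℝ)), add_zero]
    have h7 := min_le_left β X
    have h9 := le_max_left α Y
    linarith

/-- Polarizing `v` brings it closer to any function `b` that is nondecreasing in the height. The
gain at an orbit is at least the overlap of `[v z, v (σ z)]` and `[b (σ z), b z]`. -/
lemma polarize_gain {T : Type*} {σ : T → T} {h v b : T → ℝ} (hσ : ∀ z, σ (σ z) = z)
    {z : T} (hb : h (σ z) ≤ h z → b (σ z) ≤ b z) (hb' : h z ≤ h (σ z) → b z ≤ b (σ z)) :
    ENNReal.ofReal |polarize σ h v z - b z| + ENNReal.ofReal |polarize σ h v (σ z) - b (σ z)| +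
      ENNReal.ofReal (min (v (σ z)) (b z) - max (v z) (b (σ z))) ≤
    ENNReal.ofReal |v z - b z| + ENNReal.ofReal |v (σ z) - b (σ z)| := by
  rw [show ENNReal.ofReal (min (v (σ z)) (b z) - max (v z) (b (σ z))) =
      ENNReal.ofReal (max (min (v (σ z)) (b z) - max (v z) (b (σ z))) 0) by
        simp [ENNReal.ofReal, Real.toNNReal],
    ← ENNReal.ofReal_add (abs_nonneg _) (abs_nonneg _),
    ← ENNReal.ofReal_add (by positivity) (le_max_right _ _),
    ← ENNReal.ofReal_add (abs_nonneg _) (abs_nonneg _)]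
  apply ENNReal.ofReal_le_ofReal
  have h7 := min_le_right (v (σ z)) (b z)
  have h10 := le_max_right (v z) (b (σ z))
  rcases lt_trichotomy (h (σ z)) (h z) with h1 | h1 | h1
  · have e1 : polarize σ h v z = max (v z) (v (σ z)) := if_pos h1
    have e2 : polarize σ h v (σ z) = min (v z) (v (σ z)) := by
      rw [polarize, hσ, if_neg (not_lt.2 h1.le), if_pos h1, min_comm]
    rw [e1, e2]
    exact two_point_ineq (hb h1.le)
  · have e1 : polarize σ h v z = v z := by simp [polarize, h1]
    have e2 : polarize σ h v (σ z) = v (σ z) := by simp [polarize, hσ, h1]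
    rw [e1, e2, max_eq_right (by linarith [hb' h1.ge]), add_zero]
  · have e1 : polarize σ h v z = min (v z) (v (σ z)) := by
      rw [polarize, if_neg (not_lt.2 h1.le), if_pos h1]
    have e2 : polarize σ h v (σ z) = max (v z) (v (σ z)) := by
      rw [polarize, hσ, if_pos h1, max_comm]
    have hz : max (min (v (σ z)) (b z) - max (v z) (b (σ z))) 0 = 0 :=
      max_eq_right (by linarith [hb' h1.le])
    rw [e1, e2, hz, add_zero]
    have := two_point_ineq (α := v (σ z)) (β := v z) (hb' h1.le)
    rw [max_comm, min_comm] at this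
    have h0 := le_max_right (min (v z) (b (σ z)) - max (v (σ z)) (b z)) 0
    linarith

/-- A measurable family of measure preserving involutions of `S` which spreads every point over
all of `S`: the images of a point under the involutions, taken with respect to the measure `ℓ` on
the parameters, are distributed with density bounded below with respect to `m`. -/
structure IsSpreading {S Λ : Type*} [MeasurableSpace S] [MeasurableSpace Λ] (m : Measure S)
    (ℓ : Measure Λ) (s : Λ → S → S) (c : ℝ≥0∞) : Prop where
  measurable : Measurable fun x : Λ × S => s x.1 x.2
  involutive : ∀ e θ, s e (s e θ) = θ
  preserving : ∀ e, MeasurePreserving (s e) m m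
  spread : ∀ θ, c • m ≤ ℓ.map fun e => s e θ

variable {S Λ B : Type*} [MeasurableSpace S] [MeasurableSpace Λ] [MeasurableSpace B]

/-- The fibrewise polarization of a function on `B × S`. -/
def polarizeProd (s : Λ → S → S) (h : S → ℝ) (e : Λ) (v : B × S → ℝ) : B × S → ℝ :=
  polarize (fun x => (x.1, s e x.2)) (fun x => h x.2) v

/-- The fibrewise rearrangement of a function on `B × S`. -/
def rearrProd (m : Measure S) (h : S → ℝ) (v : B × S → ℝ) (x : B × S) : ℝ :=
  rearr m h (fun θ => v (x.1, θ)) x.2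

variable {m : Measure S} {ℓ : Measure Λ} {s : Λ → S → S}
  {h : S → ℝ} {c : ℝ≥0∞}

lemma measurable_polarizeProd (hs : IsSpreading m ℓ s c) (hm : Measurable h) (e : Λ)
    {v : B × S → ℝ} (hv : Measurable v) : Measurable (polarizeProd s h e v) :=
  measurable_polarize (measurable_fst.prodMk ((hs.preserving e).measurable.comp measurable_snd))
    (hm.comp measurable_snd) hv

lemma measure_lt_polarizeProd (hs : IsSpreading m ℓ s c) (hm : Measurable h) (e : Λ)
    {v : B × S → ℝ} (hv : Measurable v) (b : B) (t : ℝ) :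
    m {θ | t < polarizeProd s h e v (b, θ)} = m {θ | t < v (b, θ)} := by
  have hse := (hs.preserving e).measurable
  have hvb : Measurable fun θ => v (b, θ) := hv.comp measurable_prodMk_left
  have hpb : Measurable fun θ => polarizeProd s h e v (b, θ) :=
    (measurable_polarizeProd hs hm e hv).comp measurable_prodMk_left
  have key : ∀ f : S → ℝ, Measurable f →
      2 * m {θ | t < f θ} =
        ∫⁻ θ, ({θ | t < f θ}.indicator 1 θ + {θ | t < f θ}.indicator 1 (s e θ)) ∂m := by
    intro f hf
    have hF : MeasurableSet {θ | t < f θ} := measurableSet_lt measurable_const hf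
    rw [lintegral_add_left (measurable_one.indicator hF),
      (hs.preserving e).lintegral_comp (measurable_one.indicator hF),
      lintegral_indicator_one hF, two_mul]
  have h2 : 2 * m {θ | t < polarizeProd s h e v (b, θ)} = 2 * m {θ | t < v (b, θ)} := by
    rw [key _ hvb, key _ hpb]
    refine lintegral_congr fun θ => ?_
    have hi := hs.involutive e θ
    simp only [indicator, mem_ofPred_eq, Pi.one_apply, polarizeProd, polarize, hi]
    rcases lt_trichotomy (h (s e θ)) (h θ) with h1 | h1 | h1
    · simp only [h1, if_true, not_lt.2 h1.le, if_false, lt_max_iff, lt_min_iff]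
      by_cases a1 : t < v (b, θ) <;> by_cases a2 : t < v (b, s e θ) <;> simp [a1, a2]
    · simp only [h1, lt_irrefl, if_false]
    · simp only [h1, if_true, not_lt.2 h1.le, if_false, lt_max_iff, lt_min_iff]
      by_cases a1 : t < v (b, θ) <;> by_cases a2 : t < v (b, s e θ) <;> simp [a1, a2]
  exact (ENNReal.mul_right_inj (by simp) (by simp)).1 h2

variable [IsFiniteMeasure m] {β : Measure B} [SFinite β]

lemma lintegral_polarizeProd_gain (hs : IsSpreading m ℓ s c) (hm : Measurable h) (e : Λ)
    {v b : B × S → ℝ} (hv : Measurable v) (hb : Measurable b)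
    (hmono : ∀ y θ θ', h θ ≤ h θ' → b (y, θ) ≤ b (y, θ')) :
    2 * ∫⁻ x, ENNReal.ofReal |polarizeProd s h e v x - b x| ∂(β.prod m) +
      ∫⁻ x, ENNReal.ofReal (min (v (x.1, s e x.2)) (b x) - max (v x) (b (x.1, s e x.2)))
        ∂(β.prod m) ≤ 2 * ∫⁻ x, ENNReal.ofReal |v x - b x| ∂(β.prod m) := by
  have hσ : MeasurePreserving (fun x : B × S => (x.1, s e x.2)) (β.prod m) (β.prod m) :=
    (MeasurePreserving.id β).prod (hs.preserving e)
  have key : ∀ f : B × S → ℝ, Measurable f →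
      2 * ∫⁻ x, ENNReal.ofReal |f x - b x| ∂(β.prod m) = ∫⁻ x, (ENNReal.ofReal |f x - b x| +
        ENNReal.ofReal |f (x.1, s e x.2) - b (x.1, s e x.2)|) ∂(β.prod m) := by
    intro f hf
    have hF : Measurable fun x => ENNReal.ofReal |f x - b x| :=
      ENNReal.measurable_ofReal.comp (measurable_norm.comp (hf.sub hb))
    rw [lintegral_add_left hF, hσ.lintegral_comp hF, two_mul]
  have hp := measurable_polarizeProd (B := B) hs hm e hv
  have hF : Measurable fun x => ENNReal.ofReal |polarizeProd s h e v x - b x| :=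
    ENNReal.measurable_ofReal.comp (measurable_norm.comp (hp.sub hb))
  have hG : Measurable fun x : B × S => ENNReal.ofReal |polarizeProd s h e v x - b x| +
      ENNReal.ofReal |polarizeProd s h e v (x.1, s e x.2) - b (x.1, s e x.2)| :=
    hF.add (hF.comp hσ.measurable)
  rw [key _ hv, key _ hp, ← lintegral_add_left hG]
  refine lintegral_mono fun x => ?_
  exact polarize_gain (σ := fun x : B × S => (x.1, s e x.2)) (h := fun x => h x.2)
    (fun z => by simp [hs.involutive]) (fun h1 => hmono x.1 _ _ h1) (fun h1 => hmono x.1 _ _ h1)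

lemma ofReal_overlap_eq {α β X Y M : ℝ} (hα : 0 ≤ α) (hX : X ≤ M) :
    ENNReal.ofReal (min β X - max α Y) = ∫⁻ t in Ico 0 M,
      (Ico α X).indicator 1 t * (Ico Y β).indicator 1 t := by
  have e1 : ∀ t : ℝ, (Ico α X).indicator (1 : ℝ → ℝ≥0∞) t * (Ico Y β).indicator 1 t =
      (Ico (max α Y) (min β X)).indicator 1 t := by
    intro t
    rw [← Set.inter_indicator_mul (1 : ℝ → ℝ≥0∞), Ico_inter_Ico, min_comm X β]
    simp [indicator]
  simp only [e1]
  rw [lintegral_indicator_one measurableSet_Ico, Measure.restrict_apply measurableSet_Ico,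
    inter_eq_left.2 (show Ico (max α Y) (min β X) ⊆ Ico 0 M from fun t ht =>
      ⟨hα.trans ((le_max_left _ _).trans ht.1), ht.2.trans_le ((min_le_right _ _).trans hX)⟩),
    Real.volume_Ico]

lemma sq_lintegral_le {T : Type*} [MeasurableSpace T] (ν : Measure T) {f : T → ℝ≥0∞}
    (hf : Measurable f) : (∫⁻ x, f x ∂ν) ^ 2 ≤ ν univ * ∫⁻ x, f x ^ 2 ∂ν := by
  have h1 := ENNReal.lintegral_mul_le_Lp_mul_Lq ν Real.HolderConjugate.two_two
    (f := 1) (g := f) aemeasurable_const hf.aemeasurable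
  simp only [Pi.mul_apply, Pi.one_apply, one_mul, lintegral_const,
    ENNReal.rpow_two, one_pow] at h1
  calc (∫⁻ x, f x ∂ν) ^ 2 ≤ (ν univ ^ (1 / 2 : ℝ) * (∫⁻ x, f x ^ 2 ∂ν) ^ (1 / 2 : ℝ)) ^ 2 := by
        gcongr
    _ = _ := by
        rw [mul_pow, ← ENNReal.rpow_natCast, ← ENNReal.rpow_natCast, ← ENNReal.rpow_mul,
          ← ENNReal.rpow_mul]
        norm_num [ENNReal.rpow_one]

section Overlap

variable {v b : B × S → ℝ} {M : ℝ}

omit [IsFiniteMeasure m] in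
lemma measurable_overlapLevel [SFinite m] (hv : Measurable v) (hb : Measurable b) :
    Measurable fun z : B × ℝ => m {θ | z.2 < v (z.1, θ) ∧ b (z.1, θ) ≤ z.2} := by
  have h1 : Measurable fun w : (B × ℝ) × S => (w.1.1, w.2) :=
    (measurable_fst.comp measurable_fst).prodMk measurable_snd
  have h2 : Measurable fun w : (B × ℝ) × S => w.1.2 := measurable_snd.comp measurable_fst
  exact measurable_measure_prodMk_left (ν := m)
    ((measurableSet_lt h2 (hv.comp h1)).inter (measurableSet_le (hb.comp h1) h2))

/-- If `v` and `b` are equimeasurable on each fibre then `{v > t ≥ b}` and `{b > t ≥ v}` have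
the same measure there. -/
lemma measure_diff_symm (hv : Measurable v) (hb : Measurable b) {t : ℝ} {y : B}
    (heq : m {θ | t < v (y, θ)} = m {θ | t < b (y, θ)}) :
    m {θ | t < v (y, θ) ∧ b (y, θ) ≤ t} = m {θ | t < b (y, θ) ∧ v (y, θ) ≤ t} := by
  have hV : MeasurableSet {θ | t < v (y, θ)} :=
    measurableSet_lt measurable_const (hv.comp measurable_prodMk_left)
  have hB : MeasurableSet {θ | t < b (y, θ)} :=
    measurableSet_lt measurable_const (hb.comp measurable_prodMk_left)
  have e1 : ∀ f g : B × S → ℝ, {θ | t < f (y, θ) ∧ g (y, θ) ≤ t} =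
      {θ | t < f (y, θ)} \ {θ | t < g (y, θ)} := by
    intro f g; ext θ; simp
  rw [e1, e1]
  have h1 := measure_inter_add_sdiff (μ := m) {θ | t < v (y, θ)} hB
  have h2 := measure_inter_add_sdiff (μ := m) {θ | t < b (y, θ)} hV
  rw [inter_comm, ← heq, ← h1] at h2
  exact ((ENNReal.add_right_inj (measure_ne_top _ _)).1 h2).symm

lemma lintegral_abs_sub_eq_two_mul (β : Measure B) (hv : Measurable v) (hb : Measurable b)
    (hv0 : ∀ x, 0 ≤ v x)
    (hb0 : ∀ x, 0 ≤ b x) (hvM : ∀ x, v x ≤ M) (hbM : ∀ x, b x ≤ M)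
    (heq : ∀ y t, 0 ≤ t → m {θ | t < v (y, θ)} = m {θ | t < b (y, θ)}) :
    ∫⁻ x, ENNReal.ofReal |v x - b x| ∂(β.prod m) =
      2 * ∫⁻ z, m {θ | z.2 < v (z.1, θ) ∧ b (z.1, θ) ≤ z.2}
        ∂(β.prod (volume.restrict (Ico 0 M))) := by
  have hF : Measurable fun x => ENNReal.ofReal |v x - b x| :=
    ENNReal.measurable_ofReal.comp (measurable_norm.comp (hv.sub hb))
  have hA := measurable_overlapLevel (m := m) hv hb
  rw [lintegral_prod _ hF.aemeasurable, lintegral_prod _ hA.aemeasurable, ← lintegral_const_mul]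
  swap
  · exact hA.lintegral_prod_right'
  refine lintegral_congr fun y => ?_
  have hvy : Measurable fun θ => v (y, θ) := hv.comp measurable_prodMk_left
  have hby : Measurable fun θ => b (y, θ) := hb.comp measurable_prodMk_left
  have hAy : Measurable fun t : ℝ => m {θ | t < v (y, θ) ∧ b (y, θ) ≤ t} :=
    hA.comp measurable_prodMk_left
  rw [lintegral_abs_sub_eq hvy.aemeasurable hby.aemeasurable (.of_forall fun θ => hv0 _)
    (.of_forall fun θ => hb0 _), ← lintegral_const_mul 2 hAy,
    ← lintegral_indicator measurableSet_Ici, ← lintegral_indicator measurableSet_Ico]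
  refine lintegral_congr fun t => ?_
  by_cases h0 : 0 ≤ t
  · by_cases hM : t < M
    · rw [indicator_of_mem (mem_Ici.2 h0), indicator_of_mem (mem_Ico.2 ⟨h0, hM⟩),
        ← measure_diff_symm hv hb (heq y t h0), two_mul]
    · rw [indicator_of_mem (mem_Ici.2 h0), indicator_of_notMem (fun h => hM (mem_Ico.1 h).2)]
      have e : ∀ f g : B × S → ℝ, (∀ x, f x ≤ M) → {θ | t < f (y, θ) ∧ g (y, θ) ≤ t} = ∅ := by
        intro f g hf
        ext θ
        simp only [mem_ofPred_eq, mem_empty_iff_false, iff_false, not_and]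
        intro h1
        exact absurd (h1.trans_le (hf _)) hM
      rw [e v b hvM, e b v hbM]
      simp
  · rw [indicator_of_notMem (fun h => h0 (mem_Ici.1 h)),
      indicator_of_notMem (fun h => h0 (mem_Ico.1 h).1)]

lemma lintegral_overlap_fibre (hv : Measurable v) (hb : Measurable b) (hv0 : ∀ x, 0 ≤ v x)
    (hbM : ∀ x, b x ≤ M)
    (heq : ∀ y t, 0 ≤ t → m {θ | t < v (y, θ)} = m {θ | t < b (y, θ)}) (y : B) :
    ∫⁻ θ, ∫⁻ θ', ENNReal.ofReal (min (v (y, θ')) (b (y, θ)) - max (v (y, θ)) (b (y, θ'))) ∂m ∂m =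
      ∫⁻ t in Ico 0 M, m {θ | t < v (y, θ) ∧ b (y, θ) ≤ t} ^ 2 := by
  have hvy : Measurable fun θ => v (y, θ) := hv.comp measurable_prodMk_left
  have hby : Measurable fun θ => b (y, θ) := hb.comp measurable_prodMk_left
  have hA : Measurable fun t : ℝ => m {θ | t < v (y, θ) ∧ b (y, θ) ≤ t} :=
    (measurable_overlapLevel (m := m) hv hb).comp measurable_prodMk_left
  have I1 := measurable_indicator_Ico hvy hby
  have I2 := measurable_indicator_Ico hby hvy
  have hset : ∀ (f g : S → ℝ), Measurable f → Measurable g → ∀ t,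
      ∫⁻ θ, (Ico (g θ) (f θ)).indicator (1 : ℝ → ℝ≥0∞) t ∂m = m {θ | t < f θ ∧ g θ ≤ t} := by
    intro f g hf hg t
    have hms : MeasurableSet {θ | t < f θ ∧ g θ ≤ t} :=
      (measurableSet_lt measurable_const hf).inter (measurableSet_le hg measurable_const)
    rw [← lintegral_indicator_one hms]
    refine lintegral_congr fun θ => ?_
    simp only [indicator, mem_Ico, mem_ofPred_eq, Pi.one_apply, and_comm]
  have h1 : ∀ θ, ∫⁻ θ', ENNReal.ofReal
      (min (v (y, θ')) (b (y, θ)) - max (v (y, θ)) (b (y, θ'))) ∂m =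
      ∫⁻ t in Ico 0 M, (Ico (v (y, θ)) (b (y, θ))).indicator 1 t *
        m {θ | t < v (y, θ) ∧ b (y, θ) ≤ t} := by
    intro θ
    simp_rw [ofReal_overlap_eq (hv0 (y, θ)) (hbM (y, θ))]
    rw [lintegral_lintegral_swap]
    · refine lintegral_congr fun t => ?_
      have I2t : Measurable fun θ' => (Ico (b (y, θ')) (v (y, θ'))).indicator (1 : ℝ → ℝ≥0∞) t :=
        I2.comp measurable_prodMk_right
      rw [lintegral_const_mul _ I2t, hset _ _ hvy hby]
    · exact ((((measurable_one.indicator measurableSet_Ico).comp measurable_snd)).mul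
        I2).aemeasurable
  simp_rw [h1]
  rw [lintegral_lintegral_swap (I1.mul (hA.comp measurable_snd)).aemeasurable]
  refine setLIntegral_congr_fun measurableSet_Ico fun t ht => ?_
  have I1t : Measurable fun θ => (Ico (v (y, θ)) (b (y, θ))).indicator (1 : ℝ → ℝ≥0∞) t :=
    I1.comp measurable_prodMk_right
  rw [lintegral_mul_const _ I1t, hset _ _ hby hvy,
    ← measure_diff_symm hv hb (heq y t ht.1), sq]

/-- On average over the family of involutions, the gain of a polarization is at least a multiple
of the square of the `L¹` distance to the rearrangement. -/
lemma sq_le_lintegral_gain [SFinite ℓ] (hs : IsSpreading m ℓ s c) (hv : Measurable v)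
    (hb : Measurable b) (hv0 : ∀ x, 0 ≤ v x) (hb0 : ∀ x, 0 ≤ b x) (hvM : ∀ x, v x ≤ M)
    (hbM : ∀ x, b x ≤ M)
    (heq : ∀ y t, 0 ≤ t → m {θ | t < v (y, θ)} = m {θ | t < b (y, θ)}) :
    c * (∫⁻ x, ENNReal.ofReal |v x - b x| ∂(β.prod m)) ^ 2 ≤
      4 * (β univ * ENNReal.ofReal M) * ∫⁻ e, ∫⁻ x, ENNReal.ofReal
        (min (v (x.1, s e x.2)) (b x) - max (v x) (b (x.1, s e x.2))) ∂(β.prod m) ∂ℓ := by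
  have hA := measurable_overlapLevel (m := m) hv hb
  have hov : Measurable fun w : (B × S) × S => ENNReal.ofReal
      (min (v (w.1.1, w.2)) (b w.1) - max (v w.1) (b (w.1.1, w.2))) := by
    have h1 : Measurable fun w : (B × S) × S => (w.1.1, w.2) :=
      (measurable_fst.comp measurable_fst).prodMk measurable_snd
    exact ENNReal.measurable_ofReal.comp (((hv.comp h1).min (hb.comp measurable_fst)).sub
      ((hv.comp measurable_fst).max (hb.comp h1)))
  have hse : Measurable fun w : Λ × (B × S) => s w.1 w.2.2 :=
    hs.measurable.comp (measurable_fst.prodMk (measurable_snd.comp measurable_snd))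
  have h1 : c * ∫⁻ z, m {θ | z.2 < v (z.1, θ) ∧ b (z.1, θ) ≤ z.2} ^ 2
        ∂(β.prod (volume.restrict (Ico 0 M))) ≤ ∫⁻ e, ∫⁻ x, ENNReal.ofReal
        (min (v (x.1, s e x.2)) (b x) - max (v x) (b (x.1, s e x.2))) ∂(β.prod m) ∂ℓ := by
    have hsw : Measurable (Function.uncurry fun (e : Λ) (x : B × S) => ENNReal.ofReal
        (min (v (x.1, s e x.2)) (b x) - max (v x) (b (x.1, s e x.2)))) :=
      hov.comp (measurable_snd.prodMk hse)
    rw [lintegral_lintegral_swap hsw.aemeasurable]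
    calc _ = ∫⁻ x, c * ∫⁻ θ', ENNReal.ofReal
          (min (v (x.1, θ')) (b x) - max (v x) (b (x.1, θ'))) ∂m ∂(β.prod m) := by
          have hov' := hov.lintegral_prod_right'  (ν := m)
          rw [lintegral_const_mul _ hov', lintegral_prod _ hov'.aemeasurable,
            lintegral_prod _ (hA.pow_const 2).aemeasurable]
          congr 1
          refine lintegral_congr fun y => ?_
          rw [lintegral_overlap_fibre hv hb hv0 hbM heq y]
      _ ≤ _ := by
          refine lintegral_mono fun x => ?_
          have hx : Measurable fun θ' => ENNReal.ofReal
              (min (v (x.1, θ')) (b x) - max (v x) (b (x.1, θ'))) :=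
            hov.comp measurable_prodMk_left
          have hsx : Measurable fun e => s e x.2 := hs.measurable.comp measurable_prodMk_right
          rw [← lintegral_map hx hsx, ← smul_eq_mul, ← lintegral_smul_measure]
          exact lintegral_mono' (hs.spread x.2) le_rfl
  rw [lintegral_abs_sub_eq_two_mul β hv hb hv0 hb0 hvM hbM heq, mul_pow]
  have h2 := sq_lintegral_le (β.prod (volume.restrict (Ico 0 M))) hA
  rw [← univ_prod_univ, Measure.prod_prod, Measure.restrict_apply_univ, Real.volume_Ico,
    sub_zero] at h2
  calc _ ≤ c * (2 ^ 2 * (β univ * ENNReal.ofReal M * ∫⁻ z,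
        m {θ | z.2 < v (z.1, θ) ∧ b (z.1, θ) ≤ z.2} ^ 2
          ∂(β.prod (volume.restrict (Ico 0 M))))) := by gcongr
    _ = 4 * (β univ * ENNReal.ofReal M) * (c * ∫⁻ z,
        m {θ | z.2 < v (z.1, θ) ∧ b (z.1, θ) ≤ z.2} ^ 2
          ∂(β.prod (volume.restrict (Ico 0 M)))) := by ring
    _ ≤ _ := by gcongr

end Overlap

/-- Iterated fibrewise polarizations of a bounded function approach its fibrewise rearrangement
in `L¹`. The distance `D` of a polarized function to the rearrangement satisfies, for a suitable
next polarization, `D' ≤ D - κ D²`, so the infimum of the distances is zero. -/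
theorem exists_list_polarizeProd_close [IsFiniteMeasure β] [IsProbabilityMeasure ℓ]
    (hs : IsSpreading m ℓ s c) (hc : c ≠ 0) (hm : Measurable h) (hh : ∀ t, m {θ | h θ = t} = 0)
    {v : B × S → ℝ} {M : ℝ} (hv : Measurable v) (hv0 : ∀ x, 0 ≤ v x) (hvM : ∀ x, v x ≤ M)
    {ε : ℝ} (hε : 0 < ε) :
    ∃ l : List Λ, ∫⁻ x, ENNReal.ofReal
      |l.foldr (polarizeProd s h) v x - rearrProd m h v x| ∂(β.prod m) < ENNReal.ofReal ε := by
  wlog hM : 0 ≤ M generalizing M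
  · exact this (M := max M 0) (fun x => (hvM x).trans (le_max_left _ _)) (le_max_right _ _)
  set b := rearrProd m h v with hb_def
  have hb : Measurable b := measurable_rearr_prod hm hv
  have hb0 : ∀ x, 0 ≤ b x := fun x => rearr_nonneg _ _
  have hbM : ∀ x, b x ≤ M := fun x => rearr_le hM (fun θ => hvM _) _
  have hmono : ∀ y θ θ', h θ ≤ h θ' → b (y, θ) ≤ b (y, θ') := fun y θ θ' hle =>
    rearr_mono_height (fun θ => hvM _) hle
  have hL : ∀ l : List Λ, Measurable (l.foldr (polarizeProd s h) v) ∧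
      (∀ x, 0 ≤ l.foldr (polarizeProd s h) v x) ∧ (∀ x, l.foldr (polarizeProd s h) v x ≤ M) ∧
      ∀ y t, 0 ≤ t → m {θ | t < l.foldr (polarizeProd s h) v (y, θ)} = m {θ | t < b (y, θ)} := by
    intro l
    induction l with
    | nil => exact ⟨hv, hv0, hvM, fun y t ht =>
        (measure_lt_rearr hm hh (hv.comp measurable_prodMk_left) ht).symm⟩
    | cons e l ih =>
      rw [List.foldr_cons]
      exact ⟨measurable_polarizeProd hs hm e ih.1, fun x => le_polarize ih.2.1 x,
        fun x => polarize_le ih.2.2.1 x,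
        fun y t ht => (measure_lt_polarizeProd hs hm e ih.1 y t).trans (ih.2.2.2 y t ht)⟩
  set D : List Λ → ℝ≥0∞ := fun l =>
    ∫⁻ x, ENNReal.ofReal |l.foldr (polarizeProd s h) v x - b x| ∂(β.prod m) with hD
  set C : ℝ≥0∞ := 4 * (β univ * ENNReal.ofReal M) with hC
  have hCt : C ≠ ∞ := by
    rw [hC]
    exact ENNReal.mul_ne_top (by simp) (ENNReal.mul_ne_top (measure_ne_top _ _) (by simp))
  have hDt : ∀ l, D l ≠ ∞ := fun l => by
    have h1 : D l ≤ ∫⁻ _, ENNReal.ofReal M ∂(β.prod m) := by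
      refine lintegral_mono fun x => ENNReal.ofReal_le_ofReal ?_
      rw [abs_le]
      constructor <;> linarith [hb0 x, hbM x, (hL l).2.1 x, (hL l).2.2.1 x]
    refine ne_top_of_le_ne_top ?_ h1
    rw [lintegral_const]
    exact ENNReal.mul_ne_top (by simp) (measure_ne_top _ _)
  have hstep : ∀ l, ∃ e, 2 * (C * D (e :: l)) + c * D l ^ 2 ≤ 2 * (C * D l) := by
    intro l
    obtain ⟨h1, h2, h3, h4⟩ := hL l
    have hg := sq_le_lintegral_gain (β := β) hs h1 hb h2 hb0 h3 hbM h4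
    have hgain := fun e => lintegral_polarizeProd_gain (β := β) hs hm e h1 hb hmono
    -- an involution whose gain is at least the average gain
    obtain ⟨e, he⟩ := exists_lintegral_le (μ := ℓ) (f := fun e => ∫⁻ x, ENNReal.ofReal
        (min (l.foldr (polarizeProd s h) v (x.1, s e x.2)) (b x) -
          max (l.foldr (polarizeProd s h) v x) (b (x.1, s e x.2))) ∂(β.prod m)) (by
        refine ne_top_of_le_ne_top (b := ∫⁻ _, 2 * D l ∂ℓ) ?_ (lintegral_mono fun e =>
          le_add_self.trans (hgain e))
        rw [lintegral_const, measure_univ, mul_one]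
        exact ENNReal.mul_ne_top (by simp) (hDt l))
    refine ⟨e, ?_⟩
    calc 2 * (C * D (e :: l)) + c * D l ^ 2 ≤ C * (2 * D (e :: l)) + C * _ := by
          rw [mul_left_comm]
          exact add_le_add le_rfl (hg.trans (mul_le_mul_right he _))
      _ = C * _ := (mul_add _ _ _).symm
      _ ≤ C * (2 * D l) := mul_le_mul_right (hgain e) _
      _ = _ := mul_left_comm _ _ _
  -- The infimum of the distances is zero: at a nearly optimal list, one more polarization would
  -- otherwise lead below the infimum.
  set d := ⨅ l, D l with hd
  have hd0 : d = 0 := by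
    by_contra hne
    have hdt : d ≠ ∞ := ne_top_of_le_ne_top (hDt []) (iInf_le _ _)
    have hkey : ∀ η : ℝ≥0∞, η ≠ 0 → c * d ^ 2 ≤ 2 * (C * η) := by
      intro η hη
      obtain ⟨l, hl⟩ := iInf_lt_iff.1 (ENNReal.lt_add_right hdt hη)
      obtain ⟨e, he⟩ := hstep l
      have h1 : 2 * (C * d) + c * d ^ 2 ≤ 2 * (C * d) + 2 * (C * η) := by
        calc 2 * (C * d) + c * d ^ 2 ≤ 2 * (C * D (e :: l)) + c * D l ^ 2 := by
              gcongr <;> exact iInf_le _ _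
          _ ≤ 2 * (C * D l) := he
          _ ≤ 2 * (C * (d + η)) := by gcongr
          _ = _ := by ring
      exact (ENNReal.add_le_add_iff_left (ENNReal.mul_ne_top (by simp)
        (ENNReal.mul_ne_top hCt hdt))).1 h1
    have hpos : c * d ^ 2 ≠ 0 := mul_ne_zero hc (pow_ne_zero _ hne)
    have h2 : Tendsto (fun η : ℝ≥0∞ => 2 * (C * η)) (𝓝[>] 0) (𝓝 (2 * (C * 0))) :=
      ((ENNReal.continuous_const_mul (by simp)).comp
        (ENNReal.continuous_const_mul hCt)).continuousAt.tendsto.mono_left nhdsWithin_le_nhds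
    simp only [mul_zero] at h2
    exact hpos (nonpos_iff_eq_zero.1 (ge_of_tendsto h2
      (eventually_nhdsWithin_of_forall fun η hη => hkey η (ne_of_gt hη))))
  have h1 : d < ENNReal.ofReal ε := by rw [hd0]; simpa using hε
  exact iInf_lt_iff.1 h1

end Polarization
end FoliatedSchwarz

end
noncomputable section

namespace FoliatedSchwarz

open Filter Topology Metric
open scoped Pointwise NNReal RealInnerProductSpace

/-! ### Reflections of the unit sphere -/

section Sphere

/-- The unit sphere of `ℝ^N`. -/
abbrev Sph (N : ℕ) : Type := sphere (0 : EuclideanSpace ℝ (Fin N)) 1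

/-- The surface measure of the unit sphere of `ℝ^N`. -/
abbrev sphMeasure (N : ℕ) : Measure (Sph N) :=
  (volume : Measure (EuclideanSpace ℝ (Fin N))).toSphere

variable {N : ℕ}

/-- The map induced on the unit sphere by a linear isometry. -/
def sphMap (L : EuclideanSpace ℝ (Fin N) ≃ₗᵢ[ℝ] EuclideanSpace ℝ (Fin N)) (θ : Sph N) : Sph N :=
  ⟨L θ.1, by simp⟩

lemma measurable_sphMap (L : EuclideanSpace ℝ (Fin N) ≃ₗᵢ[ℝ] EuclideanSpace ℝ (Fin N)) :
    Measurable (sphMap L) :=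
  (L.continuous.measurable.comp measurable_subtype_coe).subtype_mk

lemma measurePreserving_sphMap (L : EuclideanSpace ℝ (Fin N) ≃ₗᵢ[ℝ] EuclideanSpace ℝ (Fin N)) :
    MeasurePreserving (sphMap L) (sphMeasure N) (sphMeasure N) := by
  refine ⟨measurable_sphMap L, ?_⟩
  ext A hA
  rw [Measure.map_apply (measurable_sphMap L) hA,
    Measure.toSphere_apply' _ (measurable_sphMap L hA), Measure.toSphere_apply' _ hA]
  congr 1
  have h1 : Ioo (0 : ℝ) 1 • (Subtype.val '' (sphMap L ⁻¹' A)) =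
      L ⁻¹' (Ioo (0 : ℝ) 1 • (Subtype.val '' A)) := by
    ext x
    simp only [Set.mem_smul, mem_image, mem_preimage]
    constructor
    · rintro ⟨t, ht, _, ⟨θ, hθ, rfl⟩, rfl⟩
      exact ⟨t, ht, _, ⟨_, hθ, rfl⟩, by simp [sphMap]⟩
    · rintro ⟨t, ht, _, ⟨θ, hθ, rfl⟩, hx⟩
      refine ⟨t, ht, _, ⟨sphMap L.symm θ, ?_, rfl⟩, ?_⟩
      · have : sphMap L (sphMap L.symm θ) = θ := by ext; simp [sphMap]
        change sphMap L (sphMap L.symm θ) ∈ A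
        rwa [this]
      · apply L.injective
        simp [sphMap, hx]
  rw [h1]
  exact (L.measurePreserving.measure_preimage_equiv (f := L.toMeasurableEquiv) _)

/-- Cones `⟪x, p⟫ = s ‖x‖` are null: for `0 ≤ s < 1` such a cone lies in the boundary of a convex
cone, and for `s = 1` it lies in a line. -/
lemma volume_cone_eq_zero {E : Type*} [NormedAddCommGroup E] [InnerProductSpace ℝ E]
    [FiniteDimensional ℝ E] [MeasurableSpace E] [BorelSpace E] (μ : Measure E) [μ.IsAddHaarMeasure]
    (hd : 2 ≤ Module.finrank ℝ E) {p : E} (hp : ‖p‖ = 1) (s : ℝ) :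
    μ {x : E | ⟪x, p⟫ = s * ‖x‖} = 0 := by
  wlog hs : 0 ≤ s generalizing p s
  · have h1 := this (p := -p) (by simpa using hp) (-s) (by linarith)
    convert h1 using 3
    ext x
    simp
  rcases lt_trichotomy s 1 with h1 | h1 | h1
  · set C : Set E := {x | s * ‖x‖ - ⟪x, p⟫ ≤ 0}
    have hC : Convex ℝ C := by
      have : ConvexOn ℝ univ fun x : E => s * ‖x‖ - ⟪x, p⟫ := by
        refine ((convexOn_norm convex_univ).smul hs).sub ?_
        exact ((innerSL ℝ p).toLinearMap.concaveOn convex_univ).congr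
          fun x _ => by simp [real_inner_comm]
      have h2 := this.convex_le 0
      simp only [mem_univ, true_and] at h2
      exact h2
    refine measure_mono_null (t := frontier C) ?_ (hC.addHaar_frontier μ)
    intro x hx
    have hx' : ⟪x, p⟫ = s * ‖x‖ := hx
    refine ⟨subset_closure (show s * ‖x‖ - ⟪x, p⟫ ≤ 0 by linarith), ?_⟩
    rw [mem_interior_iff_mem_nhds]
    intro hn
    have ht : Tendsto (fun n : ℕ => x - (1 / ((n : ℝ) + 1)) • p) atTop (𝓝 (x - (0 : ℝ) • p)) :=
      tendsto_const_nhds.sub (tendsto_one_div_add_atTop_nhds_zero_nat.smul_const p)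
    rw [zero_smul, sub_zero] at ht
    obtain ⟨n, hn⟩ := (ht.eventually hn).exists
    have hpos : (0 : ℝ) < 1 / ((n : ℝ) + 1) := by positivity
    set δ := 1 / ((n : ℝ) + 1)
    have hn' : s * ‖x - δ • p‖ - ⟪x - δ • p, p⟫ ≤ 0 := hn
    rw [inner_sub_left, inner_smul_left, real_inner_self_eq_norm_sq, hp] at hn'
    have h2 : ‖x‖ - δ ≤ ‖x - δ • p‖ := by
      have := norm_sub_norm_le x (δ • p)
      rwa [norm_smul, hp, mul_one, Real.norm_of_nonneg hpos.le] at this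
    have h3 : s * (‖x‖ - δ) ≤ s * ‖x - δ • p‖ := mul_le_mul_of_nonneg_left h2 hs
    simp at hn'
    nlinarith
  · have hne : (ℝ ∙ p) ≠ ⊤ := by
      intro htop
      have h2 := finrank_span_le_card (R := ℝ) ({p} : Set E)
      rw [htop, finrank_top] at h2
      simp at h2
      omega
    refine measure_mono_null (fun x hx => ?_) (Measure.addHaar_submodule μ _ hne)
    have hx' : ⟪x, p⟫ = s * ‖x‖ := hx
    have h2 : ⟪x, p⟫ = ‖x‖ * ‖p‖ := by rw [hx', h1, hp]; ring
    have h3 := inner_eq_norm_mul_iff_real.1 h2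
    rw [hp, one_smul] at h3
    rw [h3]
    exact Submodule.smul_mem _ _ (Submodule.mem_span_singleton_self p)
  · have : {x : E | ⟪x, p⟫ = s * ‖x‖} ⊆ {0} := by
      intro x hx
      have hx' : ⟪x, p⟫ = s * ‖x‖ := hx
      have h2 := real_inner_le_norm x p
      rw [hx', hp, mul_one] at h2
      by_contra hc
      have : 0 < ‖x‖ := norm_pos_iff.2 hc
      nlinarith
    have hE : Nontrivial E := Module.nontrivial_of_finrank_pos (R := ℝ) (by omega)
    exact measure_mono_null this (measure_singleton _)

lemma sphMeasure_level_eq_zero (hN : 2 ≤ N) {p : EuclideanSpace ℝ (Fin N)} (hp : ‖p‖ = 1) (s : ℝ) :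
    sphMeasure N {θ | ⟪θ.1, p⟫ = s} = 0 := by
  have hmeas : MeasurableSet {θ : Sph N | ⟪θ.1, p⟫ = s} :=
    measurableSet_eq_fun (by fun_prop) measurable_const
  rw [Measure.toSphere_apply' _ hmeas]
  convert mul_zero _
  refine measure_mono_null ?_ (volume_cone_eq_zero volume (by simpa using hN) hp s)
  rintro _ ⟨t, ht, _, ⟨θ, hθ, rfl⟩, rfl⟩
  have h1 : ⟪θ.1, p⟫ = s := hθ
  have h2 : ‖θ.1‖ = 1 := by simp
  show ⟪t • θ.1, p⟫ = s * ‖t • θ.1‖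
  rw [inner_smul_left, norm_smul, h1, h2, Real.norm_of_nonneg ht.1.le]
  simp [mul_comm]

/-- The reflection of the unit sphere in the hyperplane `e^⊥`. -/
def sphRefl (e : EuclideanSpace ℝ (Fin N)) : Sph N → Sph N := sphMap (ℝ ∙ e)ᗮ.reflection

lemma coe_sphRefl (e : EuclideanSpace ℝ (Fin N)) (θ : Sph N) :
    (sphRefl e θ).1 = (ℝ ∙ e)ᗮ.reflection θ.1 := rfl

lemma measurePreserving_sphRefl (e : EuclideanSpace ℝ (Fin N)) :
    MeasurePreserving (sphRefl e) (sphMeasure N) (sphMeasure N) :=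
  measurePreserving_sphMap _

lemma reflection_orthogonal_singleton {E : Type*} [NormedAddCommGroup E] [InnerProductSpace ℝ E]
    (e x : E) : (ℝ ∙ e)ᗮ.reflection x = x - (2 * ⟪e, x⟫ / ‖e‖ ^ 2) • e := by
  rw [Submodule.reflection_orthogonal_apply, Submodule.reflection_singleton_apply,
    ← Nat.cast_smul_eq_nsmul ℝ, smul_smul, neg_sub, mul_div_assoc]
  simp

/-- The extension of `e ↦ sphRefl e θ` from unit vectors `e` which is homogeneous of degree `1`. -/
def radialRefl (θ : EuclideanSpace ℝ (Fin N)) (e : EuclideanSpace ℝ (Fin N)) :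
    EuclideanSpace ℝ (Fin N) := ‖e‖ • θ - (2 * ⟪e, θ⟫) • (‖e‖⁻¹ • e)

lemma lipschitzWith_radialRefl {θ : EuclideanSpace ℝ (Fin N)} (hθ : ‖θ‖ = 1) :
    LipschitzWith 7 (radialRefl θ) := by
  have key : ∀ v w : EuclideanSpace ℝ (Fin N), ‖w‖ * ‖‖v‖⁻¹ • v - ‖w‖⁻¹ • w‖ ≤ 2 * ‖v - w‖ := by
    intro v w
    rcases eq_or_ne w 0 with rfl | hw
    · simp
    have hw' : 0 < ‖w‖ := norm_pos_iff.2 hw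
    rcases eq_or_ne v 0 with rfl | hv
    · simp [norm_smul, hw]
    have hv' : 0 < ‖v‖ := norm_pos_iff.2 hv
    have h1 : ‖w‖ • (‖v‖⁻¹ • v - ‖w‖⁻¹ • w) = (v - w) + ((‖w‖ - ‖v‖) * ‖v‖⁻¹) • v := by
      rw [smul_sub, smul_smul, smul_smul, mul_inv_cancel₀ hw'.ne', one_smul, sub_mul,
        mul_inv_cancel₀ hv'.ne', sub_smul, one_smul]
      abel
    have h2 : ‖w‖ * ‖‖v‖⁻¹ • v - ‖w‖⁻¹ • w‖ = ‖‖w‖ • (‖v‖⁻¹ • v - ‖w‖⁻¹ • w)‖ := by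
      rw [norm_smul, norm_norm]
    rw [h2, h1]
    refine (norm_add_le _ _).trans ?_
    have h3 : ‖((‖w‖ - ‖v‖) * ‖v‖⁻¹) • v‖ = |‖w‖ - ‖v‖| := by
      rw [norm_smul, norm_mul, norm_inv, norm_norm, mul_assoc, inv_mul_cancel₀ hv'.ne', mul_one,
        Real.norm_eq_abs]
    rw [h3]
    have h4 := abs_norm_sub_norm_le w v
    rw [norm_sub_rev] at h4
    linarith
  refine LipschitzWith.of_dist_le_mul fun v w => ?_
  rw [dist_eq_norm, dist_eq_norm]
  have h1 : radialRefl θ v - radialRefl θ w = (‖v‖ - ‖w‖) • θ - (2 * ⟪v - w, θ⟫) • (‖v‖⁻¹ • v)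
      - (2 * ⟪w, θ⟫) • (‖v‖⁻¹ • v - ‖w‖⁻¹ • w) := by
    simp only [radialRefl, inner_sub_left, mul_sub, sub_smul, smul_sub]
    abel
  rw [h1]
  have h2 : ‖(‖v‖ - ‖w‖) • θ‖ ≤ ‖v - w‖ := by
    rw [norm_smul, hθ, mul_one]; exact abs_norm_sub_norm_le v w
  have h3 : ‖(2 * ⟪v - w, θ⟫) • (‖v‖⁻¹ • v)‖ ≤ 2 * ‖v - w‖ := by
    have h4 : ‖‖v‖⁻¹ • v‖ ≤ 1 := by
      rw [norm_smul, norm_inv, norm_norm]; exact inv_mul_le_one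
    have h5 := abs_real_inner_le_norm (v - w) θ
    rw [hθ, mul_one] at h5
    rw [norm_smul, norm_mul, Real.norm_eq_abs, Real.norm_eq_abs, abs_two]
    nlinarith [norm_nonneg (v - w), abs_nonneg ⟪v - w, θ⟫, norm_nonneg (‖v‖⁻¹ • v)]
  have h4 : ‖(2 * ⟪w, θ⟫) • (‖v‖⁻¹ • v - ‖w‖⁻¹ • w)‖ ≤ 4 * ‖v - w‖ := by
    have h5 := abs_real_inner_le_norm w θ
    rw [hθ, mul_one] at h5
    rw [norm_smul, norm_mul, Real.norm_eq_abs, Real.norm_eq_abs, abs_two]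
    have h6 := key v w
    have h7 : |⟪w, θ⟫| * ‖‖v‖⁻¹ • v - ‖w‖⁻¹ • w‖ ≤ ‖w‖ * ‖‖v‖⁻¹ • v - ‖w‖⁻¹ • w‖ := by gcongr
    linarith
  have h5 := norm_sub_le ((‖v‖ - ‖w‖) • θ - (2 * ⟪v - w, θ⟫) • (‖v‖⁻¹ • v))
    ((2 * ⟪w, θ⟫) • (‖v‖⁻¹ • v - ‖w‖⁻¹ • w))
  have h6 := norm_sub_le ((‖v‖ - ‖w‖) • θ) ((2 * ⟪v - w, θ⟫) • (‖v‖⁻¹ • v))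
  norm_num
  linarith

lemma volume_image_le_of_lipschitz {f : EuclideanSpace ℝ (Fin N) → EuclideanSpace ℝ (Fin N)}
    {K : ℝ≥0} (hf : LipschitzWith K f) (A : Set (EuclideanSpace ℝ (Fin N))) :
    volume (f '' A) ≤ (K : ℝ≥0∞) ^ N * volume A := by
  have h1 := hf.hausdorffMeasure_image_le (d := N) (by positivity) A
  have hr : Module.finrank ℝ (EuclideanSpace ℝ (Fin N)) = N := by simp
  have : (μH[(N : ℝ)] : Measure (EuclideanSpace ℝ (Fin N))).IsAddHaarMeasure := by
    have := MeasureTheory.isAddHaarMeasure_hausdorffMeasure (E := EuclideanSpace ℝ (Fin N))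
    rwa [hr] at this
  have h2 : (volume : Measure (EuclideanSpace ℝ (Fin N))) =
      Measure.addHaarScalarFactor volume (μH[(N : ℝ)]) • μH[(N : ℝ)] :=
    Measure.isAddLeftInvariant_eq_smul _ _
  rw [h2]
  simp only [Measure.smul_apply, ENNReal.smul_def, smul_eq_mul]
  rw [mul_left_comm]
  gcongr
  simpa using h1

lemma measurable_sphRefl :
    Measurable fun x : EuclideanSpace ℝ (Fin N) × Sph N => sphRefl x.1 x.2 := by
  refine Measurable.subtype_mk ?_
  have h1 : (fun x : EuclideanSpace ℝ (Fin N) × Sph N => (ℝ ∙ x.1)ᗮ.reflection x.2.1) =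
      fun x => x.2.1 - (2 * ⟪x.1, x.2.1⟫ / ‖x.1‖ ^ 2) • x.1 := by
    ext1 x
    exact reflection_orthogonal_singleton _ _
  rw [h1]
  have h2 : Measurable fun x : EuclideanSpace ℝ (Fin N) × Sph N => x.2.1 :=
    measurable_subtype_coe.comp measurable_snd
  exact h2.sub ((((measurable_fst.inner h2).const_mul 2).div
    (measurable_fst.norm.pow_const 2)).smul measurable_fst)

attribute [irreducible] sphRefl

/-- The uniform probability measure on the unit ball, from which the normals of the reflections
are drawn. -/
def ballProb (N : ℕ) : Measure (EuclideanSpace ℝ (Fin N)) :=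
  (volume (ball (0 : EuclideanSpace ℝ (Fin N)) 1))⁻¹ • volume.restrict (ball 0 1)

instance : IsProbabilityMeasure (ballProb N) := by
  refine ⟨?_⟩
  rw [ballProb, Measure.smul_apply, Measure.restrict_apply_univ, smul_eq_mul]
  exact ENNReal.inv_mul_cancel (measure_ball_pos _ _ one_pos).ne' measure_ball_lt_top.ne

/-- The constant in the lower bound for the distribution of `sphRefl e θ`: `7` is the Lipschitz
constant of `radialRefl θ`, and `N` relates the surface measure to the volume of cones. -/
def spreadConst (N : ℕ) : ℝ≥0∞ :=
  (volume (ball (0 : EuclideanSpace ℝ (Fin N)) 1))⁻¹ * ((N : ℝ≥0∞) * 7 ^ N)⁻¹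

lemma spreadConst_ne_zero (N : ℕ) : spreadConst N ≠ 0 :=
  mul_ne_zero (ENNReal.inv_ne_zero.2 measure_ball_lt_top.ne)
    (ENNReal.inv_ne_zero.2 (ENNReal.mul_ne_top (by simp) (by simp)))

/-- The reflection with normal `θ - φ` exchanges `θ` and `φ`; the normal is rescaled to length `t`,
so that the radial extension takes it to `t φ`. -/
lemma mem_image_radialRefl {θ φ : Sph N} (hne : φ ≠ θ) {A : Set (Sph N)} (hφ : φ ∈ A) {t : ℝ}
    (ht : t ∈ Ioo (0 : ℝ) 1) :
    t • φ.1 ∈ radialRefl θ.1 '' ({e | sphRefl e θ ∈ A} ∩ ball 0 1) := by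
  have hne' : θ.1 - φ.1 ≠ 0 := sub_ne_zero.2 fun h => hne (Subtype.ext h.symm)
  have hpos : 0 < ‖θ.1 - φ.1‖ := norm_pos_iff.2 hne'
  have hk : 0 < t * ‖θ.1 - φ.1‖⁻¹ := mul_pos ht.1 (inv_pos.2 hpos)
  set v := (t * ‖θ.1 - φ.1‖⁻¹) • (θ.1 - φ.1) with hvdef
  have hv : ‖v‖ = t := by
    rw [hvdef, norm_smul, Real.norm_of_nonneg hk.le, mul_assoc, inv_mul_cancel₀ hpos.ne', mul_one]
  have hspan : (ℝ ∙ v) = ℝ ∙ (θ.1 - φ.1) :=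
    Submodule.span_singleton_smul_eq (IsUnit.mk0 _ hk.ne') _
  have hrefl : (ℝ ∙ v)ᗮ.reflection θ.1 = φ.1 := by
    simp only [hspan]
    exact Submodule.reflection_sub (by simp)
  have hrefl' : sphRefl v θ = φ := Subtype.ext ((coe_sphRefl _ _).trans hrefl)
  refine ⟨v, ⟨?_, ?_⟩, ?_⟩
  · rw [mem_ofPred_eq, hrefl']
    exact hφ
  · rw [mem_ball_zero_iff, hv]
    exact ht.2
  · rw [reflection_orthogonal_singleton] at hrefl
    rw [hv] at hrefl
    have h0 := ht.1.ne'
    have h1 : t * (2 * ⟪v, θ.1⟫ / t ^ 2) = 2 * ⟪v, θ.1⟫ * t⁻¹ := by field_simp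
    clear_value v
    rw [← hrefl, radialRefl, hv, smul_sub, smul_smul, smul_smul, h1]

/-- The cone over a set `A` of the sphere is covered, up to the ray through `θ`, by the image under
the Lipschitz map `radialRefl θ` of the normals that reflect `θ` into `A`. -/
lemma sphMeasure_le_volume_normals (hN : 2 ≤ N) (θ : Sph N) {A : Set (Sph N)}
    (hA : MeasurableSet A) :
    sphMeasure N A ≤ N * (7 ^ N * volume ({e | sphRefl e θ ∈ A} ∩ ball 0 1)) := by
  have hθ : ‖θ.1‖ = 1 := by simp
  have h0 : sphMeasure N {θ} = 0 := by
    refine measure_mono_null ?_ (sphMeasure_level_eq_zero hN hθ 1)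
    rintro _ rfl
    simp
  rw [← measure_sdiff_null h0, Measure.toSphere_apply' _ (hA.diff (measurableSet_singleton θ))]
  rw [finrank_euclideanSpace, Fintype.card_fin]
  refine mul_le_mul_right ((measure_mono ?_).trans
    (volume_image_le_of_lipschitz (lipschitzWith_radialRefl hθ) _)) _
  rintro _ ⟨t, ht, _, ⟨φ, ⟨hφ, hne⟩, rfl⟩, rfl⟩
  exact mem_image_radialRefl hne hφ ht

lemma spread_sphRefl (hN : 2 ≤ N) (θ : Sph N) :
    spreadConst N • sphMeasure N ≤ (ballProb N).map fun e => sphRefl e θ := by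
  have hpair : Measurable fun e : EuclideanSpace ℝ (Fin N) => (e, θ) := measurable_prodMk_right
  have hsm : Measurable fun e : EuclideanSpace ℝ (Fin N) => sphRefl e θ :=
    Measurable.comp (g := fun x : EuclideanSpace ℝ (Fin N) × Sph N => sphRefl x.1 x.2)
      measurable_sphRefl hpair
  refine Measure.le_iff.2 fun A hA => ?_
  rw [Measure.map_apply hsm hA, ballProb, Measure.smul_apply, Measure.smul_apply,
    Measure.restrict_apply (hsm hA)]
  have h1 := sphMeasure_le_volume_normals hN θ hA
  generalize hP : volume ({e | sphRefl e θ ∈ A} ∩ ball 0 1) = x at h1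
  have hP' : volume ((fun e => sphRefl e θ) ⁻¹' A ∩ ball 0 1) = x := hP
  rw [hP', smul_eq_mul, smul_eq_mul]
  have h2 : ((N : ℝ≥0∞) * 7 ^ N)⁻¹ * ((N : ℝ≥0∞) * 7 ^ N) = 1 :=
    ENNReal.inv_mul_cancel (mul_ne_zero (by simp; omega) (by simp))
      (ENNReal.mul_ne_top (by simp) (by simp))
  rw [spreadConst, mul_assoc]
  refine mul_le_mul_right ?_ _
  calc ((N : ℝ≥0∞) * 7 ^ N)⁻¹ * sphMeasure N A
      ≤ ((N : ℝ≥0∞) * 7 ^ N)⁻¹ * (N * (7 ^ N * x)) := mul_le_mul_right h1 _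
    _ = x := by rw [← mul_assoc (N : ℝ≥0∞), ← mul_assoc, h2, one_mul]

/-- The reflections with random normals spread the points of the sphere, so that greedy iterated
polarization converges to the rearrangement. This needs `N ≥ 2`. -/
lemma isSpreading_sphRefl (hN : 2 ≤ N) :
    IsSpreading (sphMeasure N) (ballProb N) sphRefl (spreadConst N) where
  measurable := measurable_sphRefl
  involutive e θ := Subtype.ext (by simp [coe_sphRefl])
  preserving e := measurePreserving_sphRefl e
  spread := spread_sphRefl hN

end Sphere

end FoliatedSchwarz

end
noncomputable section

namespace FoliatedSchwarz

open Filter Topology Metric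
open scoped Pointwise NNReal RealInnerProductSpace

/-! ### Polar and cylindrical coordinates -/

section Coordinates

lemma measurePreserving_polar (E : Type*) [NormedAddCommGroup E] [NormedSpace ℝ E]
    [FiniteDimensional ℝ E] [MeasurableSpace E] [BorelSpace E] [Nontrivial E] (μ : Measure E)
    [μ.IsAddHaarMeasure] :
    MeasurePreserving (fun q : sphere (0 : E) 1 × Ioi (0 : ℝ) => q.2.1 • q.1.1)
      (μ.toSphere.prod (Measure.volumeIoiPow (Module.finrank ℝ E - 1))) μ := by
  have h1 := μ.measurePreserving_homeomorphUnitSphereProd.symm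
    (homeomorphUnitSphereProd E).toMeasurableEquiv
  have h2 : MeasurePreserving (Subtype.val : ({(0 : E)}ᶜ : Set E) → E) (μ.comap (↑)) μ := by
    refine ⟨measurable_subtype_coe, ?_⟩
    rw [(MeasurableEmbedding.subtype_coe (measurableSet_singleton _).compl).map_comap,
      Subtype.range_coe, restrict_compl_singleton]
  exact h2.comp h1

variable {N : ℕ}

/-- The point `(x, y)` of `ℝ^(N+1)`. -/
def join (x : EuclideanSpace ℝ (Fin N)) (y : ℝ) : Amb N :=
  WithLp.toLp 2 (Fin.snoc (α := fun _ => ℝ) (fun i => x i) y)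

@[simp] lemma join_last (x : EuclideanSpace ℝ (Fin N)) (y : ℝ) : join x y (Fin.last N) = y := by
  simp [join]

@[simp] lemma height_join (x : EuclideanSpace ℝ (Fin N)) (y : ℝ) : height (join x y) = y :=
  join_last x y

@[simp] lemma join_castSucc (x : EuclideanSpace ℝ (Fin N)) (y : ℝ) (i : Fin N) :
    join x y i.castSucc = x i := by
  simp [join]

@[simp] lemma join_zero_coord [NeZero N] (x : EuclideanSpace ℝ (Fin N)) (y : ℝ) :
    join x y 0 = x 0 := by
  rw [← Fin.castSucc_zero', join_castSucc]

lemma inner_join (x x' : EuclideanSpace ℝ (Fin N)) (y y' : ℝ) :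
    ⟪join x y, join x' y'⟫ = ⟪x, x'⟫ + y * y' := by
  simp only [PiLp.inner_apply, Fin.sum_univ_castSucc, join_castSucc, join_last]
  simp [mul_comm]

lemma norm_join_sq (x : EuclideanSpace ℝ (Fin N)) (y : ℝ) :
    ‖join x y‖ ^ 2 = ‖x‖ ^ 2 + y ^ 2 := by
  rw [← real_inner_self_eq_norm_sq, inner_join, real_inner_self_eq_norm_sq, sq y]

lemma smul_join (c : ℝ) (x : EuclideanSpace ℝ (Fin N)) (y : ℝ) :
    c • join x y = join (c • x) (c * y) := by
  ext i
  refine Fin.lastCases ?_ (fun j => ?_) i <;> simp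

lemma join_sub (x x' : EuclideanSpace ℝ (Fin N)) (y y' : ℝ) :
    join x y - join x' y' = join (x - x') (y - y') := by
  ext i
  refine Fin.lastCases ?_ (fun j => ?_) i <;> simp

/-- The reflection of `ℝ^(N+1)` in the hyperplane `(e, 0)^⊥`, which preserves the height. -/
def ambRefl (e : EuclideanSpace ℝ (Fin N)) : Amb N ≃ₗᵢ[ℝ] Amb N := (ℝ ∙ join e 0)ᗮ.reflection

lemma ambRefl_apply (e : EuclideanSpace ℝ (Fin N)) (z : Amb N) :
    ambRefl e z = z - (2 * ⟪join e 0, z⟫ / ‖join e 0‖ ^ 2) • join e 0 :=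
  reflection_orthogonal_singleton _ _

@[simp] lemma ambRefl_ambRefl (e : EuclideanSpace ℝ (Fin N)) (z : Amb N) :
    ambRefl e (ambRefl e z) = z :=
  Submodule.reflection_reflection _ _

@[simp] lemma height_ambRefl (e : EuclideanSpace ℝ (Fin N)) (z : Amb N) :
    height (ambRefl e z) = height z := by
  rw [ambRefl_apply, height, height]
  simp

lemma ambRefl_join (e x : EuclideanSpace ℝ (Fin N)) (y : ℝ) :
    ambRefl e (join x y) = join ((ℝ ∙ e)ᗮ.reflection x) y := by
  rw [ambRefl_apply, reflection_orthogonal_singleton, norm_join_sq, inner_join, smul_join, join_sub]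
  simp

attribute [irreducible] ambRefl

/-- The parameters `(y, ρ)` of the orbits of the rotations of `ℝ^N` in `ℝ^(N+1)`: the height and
the distance to the vertical axis. -/
abbrev OrbitBase : Type := ℝ × Ioi (0 : ℝ)

/-- The measure `ρ^(N-1) dy dρ` on the parameters of the orbits. -/
abbrev orbitMeasure (N : ℕ) : Measure OrbitBase :=
  (volume : Measure ℝ).prod (Measure.volumeIoiPow (N - 1))

/-- Cylindrical coordinates: the point `(ρ θ, y)`. -/
def cyl (w : OrbitBase × Sph N) : Amb N := join (w.1.2.1 • w.2.1) w.1.1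

lemma measurePreserving_join :
    MeasurePreserving (fun q : EuclideanSpace ℝ (Fin N) × ℝ => join q.1 q.2)
      ((volume : Measure (EuclideanSpace ℝ (Fin N))).prod volume) volume := by
  have h1 : MeasurePreserving (Prod.map (@WithLp.ofLp 2 (Fin N → ℝ)) (id : ℝ → ℝ))
      ((volume : Measure (EuclideanSpace ℝ (Fin N))).prod volume)
      ((volume : Measure (Fin N → ℝ)).prod volume) :=
    (PiLp.volume_preserving_ofLp (Fin N)).prod (MeasurePreserving.id _)
  have h2 : MeasurePreserving (Prod.swap : (Fin N → ℝ) × ℝ → ℝ × (Fin N → ℝ))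
      (volume.prod volume) (volume.prod volume) := Measure.measurePreserving_swap
  have h3 := (volume_preserving_piFinSuccAbove (fun _ : Fin (N + 1) => ℝ) (Fin.last N)).symm
  have h4 := PiLp.volume_preserving_toLp (Fin (N + 1))
  have h5 := h4.comp (h3.comp (h2.comp h1))
  have h6 : (fun q : EuclideanSpace ℝ (Fin N) × ℝ => join q.1 q.2) =
      WithLp.toLp 2 ∘ (MeasurableEquiv.piFinSuccAbove (fun _ => ℝ) (Fin.last N)).symm ∘
        Prod.swap ∘ Prod.map WithLp.ofLp id := by
    funext q
    exact congrArg (WithLp.toLp 2) (Fin.insertNth_last' (β := ℝ) q.2 (fun i => q.1 i)).symm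
  rw [h6]
  exact h5

lemma measurePreserving_cyl [NeZero N] :
    MeasurePreserving (cyl (N := N)) ((orbitMeasure N).prod (sphMeasure N)) volume := by
  have hpolar := measurePreserving_polar (EuclideanSpace ℝ (Fin N)) volume
  rw [finrank_euclideanSpace, Fintype.card_fin] at hpolar
  have h1 : MeasurePreserving (MeasurableEquiv.prodAssoc : (ℝ × Ioi (0 : ℝ)) × Sph N ≃ᵐ _)
      ((orbitMeasure N).prod (sphMeasure N))
      ((volume : Measure ℝ).prod ((Measure.volumeIoiPow (N - 1)).prod (sphMeasure N))) :=
    measurePreserving_prodAssoc _ _ _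
  have h2 : MeasurePreserving (Prod.swap : Ioi (0 : ℝ) × Sph N → _)
      ((Measure.volumeIoiPow (N - 1)).prod (sphMeasure N))
      ((sphMeasure N).prod (Measure.volumeIoiPow (N - 1))) := Measure.measurePreserving_swap
  have h3 := (MeasurePreserving.id (volume : Measure ℝ)).prod (hpolar.comp h2)
  have h4 : MeasurePreserving (Prod.swap : ℝ × EuclideanSpace ℝ (Fin N) → _)
      (volume.prod volume) (volume.prod volume) := Measure.measurePreserving_swap
  exact measurePreserving_join.comp (h4.comp (h3.comp h1))

lemma ambRefl_cyl (e : EuclideanSpace ℝ (Fin N)) (w : OrbitBase × Sph N) :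
    ambRefl e (cyl w) = cyl (w.1, sphRefl e w.2) := by
  rw [cyl, ambRefl_join, map_smul, cyl, coe_sphRefl]

/-- The foliated polarization of a function on `ℝ^(N+1)`, with respect to the first coordinate. -/
def polarizeAmb (e : EuclideanSpace ℝ (Fin N)) (v : Amb N → ℝ) : Amb N → ℝ :=
  polarize (ambRefl e) (fun z => z 0) v

/-- The first coordinate on the sphere, the height along which functions are rearranged. -/
def sphHeight [NeZero N] (θ : Sph N) : ℝ := θ.1 0

lemma measurable_sphHeight [NeZero N] : Measurable (sphHeight (N := N)) := by
  unfold sphHeight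
  fun_prop

lemma sphMeasure_sphHeight_eq_zero [NeZero N] (hN : 2 ≤ N) (s : ℝ) :
    sphMeasure N {θ | sphHeight θ = s} = 0 := by
  have h1 := sphMeasure_level_eq_zero hN (p := EuclideanSpace.single 0 1) (by simp) s
  convert h1 using 3
  ext θ
  simp [sphHeight, PiLp.inner_apply]

lemma polarizeAmb_comp_cyl [NeZero N] (e : EuclideanSpace ℝ (Fin N)) (v : Amb N → ℝ) :
    polarizeAmb e v ∘ cyl = polarizeProd sphRefl sphHeight e (v ∘ cyl) := by
  refine polarize_comp (τ := fun w : OrbitBase × Sph N => (w.1, sphRefl e w.2))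
    (k := fun w => sphHeight w.2) cyl (ambRefl_cyl e) (fun w => ?_) (fun w => ?_) v <;>
  · have := w.1.2.2
    simp only [cyl, join_zero_coord, PiLp.smul_apply, smul_eq_mul, sphHeight]
    exact mul_lt_mul_iff_right₀ this

lemma foldr_polarizeAmb_comp_cyl [NeZero N] (l : List (EuclideanSpace ℝ (Fin N))) (v : Amb N → ℝ) :
    l.foldr polarizeAmb v ∘ cyl = l.foldr (polarizeProd sphRefl sphHeight) (v ∘ cyl) := by
  induction l with
  | nil => rfl
  | cons e l ih => rw [List.foldr_cons, polarizeAmb_comp_cyl, ih, List.foldr_cons]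

end Coordinates

end FoliatedSchwarz

end
noncomputable section

namespace FoliatedSchwarz

open Filter Topology Metric
open scoped Pointwise NNReal RealInnerProductSpace

/-! ### Polarization of Lipschitz functions -/

section Energy

lemma lipschitzWith_polarize {T : Type*} [PseudoMetricSpace T] {σ : T → T} {h v : T → ℝ} {K : ℝ≥0}
    (hv : LipschitzWith K v) (hσ : ∀ z, σ (σ z) = z) (hiso : ∀ z w, dist (σ z) (σ w) = dist z w)
    (hsep : ∀ z w, h (σ z) < h z → h w ≤ h (σ w) → dist z (σ w) ≤ dist z w) :
    LipschitzWith K (polarize σ h v) := by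
  refine LipschitzWith.of_le_add_mul K fun z w => ?_
  have L := fun z w => hv.le_add_mul z w
  have hL : ∀ a b, dist a b ≤ dist z w → v a ≤ v b + K * dist z w := fun a b hab =>
    (L a b).trans (by gcongr)
  have hsw : ∀ z w, dist (σ z) w = dist z (σ w) := fun z w => by rw [← hiso, hσ]
  unfold polarize
  have a1 := hL z w le_rfl
  have a2 := hL (σ z) (σ w) (hiso z w).le
  rcases lt_trichotomy (h (σ z)) (h z) with hz | hz | hz <;>
  rcases lt_trichotomy (h (σ w)) (h w) with hw | hw | hw <;>
  simp only [hz, hw, hz.not_gt, hw.not_gt, if_true, if_false, lt_irrefl]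
  · exact max_le (a1.trans (by gcongr; exact le_max_left _ _))
      (a2.trans (by gcongr; exact le_max_right _ _))
  · exact max_le a1 (hL _ _ (by rw [hsw]; exact hsep z w hz hw.ge))
  · have a3 := hsep z w hz hw.le
    have b1 := hL z (σ w) a3
    have b2 := hL (σ z) w (by rw [hsw]; exact a3)
    rcases min_choice (v w) (v (σ w)) with hm | hm <;> rw [hm] <;>
      exact max_le (by assumption) (by assumption)
  · exact a1.trans (by gcongr; exact le_max_left _ _)
  · exact a1
  · have a3 := hsep (σ w) (σ z) (by rwa [hσ]) (by rw [hσ]; exact hz.le)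
    rw [hσ, hiso, dist_comm, dist_comm w] at a3
    have b1 := hL z (σ w) a3
    rcases min_choice (v w) (v (σ w)) with hm | hm <;> rw [hm] <;> assumption
  · exact (min_le_left _ _).trans (a1.trans (by gcongr; exact le_max_left _ _))
  · exact (min_le_left _ _).trans a1
  · rcases min_choice (v w) (v (σ w)) with hm | hm <;> rw [hm]
    · exact (min_le_left _ _).trans a1
    · exact (min_le_right _ _).trans a2

variable {N : ℕ}

/-- The weighted Dirichlet integral of a function on `ℝ^(N+1)`. -/
def ambEnergy (W v : Amb N → ℝ) : ℝ≥0∞ := ∫⁻ z, ENNReal.ofReal (W z * ‖fderiv ℝ v z‖ ^ 2)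

lemma sub_ambRefl_coord (e : EuclideanSpace ℝ (Fin N)) (z : Amb N) :
    z 0 - (ambRefl e z) 0 = (2 * ⟪join e 0, z⟫ / ‖join e 0‖ ^ 2) * (join e 0) 0 := by
  rw [ambRefl_apply]; simp

lemma dist_ambRefl_le (e : EuclideanSpace ℝ (Fin N)) (z w : Amb N)
    (hz : (ambRefl e z) 0 < z 0) (hw : w 0 ≤ (ambRefl e w) 0) :
    dist z (ambRefl e w) ≤ dist z w := by
  have hz' := sub_ambRefl_coord e z
  have hw' := sub_ambRefl_coord e w
  set f : Amb N := join e 0 with hf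
  have hf0 : f ≠ 0 := by
    intro h0
    rw [h0] at hz'
    simp at hz'
    linarith
  have hn : 0 < ‖f‖ := norm_pos_iff.2 hf0
  set a := 2 * ⟪f, z⟫ / ‖f‖ ^ 2 with ha
  set b := 2 * ⟪f, w⟫ / ‖f‖ ^ 2 with hb
  have h1 : 0 < a * f 0 := by linarith
  have h2 : b * f 0 ≤ 0 := by linarith
  have hab : a * b ≤ 0 := by
    by_contra hc
    have h3 : 0 < f 0 ^ 2 := by
      have : f 0 ≠ 0 := fun h0 => by rw [h0] at h1; simp at h1
      positivity
    nlinarith [mul_nonneg h1.le (neg_nonneg.2 h2), mul_pos (not_le.1 hc) h3]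
  have haz : ⟪f, z⟫ = a * ‖f‖ ^ 2 / 2 := by rw [ha]; field_simp
  have hbw : ⟪f, w⟫ = b * ‖f‖ ^ 2 / 2 := by rw [hb]; field_simp
  rw [dist_eq_norm, dist_eq_norm]
  refine le_of_sq_le_sq ?_ (norm_nonneg _)
  have h4 : z - ambRefl e w = (z - w) + b • f := by rw [ambRefl_apply]; abel
  rw [h4, norm_add_sq_real, inner_smul_right, norm_smul, mul_pow, Real.norm_eq_abs, sq_abs,
    inner_sub_left, real_inner_comm, real_inner_comm f w, haz, hbw]
  have h5 : 0 ≤ -(a * b) * ‖f‖ ^ 2 := mul_nonneg (by linarith) (by positivity)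
  nlinarith

lemma lipschitzWith_polarizeAmb (e : EuclideanSpace ℝ (Fin N)) {v : Amb N → ℝ} {K : ℝ≥0}
    (hv : LipschitzWith K v) : LipschitzWith K (polarizeAmb e v) :=
  lipschitzWith_polarize hv (ambRefl_ambRefl e) (fun z w => (ambRefl e).dist_map z w)
    (fun z w => dist_ambRefl_le e z w)

lemma fderiv_eq_of_le {E : Type*} [NormedAddCommGroup E] [NormedSpace ℝ E] {f g : E → ℝ} {z : E}
    (hf : DifferentiableAt ℝ f z) (hg : DifferentiableAt ℝ g z) (hle : ∀ᶠ w in 𝓝 z, f w ≤ g w)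
    (heq : f z = g z) : fderiv ℝ f z = fderiv ℝ g z := by
  have h1 : IsLocalMin (g - f) z := by
    filter_upwards [hle] with w hw
    simp only [Pi.sub_apply, heq]
    linarith
  have h2 := h1.fderiv_eq_zero
  rw [fderiv_sub hg hf] at h2
  exact (sub_eq_zero.1 h2).symm

lemma norm_fderiv_comp_isometry {E : Type*} [NormedAddCommGroup E] [NormedSpace ℝ E]
    (L : E ≃ₗᵢ[ℝ] E) (v : E → ℝ) (z : E) : ‖fderiv ℝ (v ∘ L) z‖ = ‖fderiv ℝ v (L z)‖ := by
  have h1 : fderiv ℝ (v ∘ L) z = (fderiv ℝ v (L z)).comp (L.toContinuousLinearEquiv : E →L[ℝ] E) :=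
    L.toContinuousLinearEquiv.comp_right_fderiv
  rw [h1]
  exact ContinuousLinearMap.opNorm_comp_linearIsometryEquiv _ L

/-- Off the reflecting hyperplane, polarization permutes the norms of the gradients at the two
points of an orbit: a maximum of two functions has at a point of differentiability the gradient of
whichever function attains it. -/
lemma norm_fderiv_polarize_add {E : Type*} [NormedAddCommGroup E] [NormedSpace ℝ E]
    {L : E ≃ₗᵢ[ℝ] E} (hL : ∀ z, L (L z) = z) {h v : E → ℝ} (hh : Continuous h) {z : E}
    (hz : h (L z) ≠ h z) (d1 : DifferentiableAt ℝ v z) (d2 : DifferentiableAt ℝ v (L z))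
    (d3 : DifferentiableAt ℝ (polarize L h v) z) (d4 : DifferentiableAt ℝ (polarize L h v) (L z)) :
    ‖fderiv ℝ (polarize L h v) z‖ ^ 2 + ‖fderiv ℝ (polarize L h v) (L z)‖ ^ 2 =
      ‖fderiv ℝ v z‖ ^ 2 + ‖fderiv ℝ v (L z)‖ ^ 2 := by
  wlog hlt : h (L z) < h z generalizing z
  · have := this (z := L z) (by rw [hL]; exact hz.symm) d2 (by rwa [hL]) d4 (by rwa [hL])
      (by rw [hL]; exact lt_of_le_of_ne (not_lt.1 hlt) hz.symm)
    rw [hL] at this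
    linarith
  have c1 : DifferentiableAt ℝ (v ∘ L) z := d2.comp z L.differentiableAt
  have c2 : DifferentiableAt ℝ (v ∘ L) (L z) := by
    refine DifferentiableAt.comp (L z) ?_ L.differentiableAt
    rwa [hL]
  have n1 : ∀ᶠ w in 𝓝 z, polarize L h v w = max (v w) (v (L w)) := by
    filter_upwards [((hh.comp L.continuous).tendsto z).eventually_lt (hh.tendsto z) hlt] with w hw
    exact if_pos hw
  have n2 : ∀ᶠ w in 𝓝 (L z), polarize L h v w = min (v w) (v (L w)) := by
    have hlt' : h (L z) < h (L (L z)) := by rwa [hL]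
    filter_upwards [(hh.tendsto (L z)).eventually_lt ((hh.comp L.continuous).tendsto (L z)) hlt']
      with w hw
    have hw' : h w < h (L w) := hw
    rw [polarize, if_neg hw'.not_gt, if_pos hw']
  have e1 := n1.self_of_nhds
  have e2 := n2.self_of_nhds
  rw [hL] at e2
  rcases le_total (v (L z)) (v z) with hle | hle
  · have f1 : fderiv ℝ v z = fderiv ℝ (polarize L h v) z :=
      fderiv_eq_of_le d1 d3 (n1.mono fun w hw => by rw [hw]; exact le_max_left _ _)
        (by rw [e1, max_eq_left hle])
    have f2 : fderiv ℝ (polarize L h v) (L z) = fderiv ℝ v (L z) :=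
      fderiv_eq_of_le d4 d2 (n2.mono fun w hw => by rw [hw]; exact min_le_left _ _)
        (by rw [e2, min_eq_left hle])
    rw [f1, f2]
  · have f1 : fderiv ℝ (v ∘ L) z = fderiv ℝ (polarize L h v) z :=
      fderiv_eq_of_le c1 d3 (n1.mono fun w hw => by rw [hw]; exact le_max_right _ _)
        (by rw [e1, max_eq_right hle]; rfl)
    have f2 : fderiv ℝ (polarize L h v) (L z) = fderiv ℝ (v ∘ L) (L z) :=
      fderiv_eq_of_le d4 c2 (n2.mono fun w hw => by rw [hw]; exact min_le_right _ _)
        (by rw [e2, min_eq_right hle]; simp [hL])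
    rw [← f1, f2, norm_fderiv_comp_isometry, norm_fderiv_comp_isometry, hL]
    ring

lemma ae_ambRefl_coord_ne {e : EuclideanSpace ℝ (Fin N)} (he : (join e 0 : Amb N) 0 ≠ 0) :
    ∀ᵐ z : Amb N, (ambRefl e z) 0 ≠ z 0 := by
  have hne : (ℝ ∙ (join e 0 : Amb N))ᗮ ≠ ⊤ := by
    intro htop
    rw [Submodule.orthogonal_eq_top_iff, Submodule.span_singleton_eq_bot] at htop
    rw [htop] at he
    exact he rfl
  have h0 := Measure.addHaar_submodule (volume : Measure (Amb N)) _ hne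
  rw [ae_iff]
  refine measure_mono_null (fun z hz => ?_) h0
  have hz' : (ambRefl e z) 0 = z 0 := not_not.1 hz
  have h1 := sub_ambRefl_coord e z
  rw [hz', sub_self] at h1
  have hn : ‖(join e 0 : Amb N)‖ ≠ 0 := fun h => he (by rw [norm_eq_zero.1 h]; rfl)
  have h2 : 2 * ⟪join e 0, z⟫ / ‖(join e 0 : Amb N)‖ ^ 2 = 0 :=
    (mul_eq_zero.1 h1.symm).resolve_right he
  have h3 : ⟪join e 0, z⟫ = 0 := by
    rcases div_eq_zero_iff.1 h2 with h | h
    · linarith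
    · exact absurd (pow_eq_zero_iff (two_ne_zero) |>.1 h) hn
  exact Submodule.mem_orthogonal_singleton_iff_inner_right.2 h3

/-- Polarization does not increase the Dirichlet integral of a Lipschitz function, for weights
invariant under the reflection: by Rademacher's theorem the pointwise identity
`norm_fderiv_polarize_add` holds almost everywhere, and it is averaged over the orbits. -/
lemma ambEnergy_polarizeAmb_le (e : EuclideanSpace ℝ (Fin N)) {W v : Amb N → ℝ} {K : ℝ≥0}
    (hW : Measurable W) (hW0 : ∀ z, 0 ≤ W z) (hWσ : ∀ z, W (ambRefl e z) = W z)
    (hv : LipschitzWith K v) : ambEnergy W (polarizeAmb e v) ≤ ambEnergy W v := by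
  by_cases he : (join e 0 : Amb N) 0 = 0
  · have h1 : polarizeAmb e v = v := by
      ext z
      have := sub_ambRefl_coord e z
      rw [he, mul_zero, sub_eq_zero] at this
      simp [polarizeAmb, polarize, this]
    rw [h1]
  have hmp : MeasurePreserving (ambRefl e) (volume : Measure (Amb N)) volume :=
    (ambRefl e).measurePreserving
  have hp := lipschitzWith_polarizeAmb e hv
  have key : ∀ f : Amb N → ℝ, 2 * ambEnergy W f =
      ∫⁻ z, ENNReal.ofReal (W z * (‖fderiv ℝ f z‖ ^ 2 + ‖fderiv ℝ f (ambRefl e z)‖ ^ 2)) := by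
    intro f
    have hF : Measurable fun z => ENNReal.ofReal (W z * ‖fderiv ℝ f z‖ ^ 2) :=
      ENNReal.measurable_ofReal.comp (hW.mul ((measurable_fderiv ℝ f).norm.pow_const 2))
    rw [ambEnergy, two_mul]
    nth_rewrite 2 [← hmp.lintegral_comp hF]
    rw [← lintegral_add_left hF]
    refine lintegral_congr fun z => ?_
    rw [hWσ, mul_add, ENNReal.ofReal_add (mul_nonneg (hW0 z) (sq_nonneg _))
      (mul_nonneg (hW0 z) (sq_nonneg _))]
  have h2 : 2 * ambEnergy W (polarizeAmb e v) = 2 * ambEnergy W v := by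
    rw [key, key]
    refine lintegral_congr_ae ?_
    have dv := hv.ae_differentiableAt (μ := (volume : Measure (Amb N)))
    have dp := hp.ae_differentiableAt (μ := (volume : Measure (Amb N)))
    filter_upwards [dv, dp, hmp.quasiMeasurePreserving.ae dv, hmp.quasiMeasurePreserving.ae dp,
      ae_ambRefl_coord_ne he] with z d1 d3 d2 d4 hne
    have h3 := norm_fderiv_polarize_add (L := ambRefl e) (h := fun z : Amb N => z 0)
      (ambRefl_ambRefl e) (by fun_prop) hne d1 d2 d3 d4
    rw [polarizeAmb, h3]
  exact ((ENNReal.mul_right_inj (by simp) (by simp)).1 h2).le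

/-- The divergence of a vector field on `ℝ^(N+1)`. -/
def ambDiv (Y : Amb N → Amb N) (z : Amb N) : ℝ :=
  ∑ i, (fderiv ℝ Y z (EuclideanSpace.single i 1)) i

lemma integral_mul_ambDiv {v : Amb N → ℝ} {K : ℝ≥0} (hv : LipschitzWith K v) {Y : Amb N → Amb N}
    (hY : ContDiff ℝ 1 Y) (hYc : HasCompactSupport Y) :
    Integrable (fun z => fderiv ℝ v z (Y z)) ∧
    ∫ z, v z * ambDiv Y z = - ∫ z, fderiv ℝ v z (Y z) := by
  set b : Fin (N + 1) → Amb N := fun i => EuclideanSpace.single i 1 with hb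
  have hYd : Differentiable ℝ Y := hY.differentiable one_ne_zero
  have hpr : ∀ i z, fderiv ℝ (fun w => Y w i) z (b i) = (fderiv ℝ Y z (b i)) i := by
    intro i z
    have := ((EuclideanSpace.proj i : Amb N →L[ℝ] ℝ).hasFDerivAt.comp z (hYd z).hasFDerivAt).fderiv
    have h2 : ((EuclideanSpace.proj i : Amb N →L[ℝ] ℝ) ∘ Y) = fun w => Y w i := rfl
    rw [h2] at this
    rw [this]; rfl
  have hYi : ∀ i, ContDiff ℝ 1 fun w => Y w i := fun i =>
    (EuclideanSpace.proj i : Amb N →L[ℝ] ℝ).contDiff.comp hY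
  have hYic : ∀ i, HasCompactSupport fun w => Y w i := fun i =>
    hYc.comp_left (g := fun y : Amb N => y i) rfl
  have hdv := hv.ae_differentiableAt (μ := (volume : Measure (Amb N)))
  have hint : ∀ i, Integrable fun z => lineDeriv ℝ v z (b i) * Y z i := by
    intro i
    have h1 : Integrable (fun z => Y z i) :=
      (hYi i).continuous.integrable_of_hasCompactSupport (hYic i)
    exact h1.bdd_mul (c := K * ‖b i‖)
      (aestronglyMeasurable_lineDeriv hv.continuous _)
      (.of_forall fun z => norm_lineDeriv_le_of_lipschitz ℝ hv)
  have hsum : (fun z => fderiv ℝ v z (Y z)) =ᵐ[volume]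
      fun z => ∑ i, lineDeriv ℝ v z (b i) * Y z i := by
    filter_upwards [hdv] with z hz
    have h1 : Y z = ∑ i, Y z i • b i := by
      ext j
      simp [hb, Pi.single_apply]
    conv_lhs => rw [h1]
    rw [map_sum]
    refine Finset.sum_congr rfl fun i _ => ?_
    rw [map_smul, hz.lineDeriv_eq_fderiv, smul_eq_mul, mul_comm]
  refine ⟨(integrable_finsetSum _ fun i _ => hint i).congr hsum.symm, ?_⟩
  rw [integral_congr_ae hsum, integral_finsetSum _ fun i _ => hint i, ← Finset.sum_neg_distrib]
  have hparts : ∀ i, - ∫ z, lineDeriv ℝ v z (b i) * Y z i =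
      ∫ z, v z * (fderiv ℝ Y z (b i)) i := by
    intro i
    obtain ⟨D, hD⟩ := (hYi i).lipschitzWith_of_hasCompactSupport (hYic i) one_ne_zero
    rw [hv.integral_lineDeriv_mul_eq hD (hYic i), ← integral_neg]
    refine integral_congr_ae (.of_forall fun z => ?_)
    have hd : DifferentiableAt ℝ (fun w => Y w i) z := (hYi i).differentiable one_ne_zero z
    beta_reduce
    rw [hd.lineDeriv_eq_fderiv, map_neg, hpr]
    ring
  simp_rw [hparts]
  rw [← integral_finsetSum]
  · simp_rw [ambDiv, Finset.mul_sum]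
    rfl
  · intro i _
    have h1 : Continuous fun z => (fderiv ℝ Y z (b i)) i := by
      have := hY.continuous_fderiv one_ne_zero
      fun_prop
    have h2 : HasCompactSupport fun z => (fderiv ℝ Y z (b i)) i :=
      (hYc.fderiv ℝ).comp_left (g := fun T : Amb N →L[ℝ] Amb N => T (b i) i) rfl
    exact (hv.continuous.mul h1).integrable_of_hasCompactSupport h2.mul_left

/-- The dual form of the energy bound, which is stable under `L¹` convergence. -/
lemma neg_two_integral_mul_ambDiv_le {v W q : Amb N → ℝ} {K : ℝ≥0} (hv : LipschitzWith K v)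
    {Y : Amb N → Amb N} (hY : ContDiff ℝ 1 Y) (hYc : HasCompactSupport Y) (hW : Measurable W)
    (hW0 : ∀ z, 0 ≤ W z) (hq0 : ∀ z, 0 ≤ q z) (hYW : ∀ z, ‖Y z‖ ^ 2 ≤ W z * q z) :
    ENNReal.ofReal (-(2 * ∫ z, v z * ambDiv Y z)) ≤ ambEnergy W v + ∫⁻ z, ENNReal.ofReal (q z) := by
  obtain ⟨hi, hp⟩ := integral_mul_ambDiv hv hY hYc
  rw [hp, mul_neg, neg_neg, ← integral_const_mul]
  have hpt : ∀ z, 2 * fderiv ℝ v z (Y z) ≤ W z * ‖fderiv ℝ v z‖ ^ 2 + q z := by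
    intro z
    have h1 : fderiv ℝ v z (Y z) ≤ ‖fderiv ℝ v z‖ * ‖Y z‖ :=
      (le_abs_self _).trans ((fderiv ℝ v z).le_opNorm _)
    set a := ‖fderiv ℝ v z‖
    have ha : 0 ≤ a := norm_nonneg _
    -- Young's inequality, in a form which does not divide by the weight
    have h2 : (2 * (a * ‖Y z‖)) ^ 2 ≤ (W z * a ^ 2 + q z) ^ 2 := by
      nlinarith [sq_nonneg (W z * a ^ 2 - q z), mul_le_mul_of_nonneg_left (hYW z) (sq_nonneg a)]
    have h3 := abs_le_of_sq_le_sq' h2 (add_nonneg (mul_nonneg (hW0 z) (sq_nonneg a)) (hq0 z))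
    linarith [h3.2]
  have hm : Measurable fun z => ENNReal.ofReal (W z * ‖fderiv ℝ v z‖ ^ 2) :=
    ENNReal.measurable_ofReal.comp (hW.mul ((measurable_fderiv ℝ v).norm.pow_const 2))
  rw [ambEnergy, ← lintegral_add_left hm]
  calc ENNReal.ofReal (∫ z, 2 * fderiv ℝ v z (Y z))
      ≤ ENNReal.ofReal (∫ z, max (2 * fderiv ℝ v z (Y z)) 0) := by
        refine ENNReal.ofReal_le_ofReal (integral_mono (hi.const_mul 2) (hi.const_mul 2).pos_part
          fun z => le_max_left _ _)
    _ = ∫⁻ z, ENNReal.ofReal (max (2 * fderiv ℝ v z (Y z)) 0) :=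
        ofReal_integral_eq_lintegral_ofReal (hi.const_mul 2).pos_part
          (.of_forall fun z => le_max_right _ _)
    _ ≤ _ := by
        refine lintegral_mono fun z => ?_
        rw [← ENNReal.ofReal_add (mul_nonneg (hW0 z) (sq_nonneg _)) (hq0 z)]
        exact ENNReal.ofReal_le_ofReal (max_le (hpt z)
          (add_nonneg (mul_nonneg (hW0 z) (sq_nonneg _)) (hq0 z)))

end Energy

end FoliatedSchwarz

end
noncomputable section

namespace FoliatedSchwarz

open Filter Topology Metric
open scoped Pointwise NNReal RealInnerProductSpace

/-! ### The energy inequality for the fibrewise rearrangement -/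

section Limit

lemma abs_integral_mul_sub_le {T : Type*} [MeasurableSpace T] {κ : Measure T} {A : Set T}
    (hA : MeasurableSet A) {f g d : T → ℝ} {C δ : ℝ} (hC : 0 ≤ C) (hδ : 0 ≤ δ)
    (hf : Integrable (fun x => f x * d x) κ) (hg : Integrable (fun x => g x * d x) κ)
    (hdA : ∀ x, x ∉ A → d x = 0) (hdC : ∀ x, |d x| ≤ C)
    (hfg : ∫⁻ x in A, ENNReal.ofReal |f x - g x| ∂κ ≤ ENNReal.ofReal δ) :
    |∫ x, f x * d x ∂κ - ∫ x, g x * d x ∂κ| ≤ C * δ := by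
  rw [← integral_sub hf hg, ← Real.norm_eq_abs]
  refine (norm_integral_le_lintegral_norm _).trans ?_
  refine ENNReal.toReal_le_of_le_ofReal (mul_nonneg hC hδ) ?_
  rw [ENNReal.ofReal_mul hC]
  calc ∫⁻ x, ENNReal.ofReal ‖f x * d x - g x * d x‖ ∂κ
      ≤ ∫⁻ x, ENNReal.ofReal C * A.indicator (fun x => ENNReal.ofReal |f x - g x|) x ∂κ := by
        refine lintegral_mono fun x => ?_
        rw [← sub_mul, norm_mul, Real.norm_eq_abs, Real.norm_eq_abs]
        by_cases hx : x ∈ A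
        · rw [indicator_of_mem hx, ← ENNReal.ofReal_mul hC, mul_comm]
          exact ENNReal.ofReal_le_ofReal (mul_le_mul_of_nonneg_right (hdC x) (abs_nonneg _))
        · simp [hdA x hx]
    _ = ENNReal.ofReal C * ∫⁻ x in A, ENNReal.ofReal |f x - g x| ∂κ := by
        rw [lintegral_const_mul' _ _ ENNReal.ofReal_ne_top, lintegral_indicator hA]
    _ ≤ _ := mul_le_mul_right hfg _

lemma integrable_mul_of_close {T : Type*} [MeasurableSpace T] {κ : Measure T} {A : Set T}
    (hA : MeasurableSet A) {f g d : T → ℝ} {C : ℝ} (hfm : AEStronglyMeasurable f κ)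
    (hdm : AEStronglyMeasurable d κ) (hg : Integrable (fun x => g x * d x) κ)
    (hgm : AEStronglyMeasurable g κ)
    (hdA : ∀ x, x ∉ A → d x = 0) (hdC : ∀ x, |d x| ≤ C)
    (hfg : ∫⁻ x in A, ENNReal.ofReal |f x - g x| ∂κ ≠ ∞) :
    Integrable (fun x => f x * d x) κ := by
  have h1 : Integrable (fun x => f x * d x - g x * d x) κ := by
    refine ⟨(hfm.mul hdm).sub (hgm.mul hdm), ?_⟩
    refine lt_of_le_of_lt (b := ∫⁻ x, ENNReal.ofReal C *
      A.indicator (fun x => ENNReal.ofReal |f x - g x|) x ∂κ) (lintegral_mono fun x => ?_) ?_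
    · beta_reduce
      rw [← sub_mul, enorm_mul, Real.enorm_eq_ofReal_abs, Real.enorm_eq_ofReal_abs]
      by_cases hx : x ∈ A
      · rw [indicator_of_mem hx, mul_comm]
        exact mul_le_mul_left (ENNReal.ofReal_le_ofReal (hdC x)) _
      · simp [hdA x hx]
    · rw [lintegral_const_mul' _ _ ENNReal.ofReal_ne_top, lintegral_indicator hA]
      exact ENNReal.mul_lt_top ENNReal.ofReal_lt_top hfg.lt_top
  exact (h1.add hg).congr (.of_forall fun x => by simp)

variable {N : ℕ}

/-- A box of orbits of finite measure. -/
def orbitBox (R : ℝ) : Set OrbitBase := Ioo (-R) R ×ˢ {r | r.1 < R}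

lemma measurableSet_orbitBox (R : ℝ) : MeasurableSet (orbitBox R) :=
  measurableSet_Ioo.prod (measurableSet_lt measurable_subtype_coe measurable_const)

lemma orbitMeasure_orbitBox_lt_top {R : ℝ} (hR : 0 < R) : orbitMeasure N (orbitBox R) < ∞ := by
  have h1 : {r : Ioi (0 : ℝ) | r.1 < R} = Iio ⟨R, hR⟩ := by
    ext r
    exact Iff.rfl
  rw [orbitBox, Measure.prod_prod, h1, Measure.volumeIoiPow_apply_Iio]
  exact ENNReal.mul_lt_top measure_Ioo_lt_top ENNReal.ofReal_lt_top

lemma mem_orbitBox_of_norm_lt {R : ℝ} {w : OrbitBase × Sph N} (hw : ‖cyl w‖ < R) :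
    w.1 ∈ orbitBox R := by
  have h1 := norm_join_sq (w.1.2.1 • w.2.1) w.1.1
  have h2 : ‖w.1.2.1 • w.2.1‖ = w.1.2.1 := by
    rw [norm_smul, Real.norm_of_nonneg (le_of_lt w.1.2.2)]
    simp
  rw [h2] at h1
  have h3 : ‖join (w.1.2.1 • w.2.1) w.1.1‖ < R := hw
  have h0 := norm_nonneg (join (w.1.2.1 • w.2.1) w.1.1)
  have hsq : w.1.2.1 ^ 2 + w.1.1 ^ 2 < R ^ 2 := by rw [← h1]; gcongr
  have hR : 0 ≤ R := h0.trans h3.le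
  have hρ : (0 : ℝ) < w.1.2.1 := w.1.2.2
  have h4 : |w.1.1| < R := abs_lt_of_sq_lt_sq (by nlinarith) hR
  have h5 : |w.1.2.1| < R := abs_lt_of_sq_lt_sq (by nlinarith [sq_nonneg w.1.1]) hR
  exact ⟨abs_lt.1 h4, (abs_lt.1 h5).2⟩

/-- The set of points of the cylindrical coordinates over a box. -/
abbrev boxProd (N : ℕ) (R : ℝ) : Set (OrbitBase × Sph N) := orbitBox R ×ˢ univ

lemma measurableSet_boxProd (R : ℝ) : MeasurableSet (boxProd N R) :=
  (measurableSet_orbitBox R).prod MeasurableSet.univ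

lemma restrict_boxProd (R : ℝ) :
    ((orbitMeasure N).prod (sphMeasure N)).restrict (boxProd N R) =
      ((orbitMeasure N).restrict (orbitBox R)).prod (sphMeasure N) := by
  rw [← Measure.prod_restrict, Measure.restrict_univ]

lemma integrable_bounded_mul_box {R M C : ℝ} (hR : 0 < R) {f d : OrbitBase × Sph N → ℝ}
    (hf : Measurable f) (hd : Measurable d) (hfM : ∀ x, |f x| ≤ M)
    (hdC : ∀ x, |d x| ≤ C) (hdA : ∀ x, x ∉ boxProd N R → d x = 0) :
    Integrable (fun x => f x * d x) ((orbitMeasure N).prod (sphMeasure N)) := by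
  have h1 : IntegrableOn (fun x => f x * d x) (boxProd N R)
      ((orbitMeasure N).prod (sphMeasure N)) := by
    refine Measure.integrableOn_of_bounded (M := M * C) ?_ (hf.mul hd).aestronglyMeasurable
      (.of_forall fun x => ?_)
    · rw [Measure.prod_prod]
      exact ENNReal.mul_ne_top (orbitMeasure_orbitBox_lt_top hR).ne (measure_ne_top _ _)
    · rw [norm_mul]
      exact mul_le_mul (hfM x) (hdC x) (norm_nonneg _) ((abs_nonneg _).trans (hfM x))
  rw [← integrable_indicator_iff (measurableSet_boxProd R)] at h1
  refine h1.congr (.of_forall fun x => ?_)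
  by_cases hx : x ∈ boxProd N R
  · exact indicator_of_mem hx _
  · rw [indicator_of_notMem hx]
    simp [hdA x hx]

variable [NeZero N]

/-- The fibrewise rearrangement of a function on `ℝ^(N+1)`, in cylindrical coordinates. -/
def starCyl (f : Amb N → ℝ) : OrbitBase × Sph N → ℝ :=
  rearrProd (sphMeasure N) sphHeight (f ∘ cyl)

lemma measurable_cyl : Measurable (cyl (N := N)) := measurePreserving_cyl.measurable

lemma measurable_starCyl {f : Amb N → ℝ} (hf : Measurable f) : Measurable (starCyl f) :=
  measurable_rearr_prod measurable_sphHeight (hf.comp measurable_cyl)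

lemma starCyl_nonneg (f : Amb N → ℝ) (w : OrbitBase × Sph N) : 0 ≤ starCyl f w :=
  rearr_nonneg _ _

/-- A vector field for testing the energy, with its weights: `‖Y‖² ≤ W q`, where `W` is a weight
invariant under the foliated reflections. -/
structure IsWeightedField (Y : Amb N → Amb N) (W q : Amb N → ℝ) : Prop where
  smooth : ContDiff ℝ 1 Y
  compact : HasCompactSupport Y
  measurable_weight : Measurable W
  weight_nonneg : ∀ z, 0 ≤ W z
  weight_refl : ∀ e z, W (ambRefl e z) = W z
  dual_nonneg : ∀ z, 0 ≤ q z
  sq_le : ∀ z, ‖Y z‖ ^ 2 ≤ W z * q z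

omit [NeZero N] in
lemma IsWeightedField.exists_bounds {Y : Amb N → Amb N} {W q : Amb N → ℝ}
    (hY : IsWeightedField Y W q) :
    Measurable (ambDiv Y) ∧ ∃ R C : ℝ, 0 < R ∧ 0 < C ∧ (∀ z, |ambDiv Y z| ≤ C) ∧
      ∀ w, w ∉ boxProd N R → ambDiv Y (cyl w) = 0 := by
  have hc : Continuous (ambDiv Y) := by
    have := hY.smooth.continuous_fderiv one_ne_zero
    unfold ambDiv
    fun_prop
  have hs : HasCompactSupport (ambDiv Y) := by
    have := (hY.compact.fderiv ℝ).comp_left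
      (g := fun T : Amb N →L[ℝ] Amb N => ∑ i, T (EuclideanSpace.single i 1) i) (by simp)
    exact this
  obtain ⟨C, hC⟩ := hs.exists_bound_of_continuous hc
  obtain ⟨R, hR0, hR⟩ := hs.isCompact.isBounded.subset_ball_lt 0 0
  refine ⟨hc.measurable, R, max C 1, hR0, by positivity,
    fun z => (hC z).trans (le_max_left _ _), fun w hw => ?_⟩
  by_contra hne
  have h1 : cyl w ∈ ball (0 : Amb N) R := hR (subset_tsupport _ hne)
  exact hw ⟨mem_orbitBox_of_norm_lt (by simpa using h1), mem_univ _⟩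

lemma integral_comp_cyl {f : Amb N → ℝ} (hf : Measurable f) :
    ∫ w, f (cyl w) ∂((orbitMeasure N).prod (sphMeasure N)) = ∫ z, f z := by
  rw [← measurePreserving_cyl.map_eq, integral_map measurable_cyl.aemeasurable
    hf.aestronglyMeasurable]

lemma ofReal_neg_two_le_of_forall {I : ℝ} {A : ℝ≥0∞} {C : ℝ} (hC : 0 < C)
    (h : ∀ ε : ℝ, 0 < ε → ∃ J : ℝ, |J - I| ≤ C * ε ∧
      ENNReal.ofReal (-(2 * J)) ≤ A + ENNReal.ofReal ε) :
    ENNReal.ofReal (-(2 * I)) ≤ A := by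
  refine ENNReal.le_of_forall_pos_le_add fun δ hδ _ => ?_
  have hε : (0 : ℝ) < δ / (2 * C + 1) := by positivity
  obtain ⟨J, hJ, hJA⟩ := h _ hε
  have h1 : -(2 * I) ≤ -(2 * J) + 2 * (C * (δ / (2 * C + 1))) := by
    have := (abs_le.1 hJ).2
    linarith
  calc ENNReal.ofReal (-(2 * I))
      ≤ ENNReal.ofReal (-(2 * J)) + ENNReal.ofReal (2 * (C * (δ / (2 * C + 1)))) :=
        (ENNReal.ofReal_le_ofReal h1).trans ENNReal.ofReal_add_le
    _ ≤ A + ENNReal.ofReal (δ / (2 * C + 1)) + ENNReal.ofReal (2 * (C * (δ / (2 * C + 1)))) := by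
        gcongr
    _ = A + δ := by
        rw [add_assoc, ← ENNReal.ofReal_add hε.le (by positivity)]
        congr 1
        rw [← ENNReal.ofReal_coe_nnreal]
        congr 1
        field_simp
        ring

/-- Iterated polarizations of a Lipschitz function do not increase its energy and converge to its
rearrangement; the dual form of the energy bound passes to the limit. -/
lemma star_energy_of_lipschitz (hN : 2 ≤ N) {v : Amb N → ℝ} {K : ℝ≥0} {M : ℝ}
    (hv : LipschitzWith K v) (hv0 : ∀ z, 0 ≤ v z) (hvM : ∀ z, v z ≤ M)
    {Y : Amb N → Amb N} {W q : Amb N → ℝ} (hY : IsWeightedField Y W q) :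
    ENNReal.ofReal (-(2 * ∫ w, starCyl v w * ambDiv Y (cyl w)
      ∂((orbitMeasure N).prod (sphMeasure N)))) ≤
      ambEnergy W v + ∫⁻ z, ENNReal.ofReal (q z) := by
  obtain ⟨hdm, R, C, hR, hC, hdC, hdR⟩ := hY.exists_bounds
  have hM : 0 ≤ M := (hv0 0).trans (hvM 0)
  refine ofReal_neg_two_le_of_forall hC fun ε hε => ?_
  have hfin : IsFiniteMeasure ((orbitMeasure N).restrict (orbitBox R)) :=
    ⟨by rw [Measure.restrict_apply_univ]; exact orbitMeasure_orbitBox_lt_top hR⟩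
  have hvm : Measurable v := hv.continuous.measurable
  obtain ⟨l, hl⟩ := exists_list_polarizeProd_close
    (β := (orbitMeasure N).restrict (orbitBox R)) (isSpreading_sphRefl hN) (spreadConst_ne_zero N)
    measurable_sphHeight (sphMeasure_sphHeight_eq_zero hN) (v := v ∘ cyl)
    (hvm.comp measurable_cyl) (fun x => hv0 _) (fun x => hvM _) hε
  have hL : LipschitzWith K (l.foldr polarizeAmb v) ∧ (∀ z, 0 ≤ l.foldr polarizeAmb v z) ∧
      (∀ z, l.foldr polarizeAmb v z ≤ M) ∧ ambEnergy W (l.foldr polarizeAmb v) ≤ ambEnergy W v := by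
    clear hl
    induction l with
    | nil => exact ⟨hv, hv0, hvM, le_rfl⟩
    | cons e l ih =>
      rw [List.foldr_cons]
      exact ⟨lipschitzWith_polarizeAmb e ih.1, fun z => le_polarize ih.2.1 z,
        fun z => polarize_le ih.2.2.1 z, (ambEnergy_polarizeAmb_le e hY.measurable_weight
          hY.weight_nonneg (hY.weight_refl e) ih.1).trans ih.2.2.2⟩
  set vl := l.foldr polarizeAmb v with hvl
  rw [← foldr_polarizeAmb_comp_cyl, ← hvl] at hl
  refine ⟨∫ z, vl z * ambDiv Y z, ?_, ?_⟩
  · have hvlm : Measurable vl := hL.1.continuous.measurable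
    rw [← integral_comp_cyl (f := fun z => vl z * ambDiv Y z) (hvlm.mul hdm)]
    refine abs_integral_mul_sub_le (measurableSet_boxProd R) hC.le hε.le ?_ ?_ hdR
      (fun x => hdC _) ?_
    · refine integrable_bounded_mul_box (M := M) hR (hvlm.comp measurable_cyl)
        (hdm.comp measurable_cyl) (fun x => ?_) (fun x => hdC _) hdR
      rw [abs_of_nonneg (hL.2.1 (cyl x))]
      exact hL.2.2.1 _
    · refine integrable_bounded_mul_box (M := M) hR (measurable_starCyl hvm)
        (hdm.comp measurable_cyl) (fun x => ?_) (fun x => hdC _) hdR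
      rw [abs_of_nonneg (starCyl_nonneg _ _)]
      exact rearr_le hM (fun θ => hvM _) _
    · rw [restrict_boxProd]
      exact hl.le
  · refine (neg_two_integral_mul_ambDiv_le hL.1 hY.smooth hY.compact hY.measurable_weight
      hY.weight_nonneg hY.dual_nonneg hY.sq_le).trans (le_add_right ?_)
    gcongr
    exact hL.2.2.2

lemma starCyl_section (f : Amb N → ℝ) (y : OrbitBase) :
    (fun θ => starCyl f (y, θ)) = rearr (sphMeasure N) sphHeight fun θ => f (cyl (y, θ)) := rfl

lemma lintegral_abs_starCyl_sub_le (hN : 2 ≤ N) {f g : Amb N → ℝ} (hf : Measurable f)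
    (hg : Measurable g) (hf0 : ∀ z, 0 ≤ f z) (hg0 : ∀ z, 0 ≤ g z) :
    ∫⁻ w, ENNReal.ofReal |starCyl f w - starCyl g w| ∂((orbitMeasure N).prod (sphMeasure N)) ≤
      ∫⁻ z, ENNReal.ofReal |f z - g z| := by
  have hF : Measurable fun z => ENNReal.ofReal |f z - g z| :=
    ENNReal.measurable_ofReal.comp (measurable_norm.comp (hf.sub hg))
  have hS : Measurable fun w => ENNReal.ofReal |starCyl f w - starCyl g w| :=
    ENNReal.measurable_ofReal.comp (measurable_norm.comp
      ((measurable_starCyl hf).sub (measurable_starCyl hg)))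
  rw [← measurePreserving_cyl.lintegral_comp hF, lintegral_prod _ hS.aemeasurable,
    lintegral_prod (fun w => ENNReal.ofReal |f (cyl w) - g (cyl w)|)
      (hF.comp measurable_cyl).aemeasurable]
  refine lintegral_mono fun y => ?_
  have hy : Measurable fun θ : Sph N => (y, θ) := measurable_prodMk_left
  have hcy : Measurable fun θ : Sph N => cyl (y, θ) := measurable_cyl.comp hy
  have m1 : Measurable fun θ : Sph N => f (cyl (y, θ)) := hf.comp hcy
  have m2 : Measurable fun θ : Sph N => g (cyl (y, θ)) := hg.comp hcy
  have m3 : Measurable fun θ => starCyl f (y, θ) := (measurable_starCyl hf).comp hy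
  have m4 : Measurable fun θ => starCyl g (y, θ) := (measurable_starCyl hg).comp hy
  rw [starCyl_section] at m3 m4
  have key := lintegral_abs_rearr_sub_le measurable_sphHeight (sphMeasure_sphHeight_eq_zero hN)
    m1 m2 (fun θ => hf0 _) (fun θ => hg0 _) m3 m4
  simp only [← starCyl_section] at key
  exact key

/-- The energy bound for the rearrangement of a function which is an `L¹` limit of Lipschitz
functions of controlled energy. -/
lemma star_energy_of_approx (hN : 2 ≤ N) {f : Amb N → ℝ} (hf : Measurable f) (hf0 : ∀ z, 0 ≤ f z)
    {Y : Amb N → Amb N} {W q : Amb N → ℝ} (hY : IsWeightedField Y W q) {A : ℝ≥0∞}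
    (happ : ∀ ε : ℝ, 0 < ε → ∃ (v : Amb N → ℝ) (K : ℝ≥0) (M : ℝ), LipschitzWith K v ∧
      (∀ z, 0 ≤ v z) ∧ (∀ z, v z ≤ M) ∧ ∫⁻ z, ENNReal.ofReal |v z - f z| ≤ ENNReal.ofReal ε ∧
      ambEnergy W v ≤ A + ENNReal.ofReal ε) :
    ENNReal.ofReal (-(2 * ∫ w, starCyl f w * ambDiv Y (cyl w)
      ∂((orbitMeasure N).prod (sphMeasure N)))) ≤ A + ∫⁻ z, ENNReal.ofReal (q z) := by
  obtain ⟨hdm, R, C, hR, hC, hdC, hdR⟩ := hY.exists_bounds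
  refine ofReal_neg_two_le_of_forall hC fun ε hε => ?_
  obtain ⟨v, K, M, hv, hv0, hvM, hvf, hvE⟩ := happ ε hε
  have hM : 0 ≤ M := (hv0 0).trans (hvM 0)
  have hvm : Measurable v := hv.continuous.measurable
  have hclose := (lintegral_abs_starCyl_sub_le hN hvm hf hv0 hf0).trans hvf
  have hi : Integrable (fun w => starCyl v w * ambDiv Y (cyl w))
      ((orbitMeasure N).prod (sphMeasure N)) := by
    refine integrable_bounded_mul_box (M := M) hR (measurable_starCyl hvm)
        (hdm.comp measurable_cyl) (fun x => ?_) (fun x => hdC _) hdR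
    rw [abs_of_nonneg (starCyl_nonneg _ _)]
    exact rearr_le hM (fun θ => hvM _) _
  refine ⟨_, abs_integral_mul_sub_le (measurableSet_boxProd R) hC.le hε.le hi ?_ hdR
    (fun x => hdC _) ((setLIntegral_le_lintegral _ _).trans hclose), ?_⟩
  · refine integrable_mul_of_close (measurableSet_boxProd R)
      (measurable_starCyl hf).aestronglyMeasurable (hdm.comp measurable_cyl).aestronglyMeasurable
      hi (measurable_starCyl hvm).aestronglyMeasurable hdR (fun x => hdC _) ?_
    refine ne_top_of_le_ne_top ENNReal.ofReal_ne_top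
      ((setLIntegral_le_lintegral _ _).trans (le_trans (le_of_eq ?_) hclose))
    simp_rw [abs_sub_comm]
  · refine (star_energy_of_lipschitz hN hv hv0 hvM hY).trans ?_
    rw [add_right_comm]
    gcongr

end Limit

end FoliatedSchwarz

end
noncomputable section

namespace FoliatedSchwarz

open Filter Topology Metric
open scoped Pointwise NNReal RealInnerProductSpace Convolution ContDiff

/-! ### Mollification of weakly differentiable functions -/

section Mollify

variable {N : ℕ}

/-- `g` is the weak gradient of `f` on the open set `U` of the ambient space. -/
structure HasWeakGradientOn (U : Set (Amb N)) (f : Amb N → ℝ) (g : Amb N → Amb N) : Prop where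
  locInt : LocallyIntegrableOn f U
  locInt_grad : LocallyIntegrableOn g U
  byParts : ∀ φ : Amb N → ℝ, ContDiff ℝ ∞ φ → HasCompactSupport φ → tsupport φ ⊆ U → ∀ c : Amb N,
    ∫ z, f z * fderiv ℝ φ z c = -∫ z, φ z * ⟪g z, c⟫

/-- Jensen's inequality for the square, against a density of total mass one. -/
lemma sq_lintegral_mul_le {α : Type*} [MeasurableSpace α] {μ : Measure α} {ρ x : α → ℝ≥0∞}
    (hρ : Measurable ρ) (h1 : ∫⁻ t, ρ t ∂μ = 1) :
    (∫⁻ t, ρ t * x t ∂μ) ^ 2 ≤ ∫⁻ t, ρ t * x t ^ 2 ∂μ := by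
  have key : ∀ s : ℝ≥0∞, s ≠ ⊤ → 2 * s * (∫⁻ t, ρ t * x t ∂μ) ≤
      s ^ 2 + ∫⁻ t, ρ t * x t ^ 2 ∂μ := by
    intro s hs
    have h : ∀ t, 2 * s * (ρ t * x t) ≤ s ^ 2 * ρ t + ρ t * x t ^ 2 := fun t => by
      have : 2 * s * x t ≤ s ^ 2 + x t ^ 2 := by
        rcases eq_or_ne (x t) ⊤ with hx | hx
        · simp [hx]
        · lift s to ℝ≥0 using hs
          lift x t to ℝ≥0 using hx with y
          norm_cast
          exact two_mul_le_add_sq s y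
      calc 2 * s * (ρ t * x t) = ρ t * (2 * s * x t) := by ring
        _ ≤ ρ t * (s ^ 2 + x t ^ 2) := by gcongr
        _ = _ := by ring
    have hs2 : s ^ 2 ≠ ⊤ := ENNReal.pow_ne_top hs
    calc 2 * s * (∫⁻ t, ρ t * x t ∂μ) = ∫⁻ t, 2 * s * (ρ t * x t) ∂μ :=
          (lintegral_const_mul' _ _ (ENNReal.mul_ne_top (by simp) hs)).symm
      _ ≤ ∫⁻ t, (s ^ 2 * ρ t + ρ t * x t ^ 2) ∂μ := lintegral_mono h
      _ = s ^ 2 + ∫⁻ t, ρ t * x t ^ 2 ∂μ := by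
          rw [lintegral_add_left (hρ.const_mul _), lintegral_const_mul _ hρ, h1, mul_one]
  rcases eq_or_ne (∫⁻ t, ρ t * x t ∂μ) ⊤ with hL | hL
  · have := key 1 (by simp)
    rw [hL] at this
    have h2 : (∫⁻ t, ρ t * x t ^ 2 ∂μ) = ⊤ := by
      simpa [ENNReal.mul_top] using this
    rw [h2]; exact le_top
  · have := key _ hL
    set L := ∫⁻ t, ρ t * x t ∂μ
    have h2 : L ^ 2 ≠ ⊤ := ENNReal.pow_ne_top hL
    have h3 : L ^ 2 + L ^ 2 ≤ L ^ 2 + ∫⁻ t, ρ t * x t ^ 2 ∂μ := by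
      refine le_trans (le_of_eq ?_) this
      ring
    exact (ENNReal.add_le_add_iff_left h2).1 h3

variable (φ : ContDiffBump (0 : Amb N))

/-- The mollification of `f` by a normed bump function. -/
def mollify (f : Amb N → ℝ) : Amb N → ℝ :=
  φ.normed volume ⋆[ContinuousLinearMap.lsmul ℝ ℝ, volume] f

variable {φ}

lemma mollify_apply (f : Amb N → ℝ) (z : Amb N) :
    mollify φ f z = ∫ t, φ.normed volume (z - t) * f t := by
  rw [mollify, convolution_lsmul_swap]
  rfl

lemma lintegral_normed_sub (z : Amb N) :
    ∫⁻ t, ENNReal.ofReal (φ.normed volume (z - t)) = 1 := by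
  rw [lintegral_sub_left_eq_self (fun t => ENNReal.ofReal (φ.normed volume t)) z,
    ← ofReal_integral_eq_lintegral_ofReal φ.integrable_normed
      (Eventually.of_forall fun t => φ.nonneg_normed t), φ.integral_normed]
  simp

lemma lintegral_normed_sub' (t : Amb N) :
    ∫⁻ z, ENNReal.ofReal (φ.normed volume (z - t)) = 1 := by
  rw [lintegral_sub_right_eq_self (fun t => ENNReal.ofReal (φ.normed volume t)) t,
    ← ofReal_integral_eq_lintegral_ofReal φ.integrable_normed
      (Eventually.of_forall fun t => φ.nonneg_normed t), φ.integral_normed]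
  simp

lemma contDiff_mollify {f : Amb N → ℝ} (hf : Integrable f) : ContDiff ℝ 1 (mollify φ f) :=
  φ.hasCompactSupport_normed.contDiff_convolution_left _ φ.contDiff_normed hf.locallyIntegrable

lemma hasCompactSupport_mollify {f : Amb N → ℝ} (hf : HasCompactSupport f) :
    HasCompactSupport (mollify φ f) :=
  HasCompactSupport.convolution _ φ.hasCompactSupport_normed hf

lemma mollify_nonneg {f : Amb N → ℝ} (hf : ∀ z, 0 ≤ f z) (z : Amb N) : 0 ≤ mollify φ f z := by
  rw [mollify_apply]
  exact integral_nonneg fun t => mul_nonneg (φ.nonneg_normed _) (hf t)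

lemma fderiv_mollify_apply {f : Amb N → ℝ} (hf : Integrable f) (z c : Amb N) :
    fderiv ℝ (mollify φ f) z c = ∫ t, fderiv ℝ (φ.normed volume) (z - t) c * f t := by
  have h := (φ.hasCompactSupport_normed (μ := volume)).hasFDerivAt_convolution_left
    (ContinuousLinearMap.lsmul ℝ ℝ) φ.contDiff_normed hf.locallyIntegrable z
  rw [mollify, h.fderiv, ← convolution_flip]
  have h3 : Continuous (fderiv ℝ (φ.normed (volume : Measure (Amb N)))) :=
    (φ.contDiff_normed (n := 1)).continuous_fderiv one_ne_zero
  have h4 := convolution_precompR_apply (L := (ContinuousLinearMap.lsmul ℝ ℝ).flip)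
    (x₀ := z) (hf.locallyIntegrable)
    ((φ.hasCompactSupport_normed (μ := volume)).fderiv (𝕜 := ℝ)) h3 c
  refine Eq.trans h4 ?_
  rw [convolution_def]
  rfl

/-- Close to points where `f` has a weak gradient, the gradient of the mollification is the
mollification of the weak gradient. -/
lemma fderiv_mollify_eq {U K : Set (Amb N)} {f : Amb N → ℝ} {g : Amb N → Amb N}
    (h : HasWeakGradientOn U f g) (hf : Integrable (K.indicator f)) (hKU : K ⊆ U) {z : Amb N}
    (hz : closedBall z φ.rOut ⊆ K) (c : Amb N) :
    fderiv ℝ (mollify φ (K.indicator f)) z c = ∫ t, φ.normed volume (z - t) * ⟪g t, c⟫ := by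
  set ψ : Amb N → ℝ := fun t => φ.normed volume (z - t) with hψ
  have hψs : ContDiff ℝ ∞ ψ := φ.contDiff_normed.comp (contDiff_const.sub contDiff_id)
  have hψt : tsupport ψ ⊆ closedBall z φ.rOut := by
    refine closure_minimal (fun t ht => ?_) isClosed_closedBall
    have : z - t ∈ Function.support (φ.normed (volume : Measure (Amb N))) := ht
    rw [φ.support_normed_eq] at this
    rw [mem_closedBall, dist_comm, dist_eq_norm]
    simpa using (mem_ball.1 this).le
  have hψc : HasCompactSupport ψ :=
    HasCompactSupport.of_support_subset_isCompact (isCompact_closedBall z φ.rOut)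
      ((subset_tsupport _).trans hψt)
  have hb := h.byParts ψ hψs hψc ((hψt.trans hz).trans hKU) c
  have hd : ∀ t, fderiv ℝ ψ t c = -fderiv ℝ (φ.normed volume) (z - t) c := fun t => by
    have h1 : HasFDerivAt (fun t : Amb N => z - t) (-ContinuousLinearMap.id ℝ (Amb N)) t := by
      simpa using (hasFDerivAt_id (𝕜 := ℝ) t).const_sub z
    have h2 : HasFDerivAt (φ.normed volume) (fderiv ℝ (φ.normed volume) (z - t)) (z - t) :=
      ((φ.contDiff_normed (n := 1)).differentiable one_ne_zero _).hasFDerivAt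
    have h3 : HasFDerivAt ψ _ t := h2.comp t h1
    rw [h3.fderiv]
    simp
  rw [fderiv_mollify_apply hf, ← neg_eq_iff_eq_neg.2 hb, ← integral_neg]
  refine integral_congr_ae (Eventually.of_forall fun t => ?_)
  show fderiv ℝ (φ.normed volume) (z - t) c * K.indicator f t = -(f t * fderiv ℝ ψ t c)
  by_cases ht : t ∈ K
  · rw [indicator_of_mem ht, hd]; ring
  · have : t ∉ tsupport ψ := fun h' => ht (hz (hψt h'))
    have h0 : fderiv ℝ ψ t = 0 := image_eq_zero_of_notMem_tsupport
      (fun h' => this (tsupport_fderiv_subset ℝ h'))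
    rw [indicator_of_notMem ht, h0]
    simp

lemma enorm_fderiv_mollify_sq_le {U K : Set (Amb N)} {f : Amb N → ℝ} {g : Amb N → Amb N}
    (h : HasWeakGradientOn U f g) (hf : Integrable (K.indicator f)) (hKU : K ⊆ U) {z : Amb N}
    (hz : closedBall z φ.rOut ⊆ K) :
    ‖fderiv ℝ (mollify φ (K.indicator f)) z‖ₑ ^ 2 ≤
      ∫⁻ t, ENNReal.ofReal (φ.normed volume (z - t)) * ‖g t‖ₑ ^ 2 := by
  have hm : Measurable fun t => ENNReal.ofReal (φ.normed volume (z - t)) :=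
    ENNReal.measurable_ofReal.comp
      ((φ.continuous_normed.comp (continuous_const.sub continuous_id)).measurable)
  refine le_trans ?_ (sq_lintegral_mul_le hm (lintegral_normed_sub z))
  gcongr
  set L := ∫⁻ t, ENNReal.ofReal (φ.normed volume (z - t)) * ‖g t‖ₑ with hL
  rcases eq_or_ne L ⊤ with hT | hT
  · rw [hT]; exact le_top
  rw [← ENNReal.ofReal_toReal hT, ← ofReal_norm]
  refine ENNReal.ofReal_le_ofReal (ContinuousLinearMap.opNorm_le_bound _ ENNReal.toReal_nonneg
    fun c => ?_)
  rw [← ENNReal.ofReal_le_ofReal_iff (by positivity), ofReal_norm,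
    ENNReal.ofReal_mul ENNReal.toReal_nonneg, ENNReal.ofReal_toReal hT,
    fderiv_mollify_eq h hf hKU hz]
  refine (enorm_integral_le_lintegral_enorm _).trans ?_
  rw [hL, ← lintegral_mul_const' _ _ ENNReal.ofReal_ne_top]
  refine lintegral_mono fun t => ?_
  rw [enorm_mul, mul_assoc]
  refine mul_le_mul' (le_of_eq ?_) ?_
  · rw [← ofReal_norm, Real.norm_of_nonneg (φ.nonneg_normed _)]
  · rw [← ofReal_norm, ← ofReal_norm, ← ENNReal.ofReal_mul (norm_nonneg _)]
    exact ENNReal.ofReal_le_ofReal (norm_inner_le_norm _ _)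

/-- Mollification increases the weighted energy by little if the weight varies little. -/
lemma ambEnergy_mollify_le {U K : Set (Amb N)} {f : Amb N → ℝ} {g : Amb N → Amb N}
    (h : HasWeakGradientOn U f g) (hf : Integrable (K.indicator f)) (hKU : K ⊆ U)
    (hKm : MeasurableSet K) (hg : AEMeasurable g (volume.restrict K))
    {W : Amb N → ℝ} (hW0 : ∀ z, 0 ≤ W z) (hWm : Measurable W)
    (hWK : ∀ z, W z ≠ 0 → closedBall z φ.rOut ⊆ K) {η : ℝ} (hη : 0 ≤ η)
    (hWη : ∀ z t, dist z t ≤ φ.rOut → W z ≤ W t + η) :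
    ambEnergy W (mollify φ (K.indicator f)) ≤
      (∫⁻ t, ENNReal.ofReal (W t * ‖g t‖ ^ 2)) +
        ENNReal.ofReal η * ∫⁻ t in K, ‖g t‖ₑ ^ 2 := by
  have hρ : Continuous fun p : Amb N × Amb N => φ.normed volume (p.1 - p.2) :=
    φ.continuous_normed.comp (continuous_fst.sub continuous_snd)
  have hsupp : ∀ z t, W z * φ.normed volume (z - t) ≠ 0 → t ∈ K ∧ dist z t ≤ φ.rOut := by
    intro z t hne
    have h2 : z - t ∈ Function.support (φ.normed (volume : Measure (Amb N))) :=
      right_ne_zero_of_mul hne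
    rw [φ.support_normed_eq, mem_ball_zero_iff, ← dist_eq_norm] at h2
    exact ⟨hWK z (left_ne_zero_of_mul hne) (by rw [mem_closedBall, dist_comm]; exact h2.le), h2.le⟩
  have hgm : AEMeasurable (fun t => ‖g t‖ₑ ^ 2) (volume.restrict K) :=
    hg.enorm.pow_const 2
  calc ambEnergy W (mollify φ (K.indicator f))
      ≤ ∫⁻ z, ∫⁻ t in K, ENNReal.ofReal (W z * φ.normed volume (z - t)) * ‖g t‖ₑ ^ 2 := by
        refine lintegral_mono fun z => ?_
        by_cases hz : W z = 0
        · simp [hz]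
        have h1 := enorm_fderiv_mollify_sq_le h hf hKU (hWK z hz)
        show ENNReal.ofReal (W z * ‖fderiv ℝ (mollify φ (K.indicator f)) z‖ ^ 2) ≤ _
        rw [ENNReal.ofReal_mul (hW0 z), ENNReal.ofReal_pow (norm_nonneg _), ofReal_norm]
        refine (mul_le_mul_right h1 _).trans ?_
        rw [← lintegral_const_mul' _ _ ENNReal.ofReal_ne_top, ← lintegral_indicator hKm]
        refine lintegral_mono fun t => ?_
        rw [← mul_assoc, ← ENNReal.ofReal_mul (hW0 z)]
        by_cases ht : t ∈ K
        · rw [indicator_of_mem ht]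
        · rw [indicator_of_notMem ht, not_not.1 (mt (hsupp z t) (fun h' => ht h'.1))]
          simp
    _ = ∫⁻ t in K, ∫⁻ z, ENNReal.ofReal (W z * φ.normed volume (z - t)) * ‖g t‖ₑ ^ 2 := by
        refine lintegral_lintegral_swap ?_
        refine AEMeasurable.mul ?_ (hgm.comp_snd)
        exact (ENNReal.measurable_ofReal.comp
          ((hWm.comp measurable_fst).mul hρ.measurable)).aemeasurable
    _ ≤ ∫⁻ t in K, (ENNReal.ofReal (W t * ‖g t‖ ^ 2) + ENNReal.ofReal η * ‖g t‖ₑ ^ 2) := by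
        refine lintegral_mono fun t => ?_
        have hb : ‖g t‖ₑ ^ 2 ≠ ⊤ := by simp
        rw [lintegral_mul_const' _ _ hb, ENNReal.ofReal_mul (hW0 t),
          ENNReal.ofReal_pow (norm_nonneg _), ofReal_norm, ← add_mul,
          ← ENNReal.ofReal_add (hW0 t) hη]
        gcongr
        calc ∫⁻ z, ENNReal.ofReal (W z * φ.normed volume (z - t))
            ≤ ∫⁻ z, ENNReal.ofReal (W t + η) * ENNReal.ofReal (φ.normed volume (z - t)) := by
              refine lintegral_mono fun z => ?_
              rw [← ENNReal.ofReal_mul (add_nonneg (hW0 t) hη)]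
              refine ENNReal.ofReal_le_ofReal ?_
              by_cases hne : W z * φ.normed volume (z - t) = 0
              · rw [hne]
                exact mul_nonneg (add_nonneg (hW0 t) hη) (φ.nonneg_normed _)
              · exact mul_le_mul_of_nonneg_right (hWη z t (hsupp z t hne).2) (φ.nonneg_normed _)
          _ = ENNReal.ofReal (W t + η) := by
              rw [lintegral_const_mul' _ _ ENNReal.ofReal_ne_top, lintegral_normed_sub', mul_one]
    _ ≤ _ := by
        rw [lintegral_add_right' _ (hgm.const_mul _), lintegral_const_mul'' _ hgm]
        exact add_le_add (setLIntegral_le_lintegral _ _) le_rfl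

/-- Mollifications of a nonnegative integrable function converge in `L¹`: they converge almost
everywhere and preserve the integral. -/
lemma tendsto_lintegral_mollify_sub {φ : ℕ → ContDiffBump (0 : Amb N)}
    (hφ : Tendsto (fun n => (φ n).rOut) atTop (𝓝 0)) (hφ' : ∀ n, (φ n).rOut ≤ 2 * (φ n).rIn)
    {f : Amb N → ℝ} (hf : Integrable f) (hf0 : ∀ z, 0 ≤ f z) :
    Tendsto (fun n => ∫⁻ z, ENNReal.ofReal |mollify (φ n) f z - f z|) atTop (𝓝 0) := by
  have hae : ∀ᵐ z, Tendsto (fun n => mollify (φ n) f z) atTop (𝓝 (f z)) :=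
    ContDiffBump.ae_convolution_tendsto_right_of_locallyIntegrable hφ
      (Eventually.of_forall hφ') hf.locallyIntegrable
  have hvi : ∀ n, Integrable (mollify (φ n) f) := fun n =>
    (φ n).integrable_normed.integrable_convolution _ hf
  have hvI : ∀ n, ∫ z, mollify (φ n) f z = ∫ z, f z := fun n => by
    rw [mollify, integral_convolution _ (φ n).integrable_normed hf, (φ n).integral_normed]
    simp
  -- the positive part of `f - mollify f` is dominated by `f`; the integrals of `f` and of its
  -- mollification agree, so the `L¹` distance is twice the integral of the positive part
  have hpos : Tendsto (fun n => ∫ z, max (f z - mollify (φ n) f z) 0) atTop (𝓝 0) := by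
    refine (integral_zero (Amb N) ℝ (μ := volume)) ▸
      tendsto_integral_of_dominated_convergence (F := fun n z =>
      max (f z - mollify (φ n) f z) 0) f (fun n => ?_) hf (fun n => ?_) ?_
    · exact ((hf.sub (hvi n)).sup (integrable_zero _ _ _)).aestronglyMeasurable
    · refine Eventually.of_forall fun z => ?_
      rw [Real.norm_of_nonneg (le_max_right _ _)]
      exact max_le (sub_le_self _ (mollify_nonneg hf0 z)) (hf0 z)
    · filter_upwards [hae] with z hz
      have := ((tendsto_const_nhds (x := f z)).sub hz).max (tendsto_const_nhds (x := (0 : ℝ)))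
      simpa using this
  have hE : ∀ n, ∫⁻ z, ENNReal.ofReal |mollify (φ n) f z - f z| =
      ENNReal.ofReal (2 * ∫ z, max (f z - mollify (φ n) f z) 0) := fun n => by
    have hd : Integrable fun z => mollify (φ n) f z - f z := (hvi n).sub hf
    rw [← ofReal_integral_eq_lintegral_ofReal hd.abs (Eventually.of_forall fun z => abs_nonneg _)]
    have hp : Integrable fun z => max (f z - mollify (φ n) f z) 0 :=
      (hf.sub (hvi n)).sup (integrable_zero _ _ _)
    congr 1
    calc ∫ z, |mollify (φ n) f z - f z|
        = ∫ z, ((mollify (φ n) f z - f z) + 2 * max (f z - mollify (φ n) f z) 0) := by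
          refine integral_congr_ae (Eventually.of_forall fun z => ?_)
          show |mollify (φ n) f z - f z| =
            mollify (φ n) f z - f z + 2 * max (f z - mollify (φ n) f z) 0
          rcases le_total (mollify (φ n) f z) (f z) with h | h
          · rw [abs_of_nonpos (by linarith), max_eq_left (by linarith)]; ring
          · rw [abs_of_nonneg (by linarith), max_eq_right (by linarith)]; ring
      _ = _ := by
          rw [integral_add hd (hp.const_mul 2), integral_sub (hvi n) hf, hvI, sub_self, zero_add,
            integral_const_mul]
  simp_rw [hE]
  have := ENNReal.tendsto_ofReal (hpos.const_mul 2)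
  simpa using this

/-- A function with square integrable weak gradient, cut off to a compact set, is approximated in
`L¹` by Lipschitz functions with controlled weighted energy, for weights supported well inside
that set. -/
lemma exists_lipschitz_approx {U K : Set (Amb N)} {f : Amb N → ℝ} {g : Amb N → Amb N}
    (h : HasWeakGradientOn U f g) (hKc : IsCompact K) (hKU : K ⊆ U) (hf0 : ∀ z, 0 ≤ f z)
    (hg : ∫⁻ t in K, ‖g t‖ₑ ^ 2 ≠ ⊤)
    {W : Amb N → ℝ} (hW0 : ∀ z, 0 ≤ W z) (hWc : Continuous W) (hWs : HasCompactSupport W)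
    {δ : ℝ} (hδ : 0 < δ) (hWK : ∀ z, W z ≠ 0 → closedBall z δ ⊆ K) {ε : ℝ} (hε : 0 < ε) :
    ∃ (v : Amb N → ℝ) (C : ℝ≥0) (M : ℝ), LipschitzWith C v ∧
      (∀ z, 0 ≤ v z) ∧ (∀ z, v z ≤ M) ∧
      ∫⁻ z, ENNReal.ofReal |v z - K.indicator f z| ≤ ENNReal.ofReal ε ∧
      ambEnergy W v ≤ (∫⁻ t, ENNReal.ofReal (W t * ‖g t‖ ^ 2)) + ENNReal.ofReal ε := by
  have hfi : Integrable (K.indicator f) :=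
    (integrable_indicator_iff hKc.measurableSet).2 (h.locInt.integrableOn_compact_subset hKU hKc)
  have hf0' : ∀ z, 0 ≤ K.indicator f z := fun z => indicator_nonneg (fun z _ => hf0 z) z
  have hgm : AEMeasurable g (volume.restrict K) :=
    (h.locInt_grad.integrableOn_compact_subset hKU hKc).aestronglyMeasurable.aemeasurable
  set Q := ∫⁻ t in K, ‖g t‖ₑ ^ 2
  obtain ⟨η, hη, hηQ⟩ : ∃ η : ℝ, 0 < η ∧ ENNReal.ofReal η * Q ≤ ENNReal.ofReal ε := by
    refine ⟨ε / (Q.toReal + 1), by positivity, ?_⟩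
    calc ENNReal.ofReal (ε / (Q.toReal + 1)) * Q
        = ENNReal.ofReal (ε / (Q.toReal + 1) * Q.toReal) := by
          rw [ENNReal.ofReal_mul (by positivity), ENNReal.ofReal_toReal hg]
      _ ≤ ENNReal.ofReal ε := ENNReal.ofReal_le_ofReal ?_
    rw [div_mul_eq_mul_div, div_le_iff₀ (by positivity)]
    exact mul_le_mul_of_nonneg_left (by simp) hε.le
  obtain ⟨δ', hδ', hWu⟩ := Metric.uniformContinuous_iff.1
    (hWs.uniformContinuous_of_continuous hWc) η hη
  let φ : ℕ → ContDiffBump (0 : Amb N) := fun n =>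
    ⟨1 / ((n : ℝ) + 1), 2 * (1 / ((n : ℝ) + 1)), by positivity,
      by have : 0 < 1 / ((n : ℝ) + 1) := by positivity
         linarith⟩
  have hφ : Tendsto (fun n => (φ n).rOut) atTop (𝓝 0) := by
    simpa only [mul_zero] using (tendsto_one_div_add_atTop_nhds_zero_nat (𝕜 := ℝ)).const_mul 2
  have hL := tendsto_lintegral_mollify_sub hφ (fun n => le_rfl) hfi hf0'
  obtain ⟨n, hn1, hn2, hn3⟩ := ((hL.eventually (gt_mem_nhds (ENNReal.ofReal_pos.2 hε))).and
    ((hφ.eventually (gt_mem_nhds hδ')).and (hφ.eventually (gt_mem_nhds hδ)))).exists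
  have hvd := contDiff_mollify (φ := φ n) hfi
  have hvc : HasCompactSupport (mollify (φ n) (K.indicator f)) :=
    hasCompactSupport_mollify (HasCompactSupport.intro hKc fun z hz => indicator_of_notMem hz f)
  obtain ⟨C, hC⟩ := hvd.lipschitzWith_of_hasCompactSupport hvc one_ne_zero
  obtain ⟨M, hM⟩ := hvd.continuous.bounded_above_of_compact_support hvc
  refine ⟨mollify (φ n) (K.indicator f), C, M, hC, mollify_nonneg hf0',
    fun z => (le_abs_self _).trans (hM z), hn1.le, ?_⟩
  refine (ambEnergy_mollify_le h hfi hKU hKc.measurableSet hgm hW0 hWc.measurable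
    (fun z hz => (closedBall_subset_closedBall hn3.le).trans (hWK z hz)) hη.le
    (fun z t hzt => ?_)).trans (add_le_add le_rfl hηQ)
  have := hWu (hzt.trans_lt hn2)
  rw [Real.dist_eq] at this
  linarith [(abs_lt.1 this).2]

end Mollify

end FoliatedSchwarz

end
noncomputable section

namespace FoliatedSchwarz

open Filter Topology Metric
open scoped Pointwise NNReal RealInnerProductSpace

/-! ### Polar coordinates on the upper half-space -/

section Radial

variable {N : ℕ}

/-- The open upper half-space, the cone over the open hemisphere. -/
def upperSpace (N : ℕ) : Set (Amb N) := {z | 0 < height z}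

/-- The radial projection to the unit sphere. -/
def direction (z : Amb N) : Amb N := ‖z‖⁻¹ • z

/-- Polar coordinates `(ω, r) ↦ r ω`, with `ω` in the ambient space rather than in a subtype. -/
def radial (q : Amb N × Ioi (0 : ℝ)) : Amb N := q.2.1 • q.1

@[fun_prop] lemma continuous_height : Continuous (height (N := N)) := by
  unfold height; fun_prop

@[simp] lemma height_smul (c : ℝ) (z : Amb N) : height (c • z) = c * height z := by
  simp [height]

lemma isOpen_upperSpace : IsOpen (upperSpace N) := isOpen_lt continuous_const continuous_height

lemma abs_height_le (z : Amb N) : |height z| ≤ ‖z‖ := by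
  simpa [height] using PiLp.norm_apply_le z (Fin.last N)

lemma ne_zero_of_mem_upperSpace {z : Amb N} (hz : z ∈ upperSpace N) : z ≠ 0 := by
  rintro rfl
  simp [upperSpace, height] at hz

lemma hemisphere_eq : hemisphere N = sphere 0 1 ∩ upperSpace N := by
  ext z
  simp [hemisphere, upperSpace]

lemma measurableSet_hemisphere : MeasurableSet (hemisphere N) := by
  rw [hemisphere_eq]
  exact isClosed_sphere.measurableSet.inter isOpen_upperSpace.measurableSet

lemma isLocallyClosed_hemisphere : IsLocallyClosed (hemisphere N) := by
  rw [hemisphere_eq]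
  exact isClosed_sphere.isLocallyClosed.inter isOpen_upperSpace.isLocallyClosed

lemma direction_mem_hemisphere {z : Amb N} (hz : z ∈ upperSpace N) :
    direction z ∈ hemisphere N := by
  have h0 : 0 < ‖z‖ := norm_pos_iff.2 (ne_zero_of_mem_upperSpace hz)
  refine ⟨?_, ?_⟩
  · rw [direction, norm_smul, norm_inv, norm_norm, inv_mul_cancel₀ h0.ne']
  · rw [direction, height_smul]
    exact mul_pos (inv_pos.2 h0) hz

lemma norm_radial {q : Amb N × Ioi (0 : ℝ)} (hq : ‖q.1‖ = 1) : ‖radial q‖ = q.2 := by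
  rw [radial, norm_smul, hq, mul_one, Real.norm_of_nonneg (le_of_lt q.2.2)]

lemma direction_radial {q : Amb N × Ioi (0 : ℝ)} (hq : ‖q.1‖ = 1) : direction (radial q) = q.1 := by
  rw [direction, norm_radial hq, radial, smul_smul, inv_mul_cancel₀ (ne_of_gt q.2.2), one_smul]

lemma measurable_direction : Measurable (direction (N := N)) :=
  (measurable_norm.inv).smul measurable_id

lemma continuousOn_direction : ContinuousOn (direction (N := N)) {0}ᶜ := by
  intro z hz
  have : ‖z‖ ≠ 0 := norm_ne_zero_iff.2 hz
  exact ((continuous_norm.continuousAt.inv₀ this).smul continuousAt_id).continuousWithinAt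

lemma continuous_radial : Continuous (radial (N := N)) := by
  unfold radial; fun_prop

instance : IsFiniteMeasure (sphereMeasure N) := by
  unfold sphereMeasure; infer_instance

instance : IsFiniteMeasure (surface N) := by
  unfold surface; infer_instance

lemma ae_norm_eq_one : ∀ᵐ ω ∂(sphereMeasure N), ‖ω‖ = 1 := by
  rw [sphereMeasure, ae_map_iff measurable_subtype_coe.aemeasurable
    (measurableSet_eq_fun measurable_norm measurable_const)]
  exact Eventually.of_forall fun ω => by simp

lemma ae_mem_hemisphere : ∀ᵐ ω ∂(surface N), ω ∈ hemisphere N :=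
  ae_restrict_mem measurableSet_hemisphere

/-- Integration in polar coordinates; the radial measure is `r^N dr`. -/
lemma measurePreserving_radial : MeasurePreserving (radial (N := N))
    ((surface N).prod (Measure.volumeIoiPow N)) (volume.restrict (upperSpace N)) := by
  have hpolar := measurePreserving_polar (Amb N) volume
  rw [finrank_euclideanSpace, Fintype.card_fin, Nat.add_sub_cancel] at hpolar
  have h1 : MeasurePreserving (Prod.map Subtype.val id : sphere (0 : Amb N) 1 × Ioi (0 : ℝ) → _)
      (volume.toSphere.prod (Measure.volumeIoiPow N))
      ((sphereMeasure N).prod (Measure.volumeIoiPow N)) :=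
    (MeasurePreserving.mk measurable_subtype_coe rfl).prod (MeasurePreserving.id _)
  have h2 : MeasurePreserving (radial (N := N))
      ((sphereMeasure N).prod (Measure.volumeIoiPow N)) volume := by
    refine ⟨continuous_radial.measurable, ?_⟩
    rw [← h1.map_eq, Measure.map_map continuous_radial.measurable h1.measurable]
    exact hpolar.map_eq
  have h3 := h2.restrict_preimage (s := upperSpace N) isOpen_upperSpace.measurableSet
  have h4 : ((sphereMeasure N).prod (Measure.volumeIoiPow N)).restrict
      (radial ⁻¹' upperSpace N) = (surface N).prod (Measure.volumeIoiPow N) := by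
    have h5 : radial ⁻¹' upperSpace N = upperSpace N ×ˢ (univ : Set (Ioi (0 : ℝ))) := by
      ext q
      simp only [mem_preimage, upperSpace, mem_ofPred_eq, radial, height_smul, mem_prod, mem_univ,
        and_true]
      exact mul_pos_iff_of_pos_left q.2.2
    have h6 : hemisphere N =ᵐ[sphereMeasure N] upperSpace N := by
      rw [hemisphere_eq]
      filter_upwards [ae_norm_eq_one] with ω hω
      apply propext
      show (ω ∈ sphere 0 1 ∧ ω ∈ upperSpace N) ↔ ω ∈ upperSpace N
      simp [hω]
    rw [h5, ← Measure.prod_restrict, Measure.restrict_univ, surface,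
      Measure.restrict_congr_set h6]
  rwa [h4] at h3

lemma ae_radial_mem : ∀ᵐ q ∂((surface N).prod (Measure.volumeIoiPow N)), q.1 ∈ hemisphere N :=
  Measure.quasiMeasurePreserving_fst.ae ae_mem_hemisphere

lemma quasiMeasurePreserving_direction : Measure.QuasiMeasurePreserving (direction (N := N))
    (volume.restrict (upperSpace N)) (surface N) := by
  refine ⟨measurable_direction, ?_⟩
  rw [← measurePreserving_radial.map_eq, Measure.map_map measurable_direction
    continuous_radial.measurable]
  have : (direction ∘ radial : Amb N × Ioi (0 : ℝ) → Amb N)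
      =ᵐ[(surface N).prod (Measure.volumeIoiPow N)] Prod.fst := by
    filter_upwards [ae_radial_mem] with q hq
    exact direction_radial hq.1
  rw [Measure.map_congr this]
  exact Measure.quasiMeasurePreserving_fst.absolutelyContinuous

lemma volumeIoiPow_ne_zero (n : ℕ) : Measure.volumeIoiPow n ≠ 0 := by
  intro h
  have h1 := Measure.volumeIoiPow_apply_Iio n ⟨1, mem_Ioi.2 one_pos⟩
  rw [h] at h1
  have h2 : (0 : ℝ) < 1 ^ (n + 1) / (n + 1) := by positivity
  simp only [Measure.coe_zero, Pi.zero_apply] at h1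
  exact (ENNReal.ofReal_pos.2 h2).ne h1

/-- A property of almost every direction and radius holds, for some radius, in almost every
direction. -/
lemma exists_radius_of_ae {p : Amb N × Ioi (0 : ℝ) → Prop}
    (h : ∀ᵐ q ∂((surface N).prod (Measure.volumeIoiPow N)), p q) :
    ∃ r : Ioi (0 : ℝ), ∀ᵐ ω ∂(surface N), p (ω, r) := by
  have h1 : ∀ᵐ q ∂((Measure.volumeIoiPow N).prod (surface N)), p q.swap :=
    (Measure.measurePreserving_swap (μ := Measure.volumeIoiPow N)
      (ν := surface N)).quasiMeasurePreserving.ae h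
  have := (ae_neBot.2 (volumeIoiPow_ne_zero N))
  exact (Measure.ae_ae_of_ae_prod h1).exists

lemma integral_volumeIoiPow (n : ℕ) (F : ℝ → ℝ) :
    ∫ r, F r.1 ∂(Measure.volumeIoiPow n) = ∫ r in Ioi (0 : ℝ), r ^ n * F r := by
  have hm : Measurable fun r : Ioi (0 : ℝ) => (r.1 ^ n).toNNReal := by fun_prop
  have h1 := integral_withDensity_eq_integral_smul (μ := Measure.comap Subtype.val volume) hm
    (fun r : Ioi (0 : ℝ) => F r.1)
  rw [← integral_subtype_comap measurableSet_Ioi (fun r : ℝ => r ^ n * F r)]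
  refine Eq.trans h1 (integral_congr_ae (Eventually.of_forall fun r => ?_))
  have hr : (0 : ℝ) ≤ r.1 ^ n := pow_nonneg (le_of_lt r.2) n
  show (r.1 ^ n).toNNReal • F r.1 = r.1 ^ n * F r.1
  rw [NNReal.smul_def, Real.coe_toNNReal _ hr, smul_eq_mul]

lemma isCompact_direction_image {K : Set (Amb N)} (hK : IsCompact K) (hKU : K ⊆ upperSpace N) :
    IsCompact (direction '' K) :=
  hK.image_of_continuousOn (continuousOn_direction.mono fun _ hz =>
    ne_zero_of_mem_upperSpace (hKU hz))

lemma direction_image_subset {K : Set (Amb N)} (hKU : K ⊆ upperSpace N) :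
    direction '' K ⊆ hemisphere N := by
  rintro _ ⟨z, hz, rfl⟩
  exact direction_mem_hemisphere (hKU hz)

/-- Products of a locally integrable function of the direction and a bounded function supported
over a compact set are integrable in polar coordinates. -/
lemma integrable_radial_smul {F : Type*} [NormedAddCommGroup F] [NormedSpace ℝ F] {h : Amb N → F}
    (hh : LocallyIntegrableOn h (hemisphere N) (sphereMeasure N)) {K : Set (Amb N)}
    (hK : IsCompact K) (hKU : K ⊆ upperSpace N) {b : Amb N × Ioi (0 : ℝ) → ℝ}
    (hb : AEStronglyMeasurable b ((surface N).prod (Measure.volumeIoiPow N))) {C : ℝ}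
    (hC : ∀ q, q.1 ∈ hemisphere N → radial q ∈ K → |b q| ≤ C) (hbK : ∀ q, radial q ∉ K → b q = 0) :
    Integrable (fun q => b q • h q.1) ((surface N).prod (Measure.volumeIoiPow N)) := by
  set K₁ := direction '' K
  have hK₁ : IsCompact K₁ := isCompact_direction_image hK hKU
  have hK₁S : K₁ ⊆ hemisphere N := direction_image_subset hKU
  have hi : Integrable (K₁.indicator h) (surface N) := by
    rw [integrable_indicator_iff hK₁.measurableSet, surface, IntegrableOn,
      Measure.restrict_restrict hK₁.measurableSet, inter_eq_left.2 hK₁S]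
    exact hh.integrableOn_compact_subset hK₁S hK₁
  obtain ⟨R, hR⟩ := hK.isBounded.exists_norm_le
  set R' : Ioi (0 : ℝ) := ⟨|R| + 1, mem_Ioi.2 (by positivity)⟩
  have hj : Integrable ((Iio R').indicator fun _ => |C|) (Measure.volumeIoiPow N) := by
    rw [integrable_indicator_iff measurableSet_Iio]
    refine integrableOn_const ?_
    rw [Measure.volumeIoiPow_apply_Iio]
    exact ENNReal.ofReal_ne_top
  have hm : AEStronglyMeasurable h (surface N) := hh.aestronglyMeasurable
  refine Integrable.mono' (hi.norm.mul_prod hj)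
    (hb.smul (hm.comp_quasiMeasurePreserving Measure.quasiMeasurePreserving_fst)) ?_
  filter_upwards [ae_radial_mem] with q hq
  by_cases hqK : radial q ∈ K
  · have h1 : q.1 ∈ K₁ := ⟨_, hqK, direction_radial hq.1⟩
    have h2 : q.2 ∈ Iio R' := by
      have := hR _ hqK
      rw [norm_radial hq.1] at this
      exact Subtype.coe_lt_coe.1 (this.trans_lt ((le_abs_self R).trans_lt (lt_add_one _)))
    rw [indicator_of_mem h1, indicator_of_mem h2, norm_smul, mul_comm]
    exact mul_le_mul_of_nonneg_left ((hC q hq hqK).trans (le_abs_self C)) (norm_nonneg _)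
  · rw [hbK q hqK, zero_smul, norm_zero]
    exact mul_nonneg (norm_nonneg _) (indicator_nonneg (fun _ _ => abs_nonneg C) _)

lemma integrable_radial_smul_of_continuous {F : Type*} [NormedAddCommGroup F] [NormedSpace ℝ F]
    {h : Amb N → F} (hh : LocallyIntegrableOn h (hemisphere N) (sphereMeasure N)) {K : Set (Amb N)}
    (hK : IsCompact K) (hKU : K ⊆ upperSpace N) {b : Amb N × Ioi (0 : ℝ) → ℝ} (hb : Continuous b)
    (hbK : ∀ q, radial q ∉ K → b q = 0) :
    Integrable (fun q => b q • h q.1) ((surface N).prod (Measure.volumeIoiPow N)) := by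
  obtain ⟨R, hR⟩ := hK.isBounded.exists_norm_le
  have hK₁ : IsCompact (direction '' K) := isCompact_direction_image hK hKU
  -- the radii occurring in `K` are bounded away from zero
  obtain ⟨δ, hδ, hδK⟩ : ∃ δ > 0, ∀ z ∈ K, δ ≤ ‖z‖ := by
    rcases K.eq_empty_or_nonempty with hE | hE
    · exact ⟨1, one_pos, by simp [hE]⟩
    · obtain ⟨z, hz, hzm⟩ := hK.exists_isMinOn hE continuous_norm.continuousOn
      exact ⟨‖z‖, norm_pos_iff.2 (ne_zero_of_mem_upperSpace (hKU hz)), fun w hw => hzm hw⟩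
  have hI : IsCompact ((Subtype.val : Ioi (0 : ℝ) → ℝ) ⁻¹' Icc δ R) := by
    refine Topology.IsInducing.subtypeVal.isCompact_preimage_iff ?_ |>.2 isCompact_Icc
    rintro x ⟨hx, -⟩
    exact ⟨⟨x, mem_Ioi.2 (hδ.trans_le hx)⟩, rfl⟩
  obtain ⟨C, hC⟩ := (hK₁.prod hI).exists_bound_of_continuousOn hb.continuousOn
  refine integrable_radial_smul hh hK hKU
    hb.measurable.aestronglyMeasurable (C := C) (fun q hq hqK => ?_) hbK
  refine hC q ⟨⟨_, hqK, direction_radial hq.1⟩, ?_, ?_⟩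
  · rw [← norm_radial hq.1]; exact hδK _ hqK
  · rw [← norm_radial hq.1]; exact hR _ hqK

lemma integral_radial {F : Amb N → ℝ}
    (hF : AEStronglyMeasurable F (volume.restrict (upperSpace N))) :
    ∫ q, F (radial q) ∂((surface N).prod (Measure.volumeIoiPow N)) = ∫ z in upperSpace N, F z := by
  rw [← measurePreserving_radial.map_eq] at hF ⊢
  exact (integral_map continuous_radial.measurable.aemeasurable hF).symm

lemma lintegral_radial {F : Amb N → ℝ≥0∞} (hF : AEMeasurable F (volume.restrict (upperSpace N))) :
    ∫⁻ q, F (radial q) ∂((surface N).prod (Measure.volumeIoiPow N)) =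
      ∫⁻ z in upperSpace N, F z := by
  rw [← measurePreserving_radial.map_eq] at hF ⊢
  exact (lintegral_map' hF continuous_radial.measurable.aemeasurable).symm

/-- Extending by a power of the radius keeps local integrability. -/
lemma locallyIntegrableOn_comp_direction {F : Type*} [NormedAddCommGroup F] [NormedSpace ℝ F]
    {h : Amb N → F} (hh : LocallyIntegrableOn h (hemisphere N) (sphereMeasure N)) (k : ℕ) :
    LocallyIntegrableOn (fun z => (‖z‖⁻¹ ^ k) • h (direction z)) (upperSpace N) := by
  rw [locallyIntegrableOn_iff isOpen_upperSpace.isLocallyClosed]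
  intro K hKU hK
  have hm : AEStronglyMeasurable (fun z => (‖z‖⁻¹ ^ k) • h (direction z))
      (volume.restrict (upperSpace N)) :=
    ((measurable_norm.inv.pow_const k).aestronglyMeasurable).smul
      (AEStronglyMeasurable.comp_quasiMeasurePreserving
        (μ := volume.restrict (upperSpace N)) (show AEStronglyMeasurable h (surface N) from
          hh.aestronglyMeasurable) quasiMeasurePreserving_direction)
  have h0 : IntegrableOn (K.indicator fun z => (‖z‖⁻¹ ^ k) • h (direction z)) (upperSpace N) := by
    rw [IntegrableOn, ← measurePreserving_radial.integrable_comp (hm.indicator hK.measurableSet)]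
    have hcont : ContinuousOn (fun z : Amb N => ‖z‖⁻¹ ^ k) K := fun z hz =>
      ((continuous_norm.continuousAt.inv₀ (norm_ne_zero_iff.2
        (ne_zero_of_mem_upperSpace (hKU hz)))).pow k).continuousWithinAt
    obtain ⟨C, hC⟩ := hK.exists_bound_of_continuousOn hcont
    have h1 := integrable_radial_smul hh hK hKU
      (b := fun q => K.indicator (fun z : Amb N => ‖z‖⁻¹ ^ k) (radial q)) (C := C) ?_ ?_ ?_
    · refine h1.congr ?_
      filter_upwards [ae_radial_mem] with q hq
      show K.indicator (fun z : Amb N => ‖z‖⁻¹ ^ k) (radial q) • h q.1 =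
        K.indicator (fun z => (‖z‖⁻¹ ^ k) • h (direction z)) (radial q)
      by_cases hqK : radial q ∈ K
      · rw [indicator_of_mem hqK, indicator_of_mem hqK, direction_radial hq.1]
      · rw [indicator_of_notMem hqK, indicator_of_notMem hqK, zero_smul]
    · exact (((measurable_norm.inv.pow_const k).indicator hK.measurableSet).comp
        continuous_radial.measurable).aestronglyMeasurable
    · intro q _ hq
      rw [indicator_of_mem hq]
      exact hC _ hq
    · intro q hq
      rw [indicator_of_notMem hq]
  rw [IntegrableOn, integrable_indicator_iff hK.measurableSet, IntegrableOn,
    Measure.restrict_restrict hK.measurableSet, inter_eq_left.2 hKU] at h0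
  exact h0

end Radial

/-! ### From weak gradients on the hemisphere to weak gradients on the half-space -/

section WeakGradient

variable {N : ℕ}

/-- The tangential component of the constant field `c`, multiplied by the restriction to the unit
sphere of the `r`-dilate of `φ`. -/
def tangentialField (φ : Amb N → ℝ) (c : Amb N) (r : ℝ) (z : Amb N) : Amb N :=
  φ (r • z) • (c - ⟪c, z⟫ • z)

lemma isTestField_tangentialField {φ : Amb N → ℝ} (hφ : ContDiff ℝ ((⊤ : ℕ∞) : WithTop ℕ∞) φ)
    (hc : HasCompactSupport φ)
    (hU : tsupport φ ⊆ upperSpace N) (c : Amb N) {r : ℝ} (hr : 0 < r) :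
    IsTestField (tangentialField φ c r) := by
  have hsub : tsupport (tangentialField φ c r) ⊆ (fun z => r • z) ⁻¹' tsupport φ := by
    refine closure_minimal (fun z hz => ?_)
      ((isClosed_tsupport φ).preimage (continuous_const_smul r))
    refine subset_tsupport φ ?_
    intro h0
    exact hz (by simp [tangentialField, h0])
  refine ⟨?_, ?_, fun z hz => ?_, fun z hz => ?_⟩
  · have h1 : ContDiff ℝ ((⊤ : ℕ∞) : WithTop ℕ∞) fun z : Amb N => ⟪c, z⟫ :=
      contDiff_const.inner ℝ contDiff_id
    unfold tangentialField
    fun_prop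
  · have : IsCompact ((fun z : Amb N => r • z) ⁻¹' tsupport φ) :=
      (Homeomorph.smulOfNeZero r hr.ne').isClosedEmbedding.isCompact_preimage hc.isCompact
    exact this.of_isClosed_subset (isClosed_tsupport _) hsub
  · have := hU (hsub hz)
    simp only [upperSpace, mem_ofPred_eq, height_smul] at this
    exact (mul_pos_iff_of_pos_left hr).1 this
  · rw [tangentialField, inner_smul_right, inner_sub_right, inner_smul_right,
      real_inner_self_eq_norm_sq, hz, real_inner_comm]
    simp

lemma sum_single_eq (c : Amb N) : ∑ i, c i • EuclideanSpace.single i (1 : ℝ) = c := by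
  ext j
  simp [Finset.sum_apply, Pi.single_apply]

/-- The second term contains the derivative of `φ` in the radial direction, which is dealt with by
`integral_ray_eq_zero`. -/
lemma sphereDiv_tangentialField {φ : Amb N → ℝ} (hφ : ContDiff ℝ ((⊤ : ℕ∞) : WithTop ℕ∞) φ)
    (c : Amb N) (r : ℝ)
    {ω : Amb N} (hω : ‖ω‖ = 1) :
    sphereDiv (tangentialField φ c r) ω = r * fderiv ℝ φ (r • ω) c
      - ⟪c, ω⟫ * (r * fderiv ℝ φ (r • ω) ω + N * φ (r • ω)) := by
  set L := fderiv ℝ φ (r • ω)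
  have h1 : HasFDerivAt (fun z : Amb N => φ (r • z)) (r • L) ω := by
    have h2 : HasFDerivAt φ L (r • ω) :=
      (hφ.differentiable (by simp) _).hasFDerivAt
    have h3 : HasFDerivAt (fun z : Amb N => r • z) (r • ContinuousLinearMap.id ℝ (Amb N)) ω :=
      (hasFDerivAt_id (𝕜 := ℝ) ω).const_smul r
    have h4 : HasFDerivAt (fun z : Amb N => φ (r • z)) _ ω := h2.comp ω h3
    exact h4.congr_fderiv (by ext h; simp)
  have h5 : HasFDerivAt (fun z : Amb N => ⟪c, z⟫) (innerSL ℝ c) ω := (innerSL ℝ c).hasFDerivAt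
  have h6 := h1.smul ((h5.smul (hasFDerivAt_id (𝕜 := ℝ) ω)).const_sub c)
  have hD : ∀ h, fderiv ℝ (tangentialField φ c r) ω h =
      (r * L h) • (c - ⟪c, ω⟫ • ω) - φ (r • ω) • (⟪c, h⟫ • ω + ⟪c, ω⟫ • h) := fun h => by
    have h7 : HasFDerivAt (tangentialField φ c r) _ ω := h6
    rw [h7.fderiv]
    simp
    module
  have hL : ∀ v : Amb N, ∑ i, L (EuclideanSpace.single i 1) * v i = L v := fun v => by
    conv_rhs => rw [← sum_single_eq v]
    rw [map_sum]
    exact Finset.sum_congr rfl fun i _ => by rw [map_smul, smul_eq_mul, mul_comm]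
  have hcω : ∑ i, c i * ω i = ⟪c, ω⟫ := by
    rw [PiLp.inner_apply]
    exact Finset.sum_congr rfl fun i _ => by simp [mul_comm]
  have hcc : ∀ i, ⟪c, EuclideanSpace.single i (1 : ℝ)⟫ = c i := fun i => by
    simp [EuclideanSpace.inner_single_right]
  have htr : ∑ i, (fderiv ℝ (tangentialField φ c r) ω (EuclideanSpace.single i 1)) i =
      r * (L c - ⟪c, ω⟫ * L ω) - φ (r • ω) * (⟪c, ω⟫ + ⟪c, ω⟫ * (N + 1)) := by
    have : ∀ i, (fderiv ℝ (tangentialField φ c r) ω (EuclideanSpace.single i 1)) i =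
        r * (L (EuclideanSpace.single i 1) * c i) -
          r * ⟪c, ω⟫ * (L (EuclideanSpace.single i 1) * ω i) -
          φ (r • ω) * (c i * ω i) - φ (r • ω) * ⟪c, ω⟫ := fun i => by
      rw [hD, hcc]
      simp
      ring
    simp_rw [this]
    rw [Finset.sum_sub_distrib, Finset.sum_sub_distrib, Finset.sum_sub_distrib, ← Finset.mul_sum,
      ← Finset.mul_sum, ← Finset.mul_sum, hL, hL, hcω]
    simp
    ring
  have hωω : ⟪ω, ω⟫ = 1 := by rw [real_inner_self_eq_norm_sq, hω, one_pow]
  have hn : ⟪ω, fderiv ℝ (tangentialField φ c r) ω ω⟫ = -(2 * φ (r • ω) * ⟪c, ω⟫) := by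
    rw [hD]
    simp only [inner_sub_right, inner_smul_right, inner_add_right, hωω, real_inner_comm c ω]
    ring
  rw [sphereDiv, htr, hn]
  ring

/-- The radial part of the divergence of a compactly supported field has mean zero on rays. -/
lemma integral_ray_eq_zero {φ : Amb N → ℝ} (hφ : ContDiff ℝ ((⊤ : ℕ∞) : WithTop ℕ∞) φ)
    (hc : HasCompactSupport φ)
    (h0 : φ 0 = 0) {ω : Amb N} (hω : ‖ω‖ = 1) :
    ∫ r, (fderiv ℝ φ (r.1 • ω) ω + N * (r.1⁻¹ * φ (r.1 • ω))) ∂(Measure.volumeIoiPow N) = 0 := by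
  rw [integral_volumeIoiPow N fun r => fderiv ℝ φ (r • ω) ω + N * (r⁻¹ * φ (r • ω))]
  -- the integrand times `r^N` is the derivative of `r^N φ(r ω)`
  set f : ℝ → ℝ := fun r => r ^ N * φ (r • ω)
  have hf : ContDiff ℝ 1 f := by
    have : ContDiff ℝ 1 φ := hφ.of_le (by simp)
    fun_prop
  have hfc : HasCompactSupport f := by
    obtain ⟨R, hR⟩ := hc.isCompact.isBounded.exists_norm_le
    refine HasCompactSupport.intro (isCompact_Icc (a := -|R|) (b := |R|)) fun r hr => ?_
    have : r • ω ∉ tsupport φ := fun h => by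
      have h1 := (hR _ h).trans (le_abs_self R)
      rw [norm_smul, hω, mul_one] at h1
      exact hr (abs_le.1 h1)
    simp [f, image_eq_zero_of_notMem_tsupport this]
  have h1 := hfc.integral_Ioi_deriv_eq hf 0
  have h2 : f 0 = 0 := by simp [f, h0]
  rw [h2, neg_zero] at h1
  refine Eq.trans (setIntegral_congr_fun measurableSet_Ioi fun r hr => ?_) h1
  have hr' : r ≠ 0 := ne_of_gt hr
  have h3 : HasDerivAt (fun r : ℝ => φ (r • ω)) (fderiv ℝ φ (r • ω) ω) r := by
    have h4 : HasDerivAt (fun r : ℝ => r • ω) ((1 : ℝ) • ω) r := (hasDerivAt_id r).smul_const ω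
    have h5 := ((hφ.differentiable (by simp) (r • ω)).hasFDerivAt).comp_hasDerivAt r h4
    rwa [one_smul] at h5
  have h6 := (hasDerivAt_pow N r).mul h3
  have h7 : HasDerivAt f _ r := h6
  show r ^ N * (fderiv ℝ φ (r • ω) ω + N * (r⁻¹ * φ (r • ω))) = deriv f r
  rw [h7.deriv]
  rcases Nat.eq_zero_or_pos N with hN | hN
  · subst hN; simp
  · obtain ⟨n, rfl⟩ := Nat.exists_eq_succ_of_ne_zero hN.ne'
    simp only [Nat.succ_eq_add_one, Nat.add_sub_cancel, pow_succ]
    field_simp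
    ring

/-- The `0`-homogeneous extension of a weakly differentiable function on the hemisphere has a weak
gradient on the half-space. The tangential test fields give the identity on each sphere of radius
`r`; the radial part of `∇φ` contributes nothing, since it integrates to zero along rays. -/
lemma IsWeakGradient.hasWeakGradientOn {u : Amb N → ℝ} {G : Amb N → Amb N}
    (h : IsWeakGradient u G) : HasWeakGradientOn (upperSpace N) (fun z => u (direction z))
      (fun z => ‖z‖⁻¹ • G (direction z)) := by
  refine ⟨by simpa using locallyIntegrableOn_comp_direction h.locInt 0,
    by simpa using locallyIntegrableOn_comp_direction h.locInt_grad 1, fun φ hφ hc hU c => ?_⟩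
  set K := tsupport φ
  set κ := (surface N).prod (Measure.volumeIoiPow N)
  have hφK : ∀ q, radial q ∉ K → φ (radial q) = 0 := fun q hq => image_eq_zero_of_notMem_tsupport hq
  have hdK : ∀ q, radial q ∉ K → fderiv ℝ φ (radial q) = 0 := fun q hq =>
    image_eq_zero_of_notMem_tsupport fun h' => hq (tsupport_fderiv_subset ℝ h')
  have hφ0 : φ 0 = 0 := image_eq_zero_of_notMem_tsupport fun h' =>
    ne_zero_of_mem_upperSpace (hU h') rfl
  have hdc : Continuous (fderiv ℝ φ) := hφ.continuous_fderiv (by simp)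
  have hrad : Continuous (radial (N := N)) := continuous_radial
  have hinv : Continuous fun q : Amb N × Ioi (0 : ℝ) => (q.2.1)⁻¹ :=
    (continuous_subtype_val.comp continuous_snd).inv₀ fun q => ne_of_gt q.2.2
  have hint1 : Integrable (fun q => fderiv ℝ φ (radial q) c • u q.1) κ := by
    refine integrable_radial_smul_of_continuous h.locInt hc hU ?_ fun q hq => by rw [hdK q hq]; rfl
    exact (hdc.comp hrad).clm_apply continuous_const
  have hint2 : Integrable (fun q => (⟪c, q.1⟫ * (fderiv ℝ φ (radial q) q.1 +
      N * (q.2.1⁻¹ * φ (radial q)))) • u q.1) κ := by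
    refine integrable_radial_smul_of_continuous h.locInt hc hU ?_ fun q hq => ?_
    · exact (continuous_const.inner continuous_fst).mul
        (((hdc.comp hrad).clm_apply continuous_fst).add
          (continuous_const.mul (hinv.mul (hφ.continuous.comp hrad))))
    · rw [hdK q hq, hφK q hq]; simp
  have hint3 : Integrable (fun q => ⟪(q.2.1⁻¹ * φ (radial q)) • G q.1, c⟫) κ := by
    refine Integrable.inner_const ?_ c
    refine integrable_radial_smul_of_continuous h.locInt_grad hc hU
      (hinv.mul (hφ.continuous.comp hrad)) fun q hq => by rw [hφK q hq, mul_zero]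
  have hslice : ∀ r : Ioi (0 : ℝ),
      ∫ ω, (fderiv ℝ φ (radial (ω, r)) c • u ω - (⟪c, ω⟫ * (fderiv ℝ φ (radial (ω, r)) ω +
        N * (r.1⁻¹ * φ (radial (ω, r))))) • u ω) ∂(surface N) =
      -∫ ω, ⟪(r.1⁻¹ * φ (radial (ω, r))) • G ω, c⟫ ∂(surface N) := fun r => by
    have hr : r.1 ≠ 0 := ne_of_gt r.2
    have hb := h.byParts _ (isTestField_tangentialField hφ hc hU c r.2)
    have e1 : ∫ ω, u ω * sphereDiv (tangentialField φ c r) ω ∂(surface N) =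
        r.1 * ∫ ω, (fderiv ℝ φ (radial (ω, r)) c • u ω - (⟪c, ω⟫ * (fderiv ℝ φ (radial (ω, r)) ω +
        N * (r.1⁻¹ * φ (radial (ω, r))))) • u ω) ∂(surface N) := by
      rw [← integral_const_mul]
      refine integral_congr_ae ?_
      filter_upwards [ae_mem_hemisphere] with ω hω
      rw [sphereDiv_tangentialField hφ c r hω.1]
      simp only [radial, smul_eq_mul]
      field_simp
    have e2 : ∫ ω, ⟪G ω, tangentialField φ c r ω⟫ ∂(surface N) =
        r.1 * ∫ ω, ⟪(r.1⁻¹ * φ (radial (ω, r))) • G ω, c⟫ ∂(surface N) := by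
      rw [← integral_const_mul]
      refine integral_congr_ae ?_
      filter_upwards [h.tangent] with ω hω
      rw [tangentialField, inner_smul_right, inner_sub_right, inner_smul_right,
        real_inner_comm ω (G ω), hω, inner_smul_left]
      simp only [radial, conj_trivial]
      field_simp
      ring
    rw [e1, e2, ← mul_neg] at hb
    exact mul_left_cancel₀ hr hb
  have hzero : ∫ q, (⟪c, q.1⟫ * (fderiv ℝ φ (radial q) q.1 +
      N * (q.2.1⁻¹ * φ (radial q)))) • u q.1 ∂κ = 0 := by
    rw [integral_prod _ hint2]
    refine integral_eq_zero_of_ae ?_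
    filter_upwards [ae_mem_hemisphere] with ω hω
    have := integral_ray_eq_zero hφ hc hφ0 hω.1
    simp only [smul_eq_mul, Pi.zero_apply]
    rw [integral_mul_const, integral_const_mul]
    simp only [radial]
    rw [this, mul_zero, zero_mul]
  have hmain : ∫ q, fderiv ℝ φ (radial q) c • u q.1 ∂κ =
      -∫ q, ⟪(q.2.1⁻¹ * φ (radial q)) • G q.1, c⟫ ∂κ := by
    have e1 := integral_sub hint1 hint2
    rw [hzero, sub_zero] at e1
    rw [← e1]
    refine (integral_prod_symm _ (hint1.sub hint2)).trans ?_
    rw [integral_prod_symm _ hint3, ← integral_neg]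
    exact integral_congr_ae (Eventually.of_forall hslice)
  have hmu : AEStronglyMeasurable (fun z => u (direction z)) (volume.restrict (upperSpace N)) :=
    AEStronglyMeasurable.comp_quasiMeasurePreserving (show AEStronglyMeasurable u (surface N) from
      h.locInt.aestronglyMeasurable) quasiMeasurePreserving_direction
  have hmG : AEStronglyMeasurable (fun z => G (direction z)) (volume.restrict (upperSpace N)) :=
    AEStronglyMeasurable.comp_quasiMeasurePreserving (show AEStronglyMeasurable G (surface N) from
      h.locInt_grad.aestronglyMeasurable) quasiMeasurePreserving_direction
  have hin : ∀ z ∉ upperSpace N, z ∉ K := fun z hz hzK => hz (hU hzK)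
  have hres1 : ∫ z in upperSpace N, u (direction z) * fderiv ℝ φ z c =
      ∫ z, u (direction z) * fderiv ℝ φ z c :=
    setIntegral_eq_integral_of_forall_compl_eq_zero fun z hz => by
      rw [image_eq_zero_of_notMem_tsupport (f := fderiv ℝ φ) fun h' =>
        hin z hz (tsupport_fderiv_subset ℝ h')]
      simp
  have hres2 : ∫ z in upperSpace N, φ z * ⟪‖z‖⁻¹ • G (direction z), c⟫ =
      ∫ z, φ z * ⟪‖z‖⁻¹ • G (direction z), c⟫ :=
    setIntegral_eq_integral_of_forall_compl_eq_zero fun z hz => by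
      rw [image_eq_zero_of_notMem_tsupport (f := φ) (hin z hz), zero_mul]
  rw [← hres1, ← hres2, ← integral_radial, ← integral_radial]
  · refine Eq.trans (integral_congr_ae ?_) (hmain.trans (congrArg Neg.neg (integral_congr_ae ?_)))
    · filter_upwards [ae_radial_mem] with q hq
      rw [direction_radial hq.1, smul_eq_mul, mul_comm]
    · filter_upwards [ae_radial_mem] with q hq
      rw [direction_radial hq.1, norm_radial hq.1, inner_smul_left, inner_smul_left]
      simp only [conj_trivial]
      ring
  · refine hφ.continuous.aestronglyMeasurable.mul (AEStronglyMeasurable.inner ?_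
      aestronglyMeasurable_const)
    exact measurable_norm.inv.aestronglyMeasurable.smul hmG
  · exact hmu.mul (hdc.clm_apply continuous_const).aestronglyMeasurable

end WeakGradient

end FoliatedSchwarz

end
noncomputable section

namespace FoliatedSchwarz

open Filter Topology Metric
open scoped Pointwise NNReal RealInnerProductSpace

/-! ### The symmetrization as a rearrangement on parallels -/

section Parallels

variable {N : ℕ} [NeZero N]

omit [NeZero N] in
lemma slicePoint_eq_join (y : ℝ) (θ : Sph N) : slicePoint y θ = join (√(1 - y ^ 2) • θ.1) y := rfl

omit [NeZero N] in
@[simp] lemma height_slicePoint (y : ℝ) (θ : Sph N) : height (slicePoint y θ) = y := by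
  rw [slicePoint_eq_join, height_join]

lemma slicePole_eq_join (y : ℝ) :
    slicePole N y = join (√(1 - y ^ 2) • EuclideanSpace.single 0 1) y := by
  ext i
  have h0 : (0 : Fin (N + 1)) = Fin.castSucc 0 := Fin.castSucc_zero'.symm
  refine Fin.lastCases ?_ (fun j => ?_) i
  · have : Fin.last N ≠ 0 := by rw [h0]; exact (Fin.castSucc_lt_last 0).ne'
    simp [slicePole, this]
  · have h1 : j.castSucc ≠ Fin.last N := (Fin.castSucc_lt_last j).ne
    have h2 : j.castSucc = 0 ↔ j = 0 := by
      rw [h0]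
      exact Fin.castSucc_inj
    simp [slicePole, h1, h2]

omit [NeZero N] in
lemma slicePoint_mem_slice {y : ℝ} (hy : |y| ≤ 1) (θ : Sph N) : slicePoint y θ ∈ slice N y := by
  refine ⟨?_, height_slicePoint y θ⟩
  have hy2 : 0 ≤ 1 - y ^ 2 := by nlinarith [abs_le.1 hy]
  have h1 : ‖slicePoint y θ‖ ^ 2 = 1 := by
    rw [slicePoint_eq_join, norm_join_sq, norm_smul, norm_eq_of_mem_sphere, mul_one,
      Real.norm_of_nonneg (Real.sqrt_nonneg _), Real.sq_sqrt hy2]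
    ring
  exact (pow_eq_one_iff_of_nonneg (norm_nonneg _) two_ne_zero).1 h1

lemma dist_slicePoint_slicePole_sq {y : ℝ} (hy : |y| ≤ 1) (θ : Sph N) :
    dist (slicePoint y θ) (slicePole N y) ^ 2 = (1 - y ^ 2) * (2 - 2 * sphHeight θ) := by
  have hy2 : 0 ≤ 1 - y ^ 2 := by nlinarith [abs_le.1 hy]
  have hi : ⟪θ.1, EuclideanSpace.single 0 (1 : ℝ)⟫ = sphHeight θ := by
    simp [EuclideanSpace.inner_single_right, sphHeight]
  have hs : ‖(EuclideanSpace.single 0 1 : EuclideanSpace ℝ (Fin N))‖ = 1 := by simp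
  rw [dist_eq_norm, slicePoint_eq_join, slicePole_eq_join, join_sub, norm_join_sq, ← smul_sub,
    norm_smul, mul_pow, Real.norm_of_nonneg (Real.sqrt_nonneg _), Real.sq_sqrt hy2,
    norm_sub_sq_real, norm_eq_of_mem_sphere, hi, hs]
  ring

/-- On a parallel, the chordal distance to the centre is a decreasing function of the first
coordinate. -/
lemma dist_slicePoint_lt_iff {y : ℝ} (hy : |y| < 1) (θ θ' : Sph N) :
    dist (slicePoint y θ') (slicePole N y) < dist (slicePoint y θ) (slicePole N y) ↔
      sphHeight θ < sphHeight θ' := by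
  have hy2 : 0 < 1 - y ^ 2 := by nlinarith [abs_lt.1 hy]
  rw [← sq_lt_sq₀ dist_nonneg dist_nonneg, dist_slicePoint_slicePole_sq hy.le,
    dist_slicePoint_slicePole_sq hy.le, mul_lt_mul_iff_right₀ hy2]
  constructor <;> intro h <;> linarith

omit [NeZero N] in
lemma continuous_slicePoint (y : ℝ) : Continuous (slicePoint (N := N) y) := by
  refine (PiLp.continuous_toLp 2 _).comp (continuous_pi fun i => ?_)
  refine Fin.lastCases ?_ (fun j => ?_) i
  · simp only [Fin.snoc_last]; fun_prop
  · simp only [Fin.snoc_castSucc]; fun_prop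

omit [NeZero N] in
lemma measurableEmbedding_slicePoint {y : ℝ} (hy : |y| < 1) :
    MeasurableEmbedding (slicePoint (N := N) y) := by
  have hy2 : 0 < 1 - y ^ 2 := by nlinarith [abs_lt.1 hy]
  refine ((continuous_slicePoint y).isClosedEmbedding fun θ θ' h => ?_).measurableEmbedding
  ext i
  have := congrArg (fun z : Amb N => z i.castSucc) h
  simp only [slicePoint_eq_join, join_castSucc, PiLp.smul_apply, smul_eq_mul] at this
  exact mul_left_cancel₀ (Real.sqrt_pos.2 hy2).ne' this

omit [NeZero N] in
lemma sliceMeasure_apply {y : ℝ} (hy : |y| < 1) (A : Set (Amb N)) :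
    sliceMeasure N y A = ENNReal.ofReal (√(1 - y ^ 2) ^ (N - 1)) *
      sphMeasure N (slicePoint y ⁻¹' A) := by
  rw [sliceMeasure, Measure.smul_apply, (measurableEmbedding_slicePoint hy).map_apply, smul_eq_mul]

omit [NeZero N] in
lemma slicePoint_preimage_sliceBall {y : ℝ} (hy : |y| < 1) (r : ℝ) :
    slicePoint y ⁻¹' sliceBall N y r =
      {θ | dist (slicePoint y θ) (slicePole N y) ≤ r} := by
  ext θ
  simp [sliceBall, slicePoint_mem_slice hy.le]

/-- Membership of a point of a parallel in the symmetrized set, up to the null alternative that the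
cap through the point has exactly the measure of the set. -/
lemma slicePoint_mem_symmSet {y : ℝ} (hy : |y| < 1) (A : Set (Amb N)) (θ : Sph N) :
    (capMeasure (sphMeasure N) sphHeight θ < sphMeasure N (slicePoint y ⁻¹' A) →
      slicePoint y θ ∈ symmSet y A) ∧
    (slicePoint y θ ∈ symmSet y A →
      capMeasure (sphMeasure N) sphHeight θ ≤ sphMeasure N (slicePoint y ⁻¹' A)) := by
  have hy2 : 0 < 1 - y ^ 2 := by nlinarith [abs_lt.1 hy]
  set κ := ENNReal.ofReal (√(1 - y ^ 2) ^ (N - 1))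
  have hκ0 : κ ≠ 0 := (ENNReal.ofReal_pos.2 (pow_pos (Real.sqrt_pos.2 hy2) _)).ne'
  have hκ : κ ≠ ⊤ := ENNReal.ofReal_ne_top
  set m := sphMeasure N
  set d : Sph N → ℝ := fun θ => dist (slicePoint y θ) (slicePole N y) with hd
  have hcap : capMeasure m sphHeight θ = m {θ' | d θ' < d θ} := by
    simp only [capMeasure, hd, dist_slicePoint_lt_iff hy]
  set R : Set ℝ := {r | 0 ≤ r ∧ m (slicePoint y ⁻¹' A) ≤ m {θ' | d θ' ≤ r}} with hR
  have hrad : symmRadius y A = sInf R := by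
    refine congrArg sInf (ext fun r => and_congr_right fun _ => ?_)
    rw [sliceMeasure_apply hy, sliceMeasure_apply hy, slicePoint_preimage_sliceBall hy]
    exact ENNReal.mul_le_mul_iff_right hκ0 hκ
  have hmem : slicePoint y θ ∈ symmSet y A ↔ m (slicePoint y ⁻¹' A) ≠ 0 ∧ d θ ≤ sInf R := by
    show sliceMeasure N y A ≠ 0 ∧ slicePoint y θ ∈ slice N y ∩ closedBall _ (symmRadius y A) ↔ _
    rw [sliceMeasure_apply hy, mul_ne_zero_iff, hrad]
    exact ⟨fun h => ⟨h.1.2, h.2.2⟩, fun h => ⟨⟨hκ0, h.1⟩, slicePoint_mem_slice hy.le θ, h.2⟩⟩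
  have hbdd : BddBelow R := ⟨0, fun r hr => hr.1⟩
  rw [hmem, hcap]
  constructor
  · intro h
    refine ⟨(zero_le.trans_lt h).ne', le_csInf ?_ fun r hr => ?_⟩
    · obtain ⟨D, hD⟩ := (isCompact_range
        ((continuous_slicePoint (N := N) y).dist (continuous_const (y := slicePole N y)))).bddAbove
      refine ⟨max D 0, le_max_right _ _, measure_mono fun θ' _ => ?_⟩
      exact (hD (mem_range_self θ')).trans (le_max_left _ _)
    · by_contra! hlt
      refine absurd hr.2 (not_le.2 (lt_of_le_of_lt (measure_mono fun θ' hθ' => ?_) h))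
      exact lt_of_le_of_lt hθ' hlt
  · -- the open ball through `θ` is exhausted by closed balls of radius below the infimum
    rintro ⟨-, hle⟩
    obtain ⟨s, hs, hslt, hst⟩ := exists_seq_strictMono_tendsto (d θ)
    have hU : {θ' | d θ' < d θ} = ⋃ n, {θ' | d θ' ≤ s n} := by
      have := iUnion_Iic_eq_Iio_of_lt_of_tendsto hslt hst
      have h2 := congrArg (fun S => d ⁻¹' S) this
      rw [preimage_iUnion] at h2
      exact h2.symm
    have hmono : Monotone fun n => {θ' | d θ' ≤ s n} := fun i j hij =>
      show {θ' | d θ' ≤ s i} ⊆ {θ' | d θ' ≤ s j} from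
        fun θ' hθ' => le_trans hθ' (hs.monotone hij)
    rw [hU, hmono.measure_iUnion]
    refine iSup_le fun n => ?_
    by_contra! hlt
    by_cases hn : 0 ≤ s n
    · exact absurd ((csInf_le hbdd ⟨hn, hlt.le⟩).trans_lt (hslt n)) (not_lt.2 hle)
    · have : {θ' | d θ' ≤ s n} = ∅ := by
        ext θ'
        simp only [mem_ofPred_eq, mem_empty_iff_false, iff_false, not_le]
        exact (not_le.1 hn).trans_le dist_nonneg
      rw [this, measure_empty] at hlt
      exact absurd hlt (not_lt.2 zero_le)

/-- In almost every point of a parallel, the symmetrization is the rearrangement. -/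
lemma symmetrization_slicePoint {y : ℝ} (hy : |y| < 1) {u : Amb N → ℝ} {f : Sph N → ℝ}
    (hf : Measurable f) (huf : ∀ᵐ θ ∂(sphMeasure N), u (slicePoint y θ) = f θ) {θ : Sph N}
    (hθ0 : capMeasure (sphMeasure N) sphHeight θ ≠ 0)
    (hθ : ∀ q : ℚ, capMeasure (sphMeasure N) sphHeight θ ≠ sphMeasure N {θ' | (q : ℝ) < f θ'}) :
    symmetrization u (slicePoint y θ) = rearr (sphMeasure N) sphHeight f θ := by
  have hlev : ∀ t : ℝ, sphMeasure N (slicePoint y ⁻¹' {w | t < u w}) =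
      sphMeasure N {θ | t < f θ} := fun t => by
    refine measure_congr ?_
    filter_upwards [huf] with θ hθ
    apply propext
    show t < u (slicePoint y θ) ↔ t < f θ
    rw [hθ]
  rw [symmetrization, height_slicePoint]
  refine sSup_eq_rearr hf hθ0 hθ ?_ ?_
  · rintro t ⟨ht, hlt⟩
    exact ⟨ht, (slicePoint_mem_symmSet hy _ θ).1 (by rwa [hlev])⟩
  · rintro t ⟨ht, hlt⟩
    exact ⟨ht, by rw [← hlev]; exact (slicePoint_mem_symmSet hy _ θ).2 hlt⟩

/-- The distance to the origin of the points of an orbit. -/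
def orbitNorm (b : OrbitBase) : ℝ := √(b.2.1 ^ 2 + b.1 ^ 2)

omit [NeZero N] in
lemma norm_cyl (w : OrbitBase × Sph N) : ‖cyl w‖ = orbitNorm w.1 := by
  rw [orbitNorm, ← Real.sqrt_sq (norm_nonneg (cyl w)), cyl, norm_join_sq, norm_smul,
    norm_eq_of_mem_sphere, mul_one, Real.norm_of_nonneg (le_of_lt w.1.2.2)]

omit [NeZero N] in
lemma height_cyl (w : OrbitBase × Sph N) : height (cyl w) = w.1.1 := height_join _ _

lemma abs_div_orbitNorm_lt_one (b : OrbitBase) : |b.1 / orbitNorm b| < 1 := by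
  have hρ : 0 < b.2.1 := b.2.2
  have h1 : 0 < orbitNorm b := Real.sqrt_pos.2 (by positivity)
  rw [abs_div, abs_of_pos h1, div_lt_one h1]
  exact Real.lt_sqrt_of_sq_lt (by rw [sq_abs]; nlinarith)

omit [NeZero N] in
lemma direction_cyl (w : OrbitBase × Sph N) :
    direction (cyl w) = slicePoint (w.1.1 / orbitNorm w.1) w.2 := by
  obtain ⟨⟨y, ρ⟩, θ⟩ := w
  have hρ : 0 < ρ.1 := ρ.2
  have h1 : 0 < ρ.1 ^ 2 + y ^ 2 := by positivity
  have h2 : √(1 - (y / orbitNorm (y, ρ)) ^ 2) = (orbitNorm (y, ρ))⁻¹ * ρ.1 := by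
    rw [div_pow, orbitNorm, Real.sq_sqrt h1.le, ← Real.sqrt_sq hρ.le, ← Real.sqrt_inv,
      ← Real.sqrt_mul (by positivity), Real.sqrt_sq hρ.le]
    congr 1
    field_simp
    ring
  rw [direction, norm_cyl, cyl, smul_join, slicePoint_eq_join, h2, smul_smul, div_eq_inv_mul]

/-- In cylindrical coordinates, the symmetrization is the rearrangement on the orbits. -/
lemma ae_symmetrization_direction_cyl (hN : 2 ≤ N) {u u' : Amb N → ℝ} (hu' : Measurable u')
    (huu' : u =ᵐ[surface N] u') :
    ∀ᵐ w ∂((orbitMeasure N).prod (sphMeasure N)), 0 < w.1.1 →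
      symmetrization u (direction (cyl w)) = starCyl (fun z => u' (direction z)) w := by
  have hm : Measurable fun w : OrbitBase × Sph N => u' (direction (cyl w)) :=
    hu'.comp (measurable_direction.comp measurable_cyl)
  have h1 : ∀ᵐ z ∂(volume : Measure (Amb N)), z ∈ upperSpace N →
      u (direction z) = u' (direction z) :=
    (ae_restrict_iff' isOpen_upperSpace.measurableSet).1
      (quasiMeasurePreserving_direction.ae huu')
  have h2 := Measure.ae_ae_of_ae_prod
    (measurePreserving_cyl.quasiMeasurePreserving.ae h1)
  filter_upwards [ae_prod_capMeasure_ne (β := orbitMeasure N) measurable_sphHeight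
    (sphMeasure_sphHeight_eq_zero hN) hm, Measure.quasiMeasurePreserving_fst.ae h2] with w hw hw2 hy
  have hms : Measurable fun θ : Sph N => u' (direction (cyl (w.1, θ))) :=
    hm.comp measurable_prodMk_left
  rw [direction_cyl]
  refine symmetrization_slicePoint (abs_div_orbitNorm_lt_one _) hms ?_ hw.1 hw.2
  filter_upwards [hw2] with θ hθ
  have := hθ (show 0 < height (cyl (w.1, θ)) by rwa [height_cyl])
  rwa [direction_cyl (w.1, θ)] at this ⊢

end Parallels

end FoliatedSchwarz

end
noncomputable section

namespace FoliatedSchwarz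

open Filter Topology Metric
open scoped Pointwise NNReal RealInnerProductSpace

/-! ### Transfer between the hemisphere and cylindrical coordinates -/

section Transfer

variable {N : ℕ}

/-- A smooth bump function of the radius, supported in `[1, 3]`. -/
def annulusBump : ContDiffBump (2 : ℝ) := ⟨1 / 2, 1, by norm_num, by norm_num⟩

lemma annulusBump_eq_zero {r : ℝ} (hr : r ≤ 1 ∨ 3 ≤ r) : annulusBump r = 0 := by
  refine annulusBump.zero_of_le_dist ?_
  show 1 ≤ dist r 2
  rw [Real.dist_eq]
  rcases hr with h | h
  · rw [abs_of_nonpos (by linarith)]; linarith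
  · rw [abs_of_nonneg (by linarith)]; linarith

lemma annulusBump_div_nonneg {r : ℝ} (hr : 0 ≤ r) : 0 ≤ annulusBump r / r :=
  div_nonneg annulusBump.nonneg hr

lemma annulusBump_div_le {r : ℝ} : annulusBump r / r ≤ 1 := by
  rcases le_or_gt r 1 with h | h
  · rw [annulusBump_eq_zero (Or.inl h), zero_div]
    exact zero_le_one
  · rw [div_le_one (by linarith)]
    exact annulusBump.le_one.trans h.le

/-- The mass of the radial weight in polar coordinates. -/
def annulusMass (N : ℕ) : ℝ≥0∞ :=
  ∫⁻ r, ENNReal.ofReal (annulusBump r.1 / r.1) ∂(Measure.volumeIoiPow N)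

lemma measurable_annulusBump_div : Measurable fun r : ℝ => annulusBump r / r :=
  annulusBump.continuous.measurable.div measurable_id

lemma annulusMass_ne_top : annulusMass N ≠ ⊤ := by
  have hle : annulusMass N ≤ Measure.volumeIoiPow N (Iio ⟨3, by norm_num⟩) := by
    rw [annulusMass, ← lintegral_indicator_one measurableSet_Iio]
    refine lintegral_mono fun r => ?_
    by_cases hr : r ∈ Iio (⟨3, by norm_num⟩ : Ioi (0 : ℝ))
    · rw [indicator_of_mem hr, Pi.one_apply]
      exact ENNReal.ofReal_le_one.2 annulusBump_div_le
    · rw [annulusBump_eq_zero (Or.inr (not_lt.1 fun h => hr (show r.1 < 3 from h)))]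
      simp
  refine ne_top_of_le_ne_top ?_ hle
  rw [Measure.volumeIoiPow_apply_Iio]
  exact ENNReal.ofReal_ne_top

lemma annulusMass_ne_zero : annulusMass N ≠ 0 := by
  intro h0
  have hm : Measurable fun r : Ioi (0 : ℝ) => ENNReal.ofReal (annulusBump r.1 / r.1) :=
    ENNReal.measurable_ofReal.comp (measurable_annulusBump_div.comp measurable_subtype_coe)
  have h1 := (lintegral_eq_zero_iff hm).1 h0
  set s : Ioi (0 : ℝ) := ⟨2, by norm_num⟩
  set t : Ioi (0 : ℝ) := ⟨5 / 2, by norm_num⟩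
  have h2 : Measure.volumeIoiPow N (Iio t \ Iio s) = 0 := by
    refine measure_mono_null (fun r hr => ?_) (ae_iff.1 h1)
    have hr1 : s.1 ≤ r.1 := not_lt.1 hr.2
    have hr1' : 2 ≤ r.1 := hr1
    have hr2 : r.1 < t.1 := hr.1
    have hr2' : r.1 < 5 / 2 := hr2
    have hb : annulusBump r.1 = 1 := by
      refine annulusBump.one_of_mem_closedBall ?_
      show dist r.1 2 ≤ 1 / 2
      rw [Real.dist_eq, abs_of_nonneg (by linarith)]
      linarith
    show ENNReal.ofReal (annulusBump r.1 / r.1) ≠ 0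
    rw [hb]
    exact (ENNReal.ofReal_pos.2 (by positivity)).ne'
  have hst : Iio s ⊆ Iio t := Iio_subset_Iio (Subtype.coe_le_coe.1 (by norm_num [s, t]))
  have h3 := measure_le_inter_add_sdiff (Measure.volumeIoiPow N) (Iio t) (Iio s)
  rw [h2, add_zero, inter_eq_right.2 hst, Measure.volumeIoiPow_apply_Iio,
    Measure.volumeIoiPow_apply_Iio, ENNReal.ofReal_le_ofReal_iff (by positivity)] at h3
  have h4 : ((2 : ℝ) ^ (N + 1)) < (5 / 2) ^ (N + 1) :=
    pow_lt_pow_left₀ (by norm_num) (by norm_num) (by simp)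
  have h5 : (0 : ℝ) < (N : ℝ) + 1 := by positivity
  exact absurd h3 (not_le.2 (div_lt_div_of_pos_right h4 h5))

lemma annulusMass_toReal :
    ∫ r, annulusBump r.1 / r.1 ∂(Measure.volumeIoiPow N) = (annulusMass N).toReal :=
  integral_eq_lintegral_of_nonneg_ae
    (Eventually.of_forall fun r => annulusBump_div_nonneg (le_of_lt r.2))
    (measurable_annulusBump_div.comp measurable_subtype_coe).aestronglyMeasurable

/-- Integrals over the hemisphere as integrals over a conical annulus. -/
lemma lintegral_annulus {h : Amb N → ℝ≥0∞} (hh : AEMeasurable h (surface N)) :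
    ∫⁻ z in upperSpace N, ENNReal.ofReal (annulusBump ‖z‖ / ‖z‖) * h (direction z) =
      annulusMass N * ∫⁻ ω, h ω ∂(surface N) := by
  have hm : AEMeasurable (fun z => ENNReal.ofReal (annulusBump ‖z‖ / ‖z‖) * h (direction z))
      (volume.restrict (upperSpace N)) :=
    (ENNReal.measurable_ofReal.comp
      (measurable_annulusBump_div.comp measurable_norm)).aemeasurable.mul
      (hh.comp_quasiMeasurePreserving quasiMeasurePreserving_direction)
  have hb : AEMeasurable (fun r : Ioi (0 : ℝ) => ENNReal.ofReal (annulusBump r.1 / r.1))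
      (Measure.volumeIoiPow N) := (ENNReal.measurable_ofReal.comp
    (measurable_annulusBump_div.comp measurable_subtype_coe)).aemeasurable
  rw [← lintegral_radial hm, mul_comm, annulusMass, ← lintegral_prod_mul hh hb]
  refine lintegral_congr_ae ?_
  filter_upwards [ae_radial_mem] with q hq
  rw [norm_radial hq.1, direction_radial hq.1, mul_comm]

lemma integral_annulus {h : Amb N → ℝ} (hh : AEStronglyMeasurable h (surface N)) :
    ∫ z in upperSpace N, annulusBump ‖z‖ / ‖z‖ * h (direction z) =
      (annulusMass N).toReal * ∫ ω, h ω ∂(surface N) := by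
  have hm : AEStronglyMeasurable (fun z => annulusBump ‖z‖ / ‖z‖ * h (direction z))
      (volume.restrict (upperSpace N)) :=
    (measurable_annulusBump_div.comp measurable_norm).aestronglyMeasurable.mul
      (hh.comp_quasiMeasurePreserving quasiMeasurePreserving_direction)
  rw [← integral_radial hm, mul_comm, ← annulusMass_toReal, ← integral_prod_mul]
  refine integral_congr_ae ?_
  filter_upwards [ae_radial_mem] with q hq
  rw [norm_radial hq.1, direction_radial hq.1, mul_comm]

variable [NeZero N]

omit [NeZero N] in
lemma injective_cyl : Function.Injective (cyl (N := N)) := by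
  rintro ⟨⟨y, ρ⟩, θ⟩ ⟨⟨y', ρ'⟩, θ'⟩ h
  have hy : y = y' := by simpa [cyl] using congrArg height h
  have hx : ρ.1 • θ.1 = ρ'.1 • θ'.1 := by
    ext i
    have := congrArg (fun z : Amb N => z i.castSucc) h
    simpa only [cyl, join_castSucc] using this
  have hρ : ρ = ρ' := by
    have := congrArg norm hx
    rw [norm_smul, norm_smul, norm_eq_of_mem_sphere, norm_eq_of_mem_sphere, mul_one, mul_one,
      Real.norm_of_nonneg (le_of_lt ρ.2), Real.norm_of_nonneg (le_of_lt ρ'.2)] at this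
    exact Subtype.ext this
  subst hy hρ
  have hθ : θ = θ' := Subtype.ext (smul_right_injective _ (ne_of_gt ρ.2) hx)
  rw [hθ]

lemma measurableEmbedding_cyl : MeasurableEmbedding (cyl (N := N)) := by
  have h1 : StandardBorelSpace (Ioi (0 : ℝ)) := measurableSet_Ioi.standardBorel
  have h2 : StandardBorelSpace (Sph N) := isClosed_sphere.measurableSet.standardBorel
  exact measurable_cyl.measurableEmbedding injective_cyl

/-- The symmetrization, composed with the radial projection, agrees almost everywhere in the
half-space with a measurable function. -/
lemma exists_measurable_ae_eq_symmetrization (hN : 2 ≤ N) {u u' : Amb N → ℝ}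
    (hu' : Measurable u') (huu' : u =ᵐ[surface N] u') :
    ∃ s : Amb N → ℝ, Measurable s ∧
      (fun z => symmetrization u (direction z)) =ᵐ[volume.restrict (upperSpace N)] s := by
  obtain ⟨s, hs, hsc⟩ := measurableEmbedding_cyl.exists_measurable_extend
    (measurable_starCyl (N := N) (hu'.comp measurable_direction)) (fun _ => ⟨0⟩)
  refine ⟨s, hs, (ae_restrict_iff' isOpen_upperSpace.measurableSet).2 ?_⟩
  rw [← measurePreserving_cyl.map_eq, measurableEmbedding_cyl.ae_map_iff]
  filter_upwards [ae_symmetrization_direction_cyl hN hu' huu'] with w hw hwU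
  have h1 := hw (by rwa [← height_cyl])
  rw [h1]
  exact (congrFun hsc w).symm

lemma aemeasurable_symmetrization (hN : 2 ≤ N) {u u' : Amb N → ℝ}
    (hu' : Measurable u') (huu' : u =ᵐ[surface N] u') :
    AEMeasurable (symmetrization u) (surface N) := by
  obtain ⟨s, hs, hsu⟩ := exists_measurable_ae_eq_symmetrization hN hu' huu'
  have h1 := measurePreserving_radial.quasiMeasurePreserving.ae hsu
  obtain ⟨r, hr⟩ := exists_radius_of_ae (N := N) (h1.and ae_radial_mem)
  refine ⟨fun ω => s (r.1 • ω), hs.comp (measurable_const_smul r.1), ?_⟩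
  filter_upwards [hr] with ω hω
  have h2 : symmetrization u (direction (radial (ω, r))) = s (radial (ω, r)) := hω.1
  rwa [direction_radial (q := (ω, r)) hω.2.1] at h2

/-- Equimeasurability on the parallels: weighted square integrals are preserved. -/
lemma lintegral_sq_symmetrization (hN : 2 ≤ N) {u u' : Amb N → ℝ}
    (hu' : Measurable u') (hu0 : ∀ z, 0 ≤ u' z) (huu' : u =ᵐ[surface N] u') {p : ℝ → ℝ≥0∞}
    (hp : Measurable p) :
    ∫⁻ ω, p (height ω) * ENNReal.ofReal (symmetrization u ω ^ 2) ∂(surface N) =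
      ∫⁻ ω, p (height ω) * ENNReal.ofReal (u' ω ^ 2) ∂(surface N) := by
  have hpm : Measurable fun ω : Amb N => p (height ω) := hp.comp continuous_height.measurable
  have hum := aemeasurable_symmetrization hN hu' huu'
  have hm1 : AEMeasurable (fun ω => p (height ω) * ENNReal.ofReal (symmetrization u ω ^ 2))
      (surface N) := hpm.aemeasurable.mul (hum.pow_const 2).ennreal_ofReal
  have hm2 : AEMeasurable (fun ω => p (height ω) * ENNReal.ofReal (u' ω ^ 2)) (surface N) :=
    hpm.aemeasurable.mul (hu'.pow_const 2).ennreal_ofReal.aemeasurable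
  refine (ENNReal.mul_right_inj annulusMass_ne_zero (annulusMass_ne_top (N := N))).1 ?_
  rw [← lintegral_annulus hm1, ← lintegral_annulus hm2,
    ← lintegral_indicator isOpen_upperSpace.measurableSet,
    ← lintegral_indicator isOpen_upperSpace.measurableSet,
    ← measurePreserving_cyl.lintegral_comp_emb measurableEmbedding_cyl,
    ← measurePreserving_cyl.lintegral_comp_emb measurableEmbedding_cyl]
  set ũ : Amb N → ℝ := fun z => u' (direction z) with hũ
  have hũm : Measurable ũ := hu'.comp measurable_direction
  -- the common weight depends on the orbit only
  set P : OrbitBase → ℝ≥0∞ := fun b => if 0 < b.1 then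
    ENNReal.ofReal (annulusBump (orbitNorm b) / orbitNorm b) * p (b.1 / orbitNorm b) else 0
  have hon : Measurable orbitNorm := by unfold orbitNorm; fun_prop
  have hPm : Measurable P := by
    refine Measurable.ite (measurableSet_lt measurable_const measurable_fst) ?_ measurable_const
    exact (ENNReal.measurable_ofReal.comp (measurable_annulusBump_div.comp hon)).mul
      (hp.comp (measurable_fst.div hon))
  have hP1 : ∀ b : OrbitBase, 0 < b.1 → P b =
      ENNReal.ofReal (annulusBump (orbitNorm b) / orbitNorm b) * p (b.1 / orbitNorm b) :=
    fun b hb => if_pos hb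
  have hP0 : ∀ b : OrbitBase, ¬ 0 < b.1 → P b = 0 := fun b hb => if_neg hb
  have key : ∀ h : Amb N → ℝ, ∀ w : OrbitBase × Sph N, (upperSpace N).indicator (fun z =>
      ENNReal.ofReal (annulusBump ‖z‖ / ‖z‖) * (p (height (direction z)) *
        ENNReal.ofReal (h (direction z) ^ 2))) (cyl w) =
      P w.1 * ENNReal.ofReal (h (direction (cyl w)) ^ 2) := fun h w => by
    by_cases hw : 0 < w.1.1
    · have hwU : cyl w ∈ upperSpace N := by
        show 0 < height (cyl w)
        rwa [height_cyl]
      have hd : height (direction (cyl w)) = w.1.1 / orbitNorm w.1 := by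
        rw [direction_cyl, height_slicePoint]
      rw [indicator_of_mem hwU, norm_cyl, hd, hP1 _ hw, mul_assoc]
    · have hwU : cyl w ∉ upperSpace N := fun h' => hw (by
        have : 0 < height (cyl w) := h'
        rwa [height_cyl] at this)
      rw [indicator_of_notMem hwU, hP0 _ hw, zero_mul]
  simp only [key]
  have hsm : Measurable (starCyl ũ) := measurable_starCyl hũm
  have e1 : ∫⁻ w, P w.1 * ENNReal.ofReal (symmetrization u (direction (cyl w)) ^ 2)
        ∂((orbitMeasure N).prod (sphMeasure N)) =
      ∫⁻ w, P w.1 * ENNReal.ofReal (starCyl ũ w ^ 2) ∂((orbitMeasure N).prod (sphMeasure N)) := by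
    refine lintegral_congr_ae ?_
    filter_upwards [ae_symmetrization_direction_cyl hN hu' huu'] with w hw
    by_cases hy : 0 < w.1.1
    · rw [hw hy]
    · rw [hP0 _ hy, zero_mul, zero_mul]
  have hms : Measurable fun w : OrbitBase × Sph N => P w.1 * ENNReal.ofReal (starCyl ũ w ^ 2) :=
    (hPm.comp measurable_fst).mul (hsm.pow_const 2).ennreal_ofReal
  have hmu : Measurable fun w : OrbitBase × Sph N => P w.1 * ENNReal.ofReal (ũ (cyl w) ^ 2) :=
    (hPm.comp measurable_fst).mul ((hũm.comp measurable_cyl).pow_const 2).ennreal_ofReal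
  rw [e1, lintegral_prod _ hms.aemeasurable]
  refine Eq.trans (lintegral_congr fun b => ?_) (lintegral_prod _ hmu.aemeasurable).symm
  have hb : Measurable fun θ : Sph N => ũ (cyl (b, θ)) :=
    (hũm.comp measurable_cyl).comp measurable_prodMk_left
  have hbs : Measurable fun θ : Sph N => starCyl ũ (b, θ) := hsm.comp measurable_prodMk_left
  show ∫⁻ θ, P b * ENNReal.ofReal (starCyl ũ (b, θ) ^ 2) ∂(sphMeasure N) =
    ∫⁻ θ, P b * ENNReal.ofReal (ũ (cyl (b, θ)) ^ 2) ∂(sphMeasure N)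
  rw [lintegral_const_mul _ (hbs.pow_const 2).ennreal_ofReal,
    lintegral_const_mul _ (hb.pow_const 2).ennreal_ofReal]
  congr 1
  have l1 := lintegral_rpow_eq_lintegral_meas_lt_mul (sphMeasure N)
    (f := fun θ => starCyl ũ (b, θ)) (Eventually.of_forall fun θ => starCyl_nonneg _ _)
    hbs.aemeasurable two_pos
  have l2 := lintegral_rpow_eq_lintegral_meas_lt_mul (sphMeasure N)
    (f := fun θ => ũ (cyl (b, θ))) (Eventually.of_forall fun θ => hu0 _)
    hb.aemeasurable two_pos
  simp only [Real.rpow_two] at l1 l2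
  rw [l1, l2]
  congr 1
  refine setLIntegral_congr_fun measurableSet_Ioi fun t ht => ?_
  congr 1
  exact measure_lt_rearr measurable_sphHeight (sphMeasure_sphHeight_eq_zero hN) hb (le_of_lt ht)

end Transfer

end FoliatedSchwarz

end
noncomputable section

namespace FoliatedSchwarz

open Filter Topology Metric
open scoped Pointwise NNReal RealInnerProductSpace

/-! ### The dual energy bound on the hemisphere -/

section Fields

variable {N : ℕ}

lemma hasFDerivAt_norm_of_ne_zero {z : Amb N} (hz : z ≠ 0) :
    HasFDerivAt (fun z : Amb N => ‖z‖) (innerSL ℝ (direction z)) z := by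
  have h0 : ‖z‖ ≠ 0 := norm_ne_zero_iff.2 hz
  have h1 := (hasStrictFDerivAt_norm_sq z).hasFDerivAt.sqrt (pow_ne_zero 2 h0)
  simp only [Real.sqrt_sq (norm_nonneg _)] at h1
  refine h1.congr_fderiv ?_
  ext c
  simp [direction]
  field_simp

/-- A test field, extended homogeneously and cut off to a conical annulus. -/
def annulusField (X : Amb N → Amb N) (z : Amb N) : Amb N := annulusBump ‖z‖ • X (direction z)

lemma annulusField_eventuallyEq_zero (X : Amb N → Amb N) {z : Amb N} (hz : ‖z‖ < 1) :
    annulusField X =ᶠ[𝓝 z] fun _ => 0 := by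
  filter_upwards [(isOpen_lt continuous_norm continuous_const).mem_nhds hz] with w hw
  have hw' : ‖w‖ < 1 := hw
  rw [annulusField, annulusBump_eq_zero (Or.inl hw'.le), zero_smul]

lemma contDiff_annulusField {X : Amb N → Amb N} (hX : ContDiff ℝ 1 X) :
    ContDiff ℝ 1 (annulusField X) := by
  rw [contDiff_iff_contDiffAt]
  intro z
  rcases eq_or_ne z 0 with rfl | hz
  · exact contDiffAt_const.congr_of_eventuallyEq
      (annulusField_eventuallyEq_zero X (by simp))
  · have hn : ContDiffAt ℝ 1 (fun z : Amb N => ‖z‖) z := contDiffAt_norm ℝ hz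
    have hd : ContDiffAt ℝ 1 (direction (N := N)) z :=
      (hn.inv (norm_ne_zero_iff.2 hz)).smul contDiffAt_id
    exact (annulusBump.contDiff.contDiffAt.comp z hn).smul (hX.contDiffAt.comp z hd)

lemma hasCompactSupport_annulusField (X : Amb N → Amb N) :
    HasCompactSupport (annulusField X) := by
  refine HasCompactSupport.intro (isCompact_closedBall 0 3) fun z hz => ?_
  rw [mem_closedBall_zero_iff, not_le] at hz
  rw [annulusField, annulusBump_eq_zero (Or.inr hz.le), zero_smul]

/-- The ambient divergence of the extension is the spherical divergence of a tangential field. -/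
lemma ambDiv_annulusField {X : Amb N → Amb N} (hX : IsTestField X) (z : Amb N) :
    ambDiv (annulusField X) z = annulusBump ‖z‖ / ‖z‖ * sphereDiv X (direction z) := by
  rcases eq_or_ne z 0 with rfl | hz
  · rw [ambDiv, (annulusField_eventuallyEq_zero X (by simp)).fderiv_eq]
    simp
  have h0 : ‖z‖ ≠ 0 := norm_ne_zero_iff.2 hz
  set ω := direction z with hω
  have hω1 : ‖ω‖ = 1 := by
    rw [hω, direction, norm_smul, norm_inv, norm_norm, inv_mul_cancel₀ h0]
  have hn := hasFDerivAt_norm_of_ne_zero hz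
  have hb : HasDerivAt annulusBump (deriv annulusBump ‖z‖) ‖z‖ :=
    ((annulusBump.contDiff (n := 1)).differentiable one_ne_zero _).hasDerivAt
  have hbn : HasFDerivAt (fun z : Amb N => annulusBump ‖z‖) _ z := hb.comp_hasFDerivAt z hn
  have hi : HasFDerivAt (fun z : Amb N => ‖z‖⁻¹) _ z := (hasDerivAt_inv h0).comp_hasFDerivAt z hn
  have hd : HasFDerivAt (direction (N := N)) _ z := hi.smul (hasFDerivAt_id (𝕜 := ℝ) z)
  set D := fderiv ℝ X ω
  have hXd : HasFDerivAt X D ω :=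
    (hX.smooth.differentiable (by simp) _).hasFDerivAt
  have hXc : HasFDerivAt (fun z => X (direction z)) _ z := hXd.comp z hd
  have hY : HasFDerivAt (annulusField X) _ z := hbn.smul hXc
  have hD : ∀ c, fderiv ℝ (annulusField X) z c = (deriv annulusBump ‖z‖ * ⟪ω, c⟫) • X ω +
      (annulusBump ‖z‖ / ‖z‖) • (D c - ⟪ω, c⟫ • D ω) := fun c => by
    rw [hY.fderiv]
    have e1 : (‖z‖⁻¹ • c + (-(‖z‖ ^ 2)⁻¹ * ⟪ω, c⟫) • z) = ‖z‖⁻¹ • (c - ⟪ω, c⟫ • ω) := by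
      have e2 : ω = ‖z‖⁻¹ • z := hω
      conv_rhs => rw [smul_sub, smul_smul]
      rw [sub_eq_add_neg, ← neg_smul]
      nth_rewrite 3 [e2]
      rw [smul_smul]
      congr 2
      field_simp
    have e3 : D (‖z‖⁻¹ • c + (-(‖z‖ ^ 2)⁻¹ * ⟪ω, c⟫) • z) = ‖z‖⁻¹ • (D c - ⟪ω, c⟫ • D ω) := by
      rw [e1, map_smul, map_sub, map_smul]
    have e4 : annulusBump ‖z‖ • D (‖z‖⁻¹ • c + (-(‖z‖ ^ 2)⁻¹ * ⟪ω, c⟫) • z) +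
        (deriv annulusBump ‖z‖ * ⟪ω, c⟫) • X ω = (deriv annulusBump ‖z‖ * ⟪ω, c⟫) • X ω +
      (annulusBump ‖z‖ / ‖z‖) • (D c - ⟪ω, c⟫ • D ω) := by
      rw [e3, smul_smul, add_comm, div_eq_mul_inv]
    exact e4
  have hDe : ∀ i, ⟪ω, EuclideanSpace.single i (1 : ℝ)⟫ = ω i := fun i => by
    simp [EuclideanSpace.inner_single_right]
  have hinner : ∀ v : Amb N, ∑ i, ω i * v i = ⟪ω, v⟫ := fun v => by
    rw [PiLp.inner_apply]
    exact Finset.sum_congr rfl fun i _ => by simp [mul_comm]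
  rw [ambDiv, sphereDiv]
  have : ∀ i, (fderiv ℝ (annulusField X) z (EuclideanSpace.single i 1)) i =
      deriv annulusBump ‖z‖ * (ω i * X ω i) + annulusBump ‖z‖ / ‖z‖ *
        (D (EuclideanSpace.single i 1) i - ω i * D ω i) := fun i => by
    rw [hD, hDe]
    simp
    ring
  simp_rw [this]
  rw [Finset.sum_add_distrib, ← Finset.mul_sum, ← Finset.mul_sum, Finset.sum_sub_distrib, hinner,
    hinner, hX.tangent ω hω1]
  ring

lemma IsTestField.exists_height_le {X : Amb N → Amb N} (hX : IsTestField X) :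
    ∃ s₀ : ℝ, 0 < s₀ ∧ ∀ ω ∈ tsupport X, 2 * s₀ ≤ height ω := by
  rcases (tsupport X).eq_empty_or_nonempty with hE | hE
  · exact ⟨1, one_pos, by simp [hE]⟩
  · obtain ⟨z, hz, hzm⟩ :=
      hX.compact.isCompact.exists_isMinOn hE continuous_height.continuousOn
    have h0 : 0 < height z := hX.support hz
    exact ⟨height z / 2, half_pos h0, fun ω hω => by
      have : height z ≤ height ω := hzm hω
      linarith⟩

/-- The power weight, cut off continuously near zero. -/
lemma exists_continuous_cutoff_rpow (a : ℝ) {s₀ : ℝ} (hs₀ : 0 < s₀) :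
    ∃ ψ : ℝ → ℝ, Continuous ψ ∧ (∀ s, 0 ≤ ψ s) ∧ (∀ s, 0 < s → ψ s ≤ s ^ a) ∧
      (∀ s, 2 * s₀ ≤ s → ψ s = s ^ a) ∧ ∀ s, s ≤ s₀ → ψ s = 0 := by
  have hm : ∀ s : ℝ, 0 < max s s₀ := fun s => lt_max_of_lt_right hs₀
  have hz : ∀ s : ℝ, s ≤ s₀ → min 1 (max 0 ((s - s₀) / s₀)) * max s s₀ ^ a = 0 := fun s hs => by
    rw [max_eq_left (div_nonpos_of_nonpos_of_nonneg (by linarith) hs₀.le), min_eq_right zero_le_one,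
      zero_mul]
  refine ⟨fun s => min 1 (max 0 ((s - s₀) / s₀)) * max s s₀ ^ a, ?_, fun s => ?_, fun s hs => ?_,
    fun s hs => ?_, hz⟩
  · refine Continuous.mul (by fun_prop) (Continuous.rpow_const (by fun_prop) fun s => ?_)
    exact Or.inl (hm s).ne'
  · exact mul_nonneg (le_min zero_le_one (le_max_left _ _)) (Real.rpow_nonneg (hm s).le a)
  · rcases le_total s s₀ with h | h
    · show min 1 (max 0 ((s - s₀) / s₀)) * max s s₀ ^ a ≤ s ^ a
      rw [hz s h]
      exact Real.rpow_nonneg hs.le a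
    · show min 1 (max 0 ((s - s₀) / s₀)) * max s s₀ ^ a ≤ s ^ a
      rw [max_eq_left h]
      exact mul_le_of_le_one_left (Real.rpow_nonneg hs.le a) (min_le_left _ _)
  · have h1 : 1 ≤ (s - s₀) / s₀ := by rw [le_div_iff₀ hs₀]; linarith
    show min 1 (max 0 ((s - s₀) / s₀)) * max s s₀ ^ a = s ^ a
    rw [max_eq_left (show s₀ ≤ s by linarith), max_eq_right (zero_le_one.trans h1), min_eq_left h1,
      one_mul]

/-- The weight on the half-space, of homogeneity `1`, and cut off to a conical annulus and away from
the boundary. The maximum only serves to make continuity at the origin evident. -/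
def annulusWeight (ψ : ℝ → ℝ) (z : Amb N) : ℝ :=
  annulusBump ‖z‖ * ‖z‖ * ψ (height z / max ‖z‖ 1)

/-- The density dual to the weight. -/
def annulusDual (a : ℝ) (X : Amb N → Amb N) (z : Amb N) : ℝ :=
  annulusBump ‖z‖ / ‖z‖ * (height (direction z) ^ (-a) * ‖X (direction z)‖ ^ 2)

lemma height_direction (z : Amb N) : height (direction z) = height z / ‖z‖ := by
  rw [direction, height_smul, div_eq_inv_mul]

lemma annulusWeight_eq (ψ : ℝ → ℝ) (z : Amb N) :
    annulusWeight ψ z = annulusBump ‖z‖ * ‖z‖ * ψ (height (direction z)) := by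
  rcases le_or_gt ‖z‖ 1 with h | h
  · rw [annulusWeight, annulusBump_eq_zero (Or.inl h), zero_mul, zero_mul, zero_mul]
  · rw [annulusWeight, max_eq_left h.le, height_direction]

lemma continuous_annulusWeight {ψ : ℝ → ℝ} (hψ : Continuous ψ) :
    Continuous (annulusWeight (N := N) ψ) := by
  have h1 : Continuous fun z : Amb N => height z / max ‖z‖ 1 :=
    continuous_height.div (by fun_prop) fun z => (lt_max_of_lt_right one_pos).ne'
  exact ((annulusBump.continuous.comp continuous_norm).mul continuous_norm).mul (hψ.comp h1)

lemma hasCompactSupport_annulusWeight (ψ : ℝ → ℝ) :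
    HasCompactSupport (annulusWeight (N := N) ψ) := by
  refine HasCompactSupport.intro (isCompact_closedBall 0 3) fun z hz => ?_
  rw [mem_closedBall_zero_iff, not_le] at hz
  rw [annulusWeight, annulusBump_eq_zero (Or.inr hz.le), zero_mul, zero_mul]

lemma height_pos_of_test_ne_zero {X : Amb N → Amb N} (hX : IsTestField X) {ω : Amb N}
    (hω : X ω ≠ 0) : 0 < height ω :=
  hX.support (subset_tsupport X hω)

lemma annulusDual_nonneg (a : ℝ) {X : Amb N → Amb N} (hX : IsTestField X) (z : Amb N) :
    0 ≤ annulusDual a X z := by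
  refine mul_nonneg (annulusBump_div_nonneg (norm_nonneg z)) ?_
  by_cases h : X (direction z) = 0
  · rw [h]; simp
  · exact mul_nonneg (Real.rpow_nonneg (height_pos_of_test_ne_zero hX h).le _) (sq_nonneg _)

/-- The extended test field is admissible: on its support the cut-off weight is the power weight,
and the factor `‖z‖` of the weight cancels the factor `‖z‖⁻¹` of the dual density. -/
lemma isWeightedField_annulus (a : ℝ) {X : Amb N → Amb N} (hX : IsTestField X) {s₀ : ℝ}
    (hs : ∀ ω ∈ tsupport X, 2 * s₀ ≤ height ω) {ψ : ℝ → ℝ} (hψ : Continuous ψ)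
    (hψ0 : ∀ s, 0 ≤ ψ s) (hψa : ∀ s, 2 * s₀ ≤ s → ψ s = s ^ a) :
    IsWeightedField (annulusField X) (annulusWeight ψ) (annulusDual a X) where
  smooth := contDiff_annulusField (hX.smooth.of_le (by simp))
  compact := hasCompactSupport_annulusField X
  measurable_weight := (continuous_annulusWeight hψ).measurable
  weight_nonneg z :=
    mul_nonneg (mul_nonneg annulusBump.nonneg (norm_nonneg z)) (hψ0 _)
  weight_refl e z := by
    rw [annulusWeight, annulusWeight, height_ambRefl, LinearIsometryEquiv.norm_map]
  dual_nonneg := annulusDual_nonneg a hX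
  sq_le z := by
    have hW : 0 ≤ annulusWeight ψ z :=
      mul_nonneg (mul_nonneg annulusBump.nonneg (norm_nonneg z)) (hψ0 _)
    by_cases hb : annulusBump ‖z‖ • X (direction z) = 0
    · rw [annulusField, hb, norm_zero, zero_pow two_ne_zero]
      exact mul_nonneg hW (annulusDual_nonneg a hX z)
    · rw [smul_eq_zero, not_or] at hb
      have h1 : 0 < ‖z‖ := by
        by_contra h
        exact hb.1 (annulusBump_eq_zero (Or.inl (by linarith)))
      have h2 := height_pos_of_test_ne_zero hX hb.2
      rw [annulusWeight_eq, hψa _ (hs _ (subset_tsupport X hb.2)), annulusDual, annulusField,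
        norm_smul, Real.rpow_neg h2.le, Real.norm_of_nonneg annulusBump.nonneg]
      have h3 : height (direction z) ^ a ≠ 0 := (Real.rpow_pos_of_pos h2 a).ne'
      refine le_of_eq ?_
      field_simp

/-- The homogeneous extension of a weak gradient is square integrable on compact subsets of the
half-space if the weighted energy is finite. -/
lemma lintegral_sq_gradient_ne_top {a : ℝ} {G : Amb N → Amb N}
    (hGm : AEStronglyMeasurable G (surface N)) (hG : weightedEnergy a G ≠ ⊤) {K : Set (Amb N)}
    (hK : IsCompact K) (hKU : K ⊆ upperSpace N) :
    ∫⁻ z in K, ‖‖z‖⁻¹ • G (direction z)‖ₑ ^ 2 ≠ ⊤ := by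
  have hcont : ContinuousOn (fun z : Amb N => ‖z‖⁻¹ ^ 2 * height (direction z) ^ (-a)) K := by
    intro z hz
    have h0 := ne_zero_of_mem_upperSpace (hKU hz)
    have h1 : ContinuousAt (direction (N := N)) z :=
      continuousOn_direction.continuousAt (isOpen_compl_singleton.mem_nhds h0)
    have h2 : height (direction z) ≠ 0 := (direction_mem_hemisphere (hKU hz)).2.ne'
    exact (((continuous_norm.continuousAt.inv₀ (norm_ne_zero_iff.2 h0)).pow 2).mul
      ((continuous_height.continuousAt.comp h1).rpow_const (Or.inl h2))).continuousWithinAt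
  obtain ⟨C, hC⟩ := hK.exists_bound_of_continuousOn hcont
  obtain ⟨R, hR⟩ := hK.isBounded.exists_norm_le
  set R' : Ioi (0 : ℝ) := ⟨|R| + 1, mem_Ioi.2 (by positivity)⟩
  have hgm : AEStronglyMeasurable (fun z => ‖z‖⁻¹ • G (direction z))
      (volume.restrict (upperSpace N)) :=
    measurable_norm.inv.aestronglyMeasurable.smul
      (hGm.comp_quasiMeasurePreserving quasiMeasurePreserving_direction)
  have hm : AEMeasurable (K.indicator fun z => ‖‖z‖⁻¹ • G (direction z)‖ₑ ^ 2)
      (volume.restrict (upperSpace N)) := (hgm.enorm.pow_const 2).indicator hK.measurableSet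
  have hE : AEMeasurable (fun ω => ENNReal.ofReal (height ω ^ a * ‖G ω‖ ^ 2)) (surface N) :=
    ((continuous_height.measurable.pow_const a).aemeasurable.mul
      (hGm.norm.aemeasurable.pow_const 2)).ennreal_ofReal
  have hI : AEMeasurable ((Iio R').indicator (1 : Ioi (0 : ℝ) → ℝ≥0∞)) (Measure.volumeIoiPow N) :=
    (measurable_one.indicator measurableSet_Iio).aemeasurable
  rw [← inter_eq_left.2 hKU, ← Measure.restrict_restrict hK.measurableSet,
    ← lintegral_indicator hK.measurableSet, ← lintegral_radial hm]
  refine ne_top_of_le_ne_top (b := ENNReal.ofReal C * (weightedEnergy a G *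
    Measure.volumeIoiPow N (Iio R'))) ?_ ?_
  · refine ENNReal.mul_ne_top ENNReal.ofReal_ne_top (ENNReal.mul_ne_top hG ?_)
    rw [Measure.volumeIoiPow_apply_Iio]
    exact ENNReal.ofReal_ne_top
  · rw [← lintegral_indicator_one measurableSet_Iio, weightedEnergy, ← lintegral_prod_mul hE hI,
      ← lintegral_const_mul' _ _ ENNReal.ofReal_ne_top]
    refine lintegral_mono_ae ?_
    filter_upwards [ae_radial_mem] with q hq
    by_cases hqK : radial q ∈ K
    · have h2 : q.2 ∈ Iio R' := by
        have := hR _ hqK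
        rw [norm_radial hq.1] at this
        exact Subtype.coe_lt_coe.1 (this.trans_lt ((le_abs_self R).trans_lt (lt_add_one _)))
      have h3 := (le_abs_self _).trans (hC _ hqK)
      have hpos : 0 < height q.1 ^ a := Real.rpow_pos_of_pos hq.2 a
      rw [direction_radial hq.1, Real.rpow_neg hq.2.le, ← div_eq_mul_inv,
        div_le_iff₀ hpos] at h3
      have hC0 : 0 ≤ C := (norm_nonneg _).trans (hC _ hqK)
      rw [indicator_of_mem hqK, indicator_of_mem h2, Pi.one_apply, mul_one, direction_radial hq.1,
        ← ENNReal.ofReal_mul hC0, ← ofReal_norm, ← ENNReal.ofReal_pow (norm_nonneg _)]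
      refine ENNReal.ofReal_le_ofReal ?_
      rw [norm_smul, mul_pow, ← mul_assoc, norm_inv, norm_norm]
      exact mul_le_mul_of_nonneg_right h3 (sq_nonneg _)
    · rw [indicator_of_notMem hqK]
      exact zero_le

variable [NeZero N]

/-- The dual form of the energy inequality: the distributional gradient of the symmetrization is
controlled, in the dual norm, by the weighted energy of the function. -/
theorem dual_energy_bound (hN : 2 ≤ N) {a : ℝ} {u u' : Amb N → ℝ} (hu' : Measurable u')
    (hu0 : ∀ z, 0 ≤ u' z) (huu' : u =ᵐ[surface N] u') {G : Amb N → Amb N}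
    (hG : IsWeakGradient u' G) (hA : weightedEnergy a G ≠ ⊤) {X : Amb N → Amb N}
    (hX : IsTestField X) :
    ENNReal.ofReal (-(2 * ∫ ω, symmetrization u ω * sphereDiv X ω ∂(surface N))) ≤
      weightedEnergy a G + weightedEnergy (-a) X := by
  obtain ⟨s₀, hs₀, hs⟩ := hX.exists_height_le
  obtain ⟨ψ, hψ, hψ0, hψle, hψa, hψz⟩ := exists_continuous_cutoff_rpow a hs₀
  have hY := isWeightedField_annulus a hX hs hψ hψ0 hψa
  have hGm : AEStronglyMeasurable G (surface N) := hG.locInt_grad.aestronglyMeasurable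
  have hw := hG.hasWeakGradientOn
  set ũ : Amb N → ℝ := fun z => u' (direction z) with hũ
  set g : Amb N → Amb N := fun z => ‖z‖⁻¹ • G (direction z) with hg
  set K : Set (Amb N) := closedBall 0 4 ∩ {z | s₀ / 2 ≤ height z} with hKdef
  have hKc : IsCompact K :=
    (isCompact_closedBall 0 4).inter_right (isClosed_le continuous_const continuous_height)
  have hKU : K ⊆ upperSpace N := fun z hz => lt_of_lt_of_le (half_pos hs₀) hz.2
  have hũm : Measurable ũ := hu'.comp measurable_direction
  have hũ0 : ∀ z, 0 ≤ ũ z := fun z => hu0 _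
  have hWmem : ∀ z : Amb N, annulusWeight ψ z ≠ 0 → 1 < ‖z‖ ∧ ‖z‖ < 3 ∧ s₀ < height z := by
    intro z hz
    rw [annulusWeight_eq] at hz
    have h1 : 1 < ‖z‖ := by
      by_contra h
      exact hz (by rw [annulusBump_eq_zero (Or.inl (not_lt.1 h)), zero_mul, zero_mul])
    refine ⟨h1, ?_, ?_⟩
    · by_contra h
      exact hz (by rw [annulusBump_eq_zero (Or.inr (not_lt.1 h)), zero_mul, zero_mul])
    · have h2 : s₀ < height (direction z) := by
        by_contra h
        exact hz (by rw [hψz _ (not_lt.1 h), mul_zero])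
      rw [height_direction, lt_div_iff₀ (by linarith)] at h2
      nlinarith
  have hWK : ∀ z : Amb N, annulusWeight ψ z ≠ 0 → closedBall z (min 1 (s₀ / 2)) ⊆ K := by
    intro z hz w hwz
    obtain ⟨h1, h2, h3⟩ := hWmem z hz
    rw [mem_closedBall, dist_eq_norm] at hwz
    have h4 := abs_height_le (w - z)
    have h5 : height (w - z) = height w - height z := by simp [height]
    have h6 := norm_le_norm_add_norm_sub' w z
    refine ⟨?_, ?_⟩
    · rw [mem_closedBall_zero_iff]
      linarith [hwz.trans (min_le_left _ _)]
    · show s₀ / 2 ≤ height w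
      rw [h5] at h4
      linarith [hwz.trans (min_le_right _ _), (abs_le.1 h4).1]
  have hfm : Measurable (K.indicator ũ) := hũm.indicator hKc.measurableSet
  -- the homogeneous extension is cut off to the compact set `K`, which does not affect the weight
  have key := star_energy_of_approx hN hfm (fun z => indicator_nonneg (fun z _ => hũ0 z) z) hY
    (A := ∫⁻ t, ENNReal.ofReal (annulusWeight ψ t * ‖g t‖ ^ 2)) fun ε hε =>
      exists_lipschitz_approx hw hKc hKU hũ0 (lintegral_sq_gradient_ne_top hGm hA hKc hKU)
        hY.weight_nonneg (continuous_annulusWeight hψ) (hasCompactSupport_annulusWeight ψ)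
        (lt_min one_pos (half_pos hs₀)) hWK hε
  -- both energies are multiples of energies on the hemisphere
  have hE1 : ∫⁻ t, ENNReal.ofReal (annulusWeight ψ t * ‖g t‖ ^ 2) ≤
      annulusMass N * weightedEnergy a G := by
    have hE : AEMeasurable (fun ω => ENNReal.ofReal (height ω ^ a * ‖G ω‖ ^ 2)) (surface N) :=
      ((continuous_height.measurable.pow_const a).aemeasurable.mul
        (hGm.norm.aemeasurable.pow_const 2)).ennreal_ofReal
    rw [weightedEnergy, ← lintegral_annulus hE,
      ← lintegral_indicator isOpen_upperSpace.measurableSet]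
    refine lintegral_mono fun z => ?_
    by_cases hz : annulusWeight ψ z = 0
    · show ENNReal.ofReal (annulusWeight ψ z * ‖g z‖ ^ 2) ≤ _
      rw [hz, zero_mul, ENNReal.ofReal_zero]
      exact zero_le
    · obtain ⟨h1, h2, h3⟩ := hWmem z hz
      have hzU : z ∈ upperSpace N := hs₀.trans h3
      have h4 := hψle _ (direction_mem_hemisphere hzU).2
      rw [indicator_of_mem hzU, ← ENNReal.ofReal_mul (annulusBump_div_nonneg (norm_nonneg z))]
      refine ENNReal.ofReal_le_ofReal ?_
      have h5 : annulusWeight ψ z * ‖g z‖ ^ 2 =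
          annulusBump ‖z‖ / ‖z‖ * (ψ (height (direction z)) * ‖G (direction z)‖ ^ 2) := by
        rw [annulusWeight_eq, hg, norm_smul, norm_inv, norm_norm]
        field_simp
      rw [h5]
      gcongr
      exact annulusBump_div_nonneg (norm_nonneg z)
  have hE2 : ∫⁻ z, ENNReal.ofReal (annulusDual a X z) ≤ annulusMass N * weightedEnergy (-a) X := by
    have hE : AEMeasurable (fun ω => ENNReal.ofReal (height ω ^ (-a) * ‖X ω‖ ^ 2)) (surface N) :=
      ((continuous_height.measurable.pow_const (-a)).mul
        (hX.smooth.continuous.norm.measurable.pow_const 2)).ennreal_ofReal.aemeasurable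
    rw [weightedEnergy, ← lintegral_annulus hE,
      ← lintegral_indicator isOpen_upperSpace.measurableSet]
    refine lintegral_mono fun z => ?_
    by_cases hz : z ∈ upperSpace N
    · rw [indicator_of_mem hz, ← ENNReal.ofReal_mul (annulusBump_div_nonneg (norm_nonneg z))]
      rfl
    · have h1 : X (direction z) = 0 := by
        by_contra h
        have := height_pos_of_test_ne_zero hX h
        rw [height_direction] at this
        exact hz ((div_pos_iff_of_pos_right ((norm_nonneg z).lt_of_ne fun h0 => by
          rw [← h0, div_zero] at this
          exact lt_irrefl _ this)).1 this)
      show ENNReal.ofReal (annulusBump ‖z‖ / ‖z‖ *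
        (height (direction z) ^ (-a) * ‖X (direction z)‖ ^ 2)) ≤ _
      rw [h1]
      simp
  -- the divergence is supported in `K`, where the cut-off is invisible
  have hdivK : ∀ z, ambDiv (annulusField X) z ≠ 0 → z ∈ K := by
    intro z hz
    rw [ambDiv_annulusField hX] at hz
    have h1 : 1 < ‖z‖ := by
      by_contra h
      exact hz (by rw [annulusBump_eq_zero (Or.inl (not_lt.1 h)), zero_div, zero_mul])
    have h2 : ‖z‖ < 3 := by
      by_contra h
      exact hz (by rw [annulusBump_eq_zero (Or.inr (not_lt.1 h)), zero_div, zero_mul])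
    have h3 : direction z ∈ tsupport X := by
      by_contra h
      refine hz ?_
      have h4 : fderiv ℝ X (direction z) = 0 :=
        image_eq_zero_of_notMem_tsupport fun h' => h (tsupport_fderiv_subset ℝ h')
      rw [sphereDiv, h4]
      simp
    have h5 := hs _ h3
    rw [height_direction, le_div_iff₀ (by linarith)] at h5
    refine ⟨by rw [mem_closedBall_zero_iff]; linarith, ?_⟩
    show s₀ / 2 ≤ height z
    nlinarith
  -- the left side is the same multiple of the integral over the hemisphere
  have hL : ∫ w, starCyl (K.indicator ũ) w * ambDiv (annulusField X) (cyl w)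
      ∂((orbitMeasure N).prod (sphMeasure N)) =
      (annulusMass N).toReal * ∫ ω, symmetrization u ω * sphereDiv X ω ∂(surface N) := by
    have hsm : AEStronglyMeasurable (fun ω => symmetrization u ω * sphereDiv X ω) (surface N) := by
      refine (aemeasurable_symmetrization hN hu' huu').aestronglyMeasurable.mul ?_
      have := hX.smooth.continuous_fderiv (by simp)
      have hc : Continuous (sphereDiv X) := by
        unfold sphereDiv
        fun_prop
      exact hc.aestronglyMeasurable
    rw [← integral_annulus hsm]
    have h1 : ∫ w, starCyl (K.indicator ũ) w * ambDiv (annulusField X) (cyl w)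
        ∂((orbitMeasure N).prod (sphMeasure N)) =
        ∫ w, symmetrization u (direction (cyl w)) * ambDiv (annulusField X) (cyl w)
          ∂((orbitMeasure N).prod (sphMeasure N)) := by
      refine integral_congr_ae ?_
      filter_upwards [ae_symmetrization_direction_cyl hN hu' huu'] with w hw
      by_cases hd : ambDiv (annulusField X) (cyl w) = 0
      · rw [hd, mul_zero, mul_zero]
      · have hK1 := hdivK _ hd
        have hpos : 0 < w.1.1 := by
          rw [← height_cyl]
          exact hKU hK1
        -- membership in `K` depends on the orbit only
        have hK2 : ∀ θ, cyl (w.1, θ) ∈ K := fun θ => by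
          refine ⟨?_, ?_⟩
          · rw [mem_closedBall_zero_iff, norm_cyl, ← norm_cyl w]
            exact mem_closedBall_zero_iff.1 hK1.1
          · show s₀ / 2 ≤ height (cyl (w.1, θ))
            rw [height_cyl, ← height_cyl w]
            exact hK1.2
        have h2 : starCyl (K.indicator ũ) w = starCyl ũ w := by
          show rearr (sphMeasure N) sphHeight (fun θ => K.indicator ũ (cyl (w.1, θ))) w.2 =
            rearr (sphMeasure N) sphHeight (fun θ => ũ (cyl (w.1, θ))) w.2
          congr 1
          funext θ
          exact indicator_of_mem (hK2 θ) _
        rw [h2, hw hpos]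
    rw [h1, measurePreserving_cyl.integral_comp measurableEmbedding_cyl
      (fun z => symmetrization u (direction z) * ambDiv (annulusField X) z),
      ← setIntegral_eq_integral_of_forall_compl_eq_zero (s := upperSpace N)]
    · refine integral_congr_ae (Eventually.of_forall fun z => ?_)
      show symmetrization u (direction z) * ambDiv (annulusField X) z = _
      rw [ambDiv_annulusField hX]
      ring
    · intro z hz
      have : ambDiv (annulusField X) z = 0 := by
        by_contra h
        exact hz (hKU (hdivK z h))
      rw [this, mul_zero]
  rw [hL] at key
  have h1 : -(2 * ((annulusMass N).toReal * ∫ ω, symmetrization u ω * sphereDiv X ω ∂(surface N))) =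
      (annulusMass N).toReal *
        -(2 * ∫ ω, symmetrization u ω * sphereDiv X ω ∂(surface N)) := by ring
  rw [h1, ENNReal.ofReal_mul ENNReal.toReal_nonneg, ENNReal.ofReal_toReal annulusMass_ne_top] at key
  refine (ENNReal.mul_le_mul_iff_right annulusMass_ne_zero (annulusMass_ne_top (N := N))).1 ?_
  refine key.trans ?_
  rw [mul_add]
  exact add_le_add hE1 hE2

end Fields

end FoliatedSchwarz

end
noncomputable section

namespace FoliatedSchwarz

open Filter Topology Metric
open scoped Pointwise NNReal RealInnerProductSpace

/-! ### The weighted Sobolev space -/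

section Sobolev

variable {N : ℕ}

lemma eLpNorm_two_sq {α F : Type*} [MeasurableSpace α] [NormedAddCommGroup F] (f : α → F)
    (μ : Measure α) : eLpNorm f 2 μ ^ 2 = ∫⁻ x, ‖f x‖ₑ ^ 2 ∂μ := by
  have := eLpNorm_nnreal_pow_eq_lintegral (f := f) (μ := μ) (p := 2) two_ne_zero
  simpa [ENNReal.rpow_two] using this

lemma measurable_height_rpow (a : ℝ) :
    Measurable fun z : Amb N => ENNReal.ofReal (height z ^ a) :=
  (continuous_height.measurable.pow_const a).ennreal_ofReal

lemma surface_absolutelyContinuous (a : ℝ) : surface N ≪ weighted N a := by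
  refine withDensity_absolutelyContinuous' (measurable_height_rpow a).aemeasurable ?_
  filter_upwards [ae_mem_hemisphere] with z hz
  exact (ENNReal.ofReal_pos.2 (Real.rpow_pos_of_pos hz.2 a)).ne'

lemma weighted_absolutelyContinuous (a : ℝ) : weighted N a ≪ surface N :=
  withDensity_absolutelyContinuous _ _

lemma lintegral_weighted (a : ℝ) (f : Amb N → ℝ≥0∞) :
    ∫⁻ z, f z ∂(weighted N a) = ∫⁻ z, ENNReal.ofReal (height z ^ a) * f z ∂(surface N) :=
  lintegral_withDensity_eq_lintegral_mul_non_measurable _ (measurable_height_rpow a)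
    (Eventually.of_forall fun _ => ENNReal.ofReal_lt_top) f

lemma memLp_weighted_iff {F : Type*} [NormedAddCommGroup F] {a : ℝ} {f : Amb N → F} :
    MemLp f 2 (weighted N a) ↔ AEStronglyMeasurable f (surface N) ∧
      ∫⁻ z, ENNReal.ofReal (height z ^ a) * ‖f z‖ₑ ^ 2 ∂(surface N) < ⊤ := by
  rw [← lintegral_weighted a fun z => ‖f z‖ₑ ^ 2, ← eLpNorm_two_sq, MemLp]
  refine and_congr ⟨fun h => h.mono_ac (surface_absolutelyContinuous a),
    fun h => h.mono_ac (weighted_absolutelyContinuous a)⟩ ?_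
  simp [ENNReal.pow_lt_top_iff]

lemma weightedEnergy_eq (a : ℝ) (G : Amb N → Amb N) :
    weightedEnergy a G = ∫⁻ z, ENNReal.ofReal (height z ^ a) * ‖G z‖ₑ ^ 2 ∂(surface N) := by
  refine lintegral_congr_ae ?_
  filter_upwards [ae_mem_hemisphere] with z hz
  rw [ENNReal.ofReal_mul (Real.rpow_nonneg hz.2.le a), ENNReal.ofReal_pow (norm_nonneg _),
    ofReal_norm]

lemma eLpNorm_sq_eq_weightedEnergy (a : ℝ) (G : Amb N → Amb N) :
    eLpNorm G 2 (weighted N a) ^ 2 = weightedEnergy a G := by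
  rw [eLpNorm_two_sq, lintegral_weighted, weightedEnergy_eq]

lemma memLp_weighted_iff_weightedEnergy {a : ℝ} {G : Amb N → Amb N} :
    MemLp G 2 (weighted N a) ↔ AEStronglyMeasurable G (surface N) ∧ weightedEnergy a G < ⊤ := by
  rw [memLp_weighted_iff, weightedEnergy_eq]

lemma locallyIntegrableOn_of_memLp_weighted {F : Type*} [NormedAddCommGroup F] {a : ℝ}
    {f : Amb N → F} (hf : MemLp f 2 (weighted N a)) :
    LocallyIntegrableOn f (hemisphere N) (sphereMeasure N) := by
  rw [locallyIntegrableOn_iff isLocallyClosed_hemisphere]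
  intro K hKS hK
  have hcont : ContinuousOn (fun z : Amb N => height z ^ (-a)) K := fun z hz =>
    (continuous_height.continuousAt.rpow_const (Or.inl (hKS hz).2.ne')).continuousWithinAt
  obtain ⟨C, hC⟩ := hK.exists_bound_of_continuousOn hcont
  have hle : (sphereMeasure N).restrict K ≤ ENNReal.ofReal C • weighted N a := by
    refine Measure.le_iff.2 fun s hs => ?_
    rw [Measure.restrict_apply hs, Measure.smul_apply, smul_eq_mul, weighted,
      withDensity_apply _ hs, ← lintegral_const_mul' _ _ ENNReal.ofReal_ne_top]
    have h1 : sphereMeasure N (s ∩ K) = ∫⁻ _ in s ∩ K, 1 ∂(surface N) := by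
      rw [setLIntegral_one, surface, Measure.restrict_apply (hs.inter hK.measurableSet),
        inter_eq_left.2 (inter_subset_right.trans hKS)]
    rw [h1]
    refine (setLIntegral_mono' (hs.inter hK.measurableSet) fun z hz => ?_).trans
      (lintegral_mono_set inter_subset_left)
    have h2 := (hKS hz.2).2
    have h3 := (le_abs_self _).trans (hC z hz.2)
    have h4 : 0 < height z ^ a := Real.rpow_pos_of_pos h2 a
    rw [← ENNReal.ofReal_mul ((norm_nonneg _).trans (hC z hz.2)), ← ENNReal.ofReal_one]
    refine ENNReal.ofReal_le_ofReal ?_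
    rwa [Real.rpow_neg h2.le, ← one_div, div_le_iff₀ h4] at h3
  exact (hf.of_measure_le_smul ENNReal.ofReal_ne_top hle).integrable one_le_two

/-- Two weak gradients of the same function agree almost everywhere. -/
lemma IsWeakGradient.ae_eq {u : Amb N → ℝ} {G G' : Amb N → Amb N} (h : IsWeakGradient u G)
    (h' : IsWeakGradient u G') : G =ᵐ[surface N] G' := by
  have w := h.hasWeakGradientOn
  have w' := h'.hasWeakGradientOn
  set g : Amb N → Amb N := fun z => ‖z‖⁻¹ • G (direction z)
  set g' : Amb N → Amb N := fun z => ‖z‖⁻¹ • G' (direction z)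
  have hint : ∀ (k : Amb N → Amb N), LocallyIntegrableOn k (upperSpace N) → ∀ φ : Amb N → ℝ,
      Continuous φ → HasCompactSupport φ → tsupport φ ⊆ upperSpace N →
      Integrable fun z => φ z • k z := fun k hk φ hφ hc hU => by
    have h1 : IntegrableOn k (tsupport φ) := hk.integrableOn_compact_subset hU hc
    refine
      (IntegrableOn.continuousOn_smul h1 hφ.continuousOn hc).integrable_of_forall_notMem_eq_zero
        fun z hz => ?_
    rw [image_eq_zero_of_notMem_tsupport hz, zero_smul]
  have hae := isOpen_upperSpace.ae_eq_zero_of_integral_contDiff_smul_eq_zero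
    (f := fun z => g z - g' z) (w.locInt_grad.sub w'.locInt_grad) fun φ hφ hc hU => by
      have i1 := hint g w.locInt_grad φ hφ.continuous hc hU
      have i2 := hint g' w'.locInt_grad φ hφ.continuous hc hU
      simp_rw [smul_sub]
      rw [integral_sub i1 i2, sub_eq_zero]
      refine ext_inner_left ℝ fun c => ?_
      rw [← integral_inner i1, ← integral_inner i2]
      simp_rw [inner_smul_right, real_inner_comm _ c]
      exact neg_injective ((w.byParts φ hφ hc hU c).symm.trans (w'.byParts φ hφ hc hU c))
  have h1 := measurePreserving_radial.quasiMeasurePreserving.ae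
    ((ae_restrict_iff' isOpen_upperSpace.measurableSet).2 hae)
  obtain ⟨r, hr⟩ := exists_radius_of_ae (h1.and ae_radial_mem)
  filter_upwards [hr] with ω hω
  have h2 : ‖radial (ω, r)‖⁻¹ • G (direction (radial (ω, r))) -
      ‖radial (ω, r)‖⁻¹ • G' (direction (radial (ω, r))) = 0 := hω.1
  rw [direction_radial (q := (ω, r)) hω.2.1, norm_radial (q := (ω, r)) hω.2.1, ← smul_sub,
    smul_eq_zero, sub_eq_zero] at h2
  exact h2.resolve_left (inv_ne_zero (ne_of_gt r.2))

end Sobolev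

/-! ### Representation of the distributional gradient -/

section Representation

variable {N : ℕ}

/-- A linear functional bounded by the norm of a linear map into a Hilbert space is represented by
a vector of that space. -/
lemma exists_riesz_representative {V H : Type*} [AddCommGroup V] [Module ℝ V]
    [NormedAddCommGroup H] [InnerProductSpace ℝ H] [CompleteSpace H] (J : V →ₗ[ℝ] H)
    (l : V →ₗ[ℝ] ℝ) {C : ℝ} (hC : 0 ≤ C) (hl : ∀ x, |l x| ≤ C * ‖J x‖) :
    ∃ F : H, (∀ x, l x = ⟪F, J x⟫) ∧ ‖F‖ ≤ C := by
  -- the bound shows that `l` factors through the range of `J`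
  obtain ⟨s, hs⟩ := LinearMap.exists_rightInverse_of_surjective J.rangeRestrict
    (LinearMap.range_eq_top.2 J.surjective_rangeRestrict)
  have hs' : ∀ y : J.range, J (s y) = y := fun y =>
    congrArg Subtype.val (LinearMap.congr_fun hs y)
  have hb : ∀ y : J.range, ‖(l ∘ₗ s) y‖ ≤ C * ‖y‖ := fun y => by
    have := hl (s y)
    rwa [hs'] at this
  obtain ⟨L, hL, hLn⟩ := exists_extension_norm_eq J.range ((l ∘ₗ s).mkContinuous C hb)
  refine ⟨(InnerProductSpace.toDual ℝ H).symm L, fun x => ?_, ?_⟩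
  · rw [InnerProductSpace.toDual_symm_apply]
    have h1 : L (J x) = l (s ⟨J x, LinearMap.mem_range_self J x⟩) := hL ⟨J x, _⟩
    have h2 := hl (x - s ⟨J x, LinearMap.mem_range_self J x⟩)
    rw [map_sub, map_sub, hs', sub_self, norm_zero, mul_zero] at h2
    rw [h1]
    exact sub_eq_zero.1 (abs_nonpos_iff.1 h2)
  · rw [LinearIsometryEquiv.norm_map, hLn]
    exact LinearMap.mkContinuous_norm_le _ hC _

/-- The space of test fields. -/
def testFields (N : ℕ) : Submodule ℝ (Amb N → Amb N) where
  carrier := {X | IsTestField X}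
  zero_mem' := ⟨contDiff_const, HasCompactSupport.zero, by simp, by simp⟩
  add_mem' {X Y} hX hY := ⟨hX.smooth.add hY.smooth, hX.compact.add hY.compact,
    (tsupport_add X Y).trans (union_subset hX.support hY.support), fun z hz => by
      rw [Pi.add_apply, inner_add_right, hX.tangent z hz, hY.tangent z hz, add_zero]⟩
  smul_mem' c X hX := ⟨hX.smooth.const_smul c, hX.compact.smul_left,
    (closure_mono (Function.support_const_smul_subset c X)).trans hX.support, fun z hz => by
      rw [Pi.smul_apply, inner_smul_right, hX.tangent z hz, mul_zero]⟩

lemma sphereDiv_add {X Y : Amb N → Amb N} (hX : IsTestField X) (hY : IsTestField Y) (z : Amb N) :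
    sphereDiv (X + Y) z = sphereDiv X z + sphereDiv Y z := by
  rw [sphereDiv, sphereDiv, sphereDiv, fderiv_add (hX.smooth.differentiable (by simp) z)
    (hY.smooth.differentiable (by simp) z)]
  simp only [add_apply, PiLp.add_apply, Finset.sum_add_distrib, inner_add_right]
  ring

lemma sphereDiv_smul (c : ℝ) {X : Amb N → Amb N} (hX : IsTestField X) (z : Amb N) :
    sphereDiv (c • X) z = c * sphereDiv X z := by
  rw [sphereDiv, sphereDiv, fderiv_const_smul (hX.smooth.differentiable (by simp) z)]
  simp only [smul_apply, PiLp.smul_apply, smul_eq_mul, ← Finset.mul_sum,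
    inner_smul_right]
  ring

lemma IsTestField.memLp {X : Amb N → Amb N} (hX : IsTestField X) (a : ℝ) :
    MemLp X 2 (weighted N a) := by
  rw [memLp_weighted_iff_weightedEnergy]
  refine ⟨hX.smooth.continuous.aestronglyMeasurable, ?_⟩
  have hcont : ContinuousOn (fun z : Amb N => height z ^ a * ‖X z‖ ^ 2) (tsupport X) := fun z hz =>
    ((continuous_height.continuousAt.rpow_const (Or.inl (hX.support hz).ne')).mul
      (hX.smooth.continuous.norm.pow 2).continuousAt).continuousWithinAt
  obtain ⟨C, hC⟩ := hX.compact.isCompact.exists_bound_of_continuousOn hcont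
  refine lt_of_le_of_lt (lintegral_mono (g := fun _ => ENNReal.ofReal (max C 0)) fun z => ?_) ?_
  · refine ENNReal.ofReal_le_ofReal ?_
    by_cases hz : z ∈ tsupport X
    · exact ((le_abs_self _).trans (hC z hz)).trans (le_max_left _ _)
    · rw [image_eq_zero_of_notMem_tsupport hz]
      simp
  · rw [lintegral_const]
    exact ENNReal.mul_lt_top ENNReal.ofReal_lt_top (measure_lt_top _ _)

lemma integrable_mul_sphereDiv {f : Amb N → ℝ}
    (hf : LocallyIntegrableOn f (hemisphere N) (sphereMeasure N)) {X : Amb N → Amb N}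
    (hX : IsTestField X) : Integrable (fun z => f z * sphereDiv X z) (surface N) := by
  have hc : Continuous (sphereDiv X) := by
    have := hX.smooth.continuous_fderiv (by simp)
    unfold sphereDiv
    fun_prop
  set K : Set (Amb N) := tsupport X ∩ sphere 0 1
  have hK : IsCompact K := hX.compact.isCompact.inter_right isClosed_sphere
  have hKS : K ⊆ hemisphere N := fun z hz => by
    rw [hemisphere_eq]
    exact ⟨hz.2, hX.support hz.1⟩
  have h1 : IntegrableOn (fun z => f z * sphereDiv X z) K (sphereMeasure N) :=
    (hf.integrableOn_compact_subset hKS hK).mul_continuousOn hc.continuousOn hK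
  have h2 : IntegrableOn (fun z => f z * sphereDiv X z) K (surface N) :=
    h1.mono_measure Measure.restrict_le_self
  refine h2.integrable_of_ae_notMem_eq_zero ?_
  filter_upwards [ae_mem_hemisphere] with z hz hzK
  have h3 : z ∉ tsupport X := fun h => hzK ⟨h, by simpa using hz.1⟩
  have h4 : fderiv ℝ X z = 0 :=
    image_eq_zero_of_notMem_tsupport fun h' => h3 (tsupport_fderiv_subset ℝ h')
  rw [sphereDiv, h4]
  simp

/-- A function whose distributional gradient is bounded in the dual norm has a weak gradient,
obtained from the Riesz representation theorem in `L²(y^(-a) dS)`. -/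
theorem exists_isWeakGradient_of_dual_bound {a : ℝ} {f : Amb N → ℝ}
    (hf : LocallyIntegrableOn f (hemisphere N) (sphereMeasure N)) {A : ℝ≥0∞} (hA : A ≠ ⊤)
    (hd : ∀ X, IsTestField X → ENNReal.ofReal (-(2 * ∫ z, f z * sphereDiv X z ∂(surface N))) ≤
      A + weightedEnergy (-a) X) :
    ∃ G, IsWeakGradient f G ∧ AEStronglyMeasurable G (surface N) ∧ weightedEnergy a G ≤ A := by
  set H := Lp (Amb N) 2 (weighted N (-a))
  have hmem : ∀ X : testFields N, IsTestField X.1 := fun X => X.2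
  let J : testFields N →ₗ[ℝ] H :=
    { toFun := fun X => ((hmem X).memLp (-a)).toLp X.1
      map_add' := fun X Y => MemLp.toLp_add _ _
      map_smul' := fun c X => MemLp.toLp_const_smul c _ }
  let l : testFields N →ₗ[ℝ] ℝ :=
    { toFun := fun X => -∫ z, f z * sphereDiv X.1 z ∂(surface N)
      map_add' := fun X Y => by
        have : ∀ z, f z * sphereDiv (X + Y : testFields N).1 z =
            f z * sphereDiv X.1 z + f z * sphereDiv Y.1 z := fun z => by
          rw [← mul_add, ← sphereDiv_add (hmem X) (hmem Y)]
          rfl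
        simp_rw [this]
        rw [integral_add (integrable_mul_sphereDiv hf (hmem X))
          (integrable_mul_sphereDiv hf (hmem Y)), neg_add]
      map_smul' := fun c X => by
        have : ∀ z, f z * sphereDiv (c • X : testFields N).1 z =
            c * (f z * sphereDiv X.1 z) := fun z => by
          rw [mul_left_comm, ← sphereDiv_smul c (hmem X)]
          rfl
        simp_rw [this]
        rw [integral_const_mul, ← mul_neg]
        rfl }
  have hJ : ∀ X : testFields N, weightedEnergy (-a) X.1 = ENNReal.ofReal (‖J X‖ ^ 2) := fun X => by
    rw [← eLpNorm_sq_eq_weightedEnergy, ENNReal.ofReal_pow (norm_nonneg _), ofReal_norm]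
    congr 1
    exact (Lp.enorm_toLp (f := X.1) ((hmem X).memLp (-a))).symm
  have hl : ∀ X, |l X| ≤ √A.toReal * ‖J X‖ := fun X => by
    -- replacing `X` by its multiples gives a nonnegative quadratic polynomial
    have hquad : ∀ t : ℝ, 0 ≤ ‖J X‖ ^ 2 * (t * t) + -(2 * l X) * t + A.toReal := fun t => by
      have h1 := hd _ (hmem (t • X))
      rw [hJ (t • X), map_smul, norm_smul, ← ENNReal.ofReal_toReal hA,
        ← ENNReal.ofReal_add ENNReal.toReal_nonneg (sq_nonneg _),
        ENNReal.ofReal_le_ofReal_iff (add_nonneg ENNReal.toReal_nonneg (sq_nonneg _))] at h1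
      have h2 : -(2 * ∫ z, f z * sphereDiv (t • X : testFields N).1 z ∂(surface N)) =
          2 * (t * l X) := by
        have h3 : l (t • X) = t * l X := by rw [map_smul, smul_eq_mul]
        rw [← h3, ← mul_neg]
        rfl
      rw [h2, mul_pow, Real.norm_eq_abs, sq_abs] at h1
      nlinarith
    have h4 := discrim_le_zero hquad
    rw [discrim] at h4
    refine abs_le_of_sq_le_sq ?_ (by positivity)
    rw [mul_pow, Real.sq_sqrt ENNReal.toReal_nonneg]
    nlinarith
  obtain ⟨F, hF, hFn⟩ := exists_riesz_representative J l (Real.sqrt_nonneg _) hl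
  have hFm : AEStronglyMeasurable F (surface N) :=
    (Lp.aestronglyMeasurable F).mono_ac (surface_absolutelyContinuous (-a))
  -- the tangential component of the representing field
  set T : Amb N → Amb N := fun z => F z - ⟪z, F z⟫ • z with hT
  have hTm : AEStronglyMeasurable T (surface N) :=
    hFm.sub (AEStronglyMeasurable.smul (AEStronglyMeasurable.inner (𝕜 := ℝ)
      aestronglyMeasurable_id hFm) aestronglyMeasurable_id)
  set G : Amb N → Amb N := fun z => height z ^ (-a) • T z with hG
  have hGm : AEStronglyMeasurable G (surface N) :=
    ((continuous_height.measurable.pow_const (-a)).aestronglyMeasurable).smul hTm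
  have hGE : weightedEnergy a G ≤ A := by
    have h1 : weightedEnergy a G ≤ weightedEnergy (-a) F := by
      refine lintegral_mono_ae ?_
      filter_upwards [ae_mem_hemisphere] with z hz
      refine ENNReal.ofReal_le_ofReal ?_
      have h2 : 0 < height z ^ a := Real.rpow_pos_of_pos hz.2 a
      have h3 : ‖T z‖ ^ 2 ≤ ‖F z‖ ^ 2 := by
        rw [hT, norm_sub_sq_real, inner_smul_right, norm_smul, hz.1, mul_one, Real.norm_eq_abs,
          sq_abs, real_inner_comm z (F z)]
        nlinarith [sq_nonneg ⟪z, F z⟫]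
      rw [hG, norm_smul, mul_pow, Real.rpow_neg hz.2.le, Real.norm_of_nonneg (by positivity)]
      have h4 : height z ^ a * ((height z ^ a)⁻¹ ^ 2 * ‖T z‖ ^ 2) =
          (height z ^ a)⁻¹ * ‖T z‖ ^ 2 := by field_simp
      rw [h4]
      gcongr
    refine h1.trans ?_
    rw [← eLpNorm_sq_eq_weightedEnergy, ← Lp.enorm_def, ← ofReal_norm,
      ← ENNReal.ofReal_pow (norm_nonneg _)]
    refine (ENNReal.ofReal_le_ofReal (pow_le_pow_left₀ (norm_nonneg _) hFn 2)).trans ?_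
    rw [Real.sq_sqrt ENNReal.toReal_nonneg, ENNReal.ofReal_toReal hA]
  have hGL : MemLp G 2 (weighted N a) :=
    memLp_weighted_iff_weightedEnergy.2 ⟨hGm, hGE.trans_lt hA.lt_top⟩
  refine ⟨G, ⟨hf, locallyIntegrableOn_of_memLp_weighted hGL, ?_, fun X hX => ?_⟩, hGm, hGE⟩
  · filter_upwards [ae_mem_hemisphere] with z hz
    rw [hG, hT, inner_smul_right, inner_sub_right, inner_smul_right, real_inner_self_eq_norm_sq,
      hz.1]
    ring
  · have h1 : -∫ z, f z * sphereDiv X z ∂(surface N) = ⟪F, J ⟨X, hX⟩⟫ := hF ⟨X, hX⟩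
    rw [← neg_eq_iff_eq_neg, h1, L2.inner_def]
    have h2 : ∫ z, ⟪F z, J ⟨X, hX⟩ z⟫ ∂(weighted N (-a)) =
        ∫ z, ⟪F z, X z⟫ ∂(weighted N (-a)) := by
      refine integral_congr_ae ?_
      filter_upwards [(hX.memLp (-a)).coeFn_toLp] with z hz
      exact congrArg (inner ℝ (F z)) hz
    rw [h2]
    refine (integral_withDensity_eq_integral_toReal_smul (measurable_height_rpow (-a))
      (Eventually.of_forall fun _ => ENNReal.ofReal_lt_top) _).trans (integral_congr_ae ?_)
    filter_upwards [ae_mem_hemisphere] with z hz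
    rw [ENNReal.toReal_ofReal (Real.rpow_nonneg hz.2.le _), smul_eq_mul, hG, hT, inner_smul_left,
      inner_sub_left, inner_smul_left, hX.tangent z hz.1, mul_zero, sub_zero]
    rfl

end Representation

end FoliatedSchwarz

end
noncomputable section

namespace FoliatedSchwarz

open Filter Topology Metric
open scoped Pointwise NNReal RealInnerProductSpace

/-! ### The symmetrization in the weighted Sobolev space -/

section Symmetrization

variable {N : ℕ}

lemma IsWeakGradient.congr {u u' : Amb N → ℝ} {G : Amb N → Amb N} (h : IsWeakGradient u G)
    (huu' : u =ᵐ[surface N] u') : IsWeakGradient u' G where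
  locInt := by
    rw [locallyIntegrableOn_iff isLocallyClosed_hemisphere]
    intro K hKS hK
    refine (h.locInt.integrableOn_compact_subset hKS hK).congr ?_
    exact ae_restrict_of_ae_restrict_of_subset hKS huu'
  locInt_grad := h.locInt_grad
  tangent := h.tangent
  byParts X hX := by
    rw [← h.byParts X hX]
    refine integral_congr_ae ?_
    filter_upwards [huu'] with z hz
    rw [hz]

lemma exists_measurable_nonneg_ae_eq {u : Amb N → ℝ} (hu : AEStronglyMeasurable u (surface N))
    (hu0 : ∀ᵐ z ∂(surface N), 0 ≤ u z) :
    ∃ u' : Amb N → ℝ, Measurable u' ∧ (∀ z, 0 ≤ u' z) ∧ u =ᵐ[surface N] u' := by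
  refine ⟨fun z => max (hu.mk u z) 0, hu.stronglyMeasurable_mk.measurable.max measurable_const,
    fun z => le_max_right _ _, ?_⟩
  filter_upwards [hu0, hu.ae_eq_mk] with z h1 h2
  rw [← h2, max_eq_left h1]

variable [NeZero N]

lemma memLp_symmetrization (hN : 2 ≤ N) {a : ℝ} {u : Amb N → ℝ} (hu : MemLp u 2 (weighted N a))
    (hu0 : ∀ᵐ z ∂(surface N), 0 ≤ u z) : MemLp (symmetrization u) 2 (weighted N a) := by
  rw [memLp_weighted_iff] at hu ⊢
  obtain ⟨u', hu', hu'0, huu'⟩ := exists_measurable_nonneg_ae_eq hu.1 hu0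
  refine ⟨(aemeasurable_symmetrization hN hu' huu').aestronglyMeasurable, lt_of_eq_of_lt ?_ hu.2⟩
  have hsq : ∀ x : ℝ, ‖x‖ₑ ^ 2 = ENNReal.ofReal (x ^ 2) := fun x => by
    rw [← ofReal_norm, ← ENNReal.ofReal_pow (norm_nonneg _), Real.norm_eq_abs, sq_abs]
  simp_rw [hsq]
  rw [lintegral_sq_symmetrization hN hu' hu'0 huu' (p := fun s => ENNReal.ofReal (s ^ a))
    (measurable_id.pow_const a).ennreal_ofReal]
  refine lintegral_congr_ae ?_
  filter_upwards [huu'] with z hz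
  rw [hz]

/-- The dual energy bound and the Riesz representation give a weak gradient of the symmetrization
with at most the energy of the given one. -/
lemma exists_isWeakGradient_symmetrization (hN : 2 ≤ N) {a : ℝ} {u : Amb N → ℝ}
    (hu : MemLp u 2 (weighted N a)) (hu0 : ∀ᵐ z ∂(surface N), 0 ≤ u z) {G : Amb N → Amb N}
    (hG : IsWeakGradient u G) (hA : weightedEnergy a G ≠ ⊤) :
    ∃ G', IsWeakGradient (symmetrization u) G' ∧ AEStronglyMeasurable G' (surface N) ∧
      weightedEnergy a G' ≤ weightedEnergy a G := by
  obtain ⟨u', hu', hu'0, huu'⟩ :=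
    exists_measurable_nonneg_ae_eq (memLp_weighted_iff.1 hu).1 hu0
  exact exists_isWeakGradient_of_dual_bound
    (locallyIntegrableOn_of_memLp_weighted (memLp_symmetrization hN hu hu0)) hA
    fun X hX => dual_energy_bound hN hu' hu'0 huu' (hG.congr huu') hA hX

end Symmetrization

end FoliatedSchwarz

end
theorem mainTheorem5 (N : ℕ) (hN : 2 ≤ N) (a : ℝ) (ha : -1 < a) (ha' : a < 1)
    (u : FoliatedSchwarz.Amb N → ℝ) (hu : FoliatedSchwarz.MemH1 a u)
    (hu0 : ∀ᵐ z ∂(FoliatedSchwarz.surface N), 0 ≤ u z) :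
    FoliatedSchwarz.MemH1 a (FoliatedSchwarz.symmetrization u) ∧
    (∀ z ∈ FoliatedSchwarz.hemisphere N, 0 ≤ FoliatedSchwarz.symmetrization u z) ∧
    ∀ G G' : FoliatedSchwarz.Amb N → FoliatedSchwarz.Amb N,
      FoliatedSchwarz.IsWeakGradient u G →
      FoliatedSchwarz.IsWeakGradient (FoliatedSchwarz.symmetrization u) G' →
      FoliatedSchwarz.weightedEnergy a G' ≤ FoliatedSchwarz.weightedEnergy a G := by
  have : NeZero N := ⟨by omega⟩
  have key := fun G hG hA =>
    FoliatedSchwarz.exists_isWeakGradient_symmetrization hN hu.1 hu0 (G := G) hG hA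
  obtain ⟨hu2, G₀, hG₀, hG₀L⟩ := hu
  have hA₀ := (FoliatedSchwarz.memLp_weighted_iff_weightedEnergy.1 hG₀L).2.ne
  refine ⟨⟨FoliatedSchwarz.memLp_symmetrization hN hu2 hu0, ?_⟩,
    fun z _ => Real.sSup_nonneg fun t ht => ht.1, fun G G' hG hG' => ?_⟩
  · obtain ⟨G, hG, hGm, hGA⟩ := key G₀ hG₀ hA₀
    exact ⟨G, hG, FoliatedSchwarz.memLp_weighted_iff_weightedEnergy.2
      ⟨hGm, hGA.trans_lt hA₀.lt_top⟩⟩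
  · by_cases hA : FoliatedSchwarz.weightedEnergy a G = ⊤
    · rw [hA]; exact le_top
    · obtain ⟨G'', hG'', -, hGA⟩ := key G hG hA
      refine le_trans (le_of_eq ?_) hGA
      refine lintegral_congr_ae ?_
      filter_upwards [hG'.ae_eq hG''] with z hz
      rw [hz]
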